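/- Let $K$ be a field with an embedding $K\subset\mathbb R$. Let $\Gamma$ be a finite graph (parallel edges and self-loops allowed) with oriented edges $e_1,\dots,e_{2n}$, where $2n>0$, and write $h_1(G)$ for the rank of $H_1(G,\mathbb Z)$ for a subgraph $G$ given by a set of edges. Suppose that $\Gamma$ is primitive log divergent with $n$ loops: $h_1(\Gamma)=n$, $\#\mathrm{Edge}(\Gamma)=2n$, and $\#\mathrm{Edge}(G)>2h_1(G)$ for every non-empty proper subgraph $G\subsetneq\Gamma$. Let $\Psi_\Gamma(A_1,\dots,A_{2n})=\det\big(\sum_{i} A_i\, e_i^\vee(h_j)\,e_i^\vee(h_k)\big)_{j,k}$ be the graph polynomial, where $(h_j)$ is a $\mathbb Z$-basis of $H_1(\Gamma,\mathbb Z)=\ker(\partial:\mathbb Z[E]\to\mathbb Z[V])$, let $X_\Gamma\subset\mathbb P^{2n-1}_K$ be the hypersurface $\Psi_\Gamma=0$, and let $$\eta_\Gamma=\frac{\Omega_{2n-1}(A)}{\Psi_\Gamma^2},\qquad \Omega_{2n-1}(A)=\sum_{i=1}^{2n}(-1)^iA_i\,dA_1\wedge\cdots\wedge\widehat{dA_i}\wedge\cdots\wedge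 dA_{2n}.$$ A coordinate linear space is a linear subspace of $\mathbb P^{2n-1}$ defined by the vanishing of a set of the coordinates $A_i$. Then there is a tower $$P=P_r\to P_{r-1}\to\cdots\to P_1\to P_0=\mathbb P^{2n-1}$$ with composite $\pi:P\to\mathbb P^{2n-1}$, in which $P_i$ is the blowup of $P_{i-1}$ along the strict transform of a non-empty coordinate linear space $L_i\subset X_\Gamma$, such that, with $Y\subset P$ the strict transform of $X_\Gamma$: (i) $\pi^*\eta_\Gamma$ has no poles along the exceptional divisors of the blowups, i.e. it is regular at the generic point of every prime divisor of $P$ that lies over the centre of one of the blowups. (ii) Let $B\subset P$ be the total transform (inverse image, with reduced structure) of the union of coordinate hyperplanes $A_1A_2\cdots A_{2n}=0$. Then $B$ is a (simple) normal crossings divisor in $P$: at every point of $P$ the local ring is regular and $B$ is cut out by the product of some members of a regular system of parameters. No face of $B$ (non-empty intersection of one or more irreducible components of $B$) is contained in $Y$. (iii) Let $\sigma^{2n-1}(\mathbb R)\subset\mathbb P^{2n-1}(\mathbb R)$ be the set of points with a vector of homogeneous coordinates $\ge 0$. Its strict transform in $P$, i.e. the closure in $P(\mathbb R)$, for the Euclidean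 topology, of the inverse image of the part of $\sigma^{2n-1}(\mathbb R)$ that lies outside all the centres, does not meet $Y$. -/

import Mathlib

open scoped Classical

noncomputable section

namespace GraphMotive

section Graphs

/-- A multigraph (parallel edges and self-loops allowed) with vertices `V` and oriented edges `E`:
each edge exits the vertex `src e` and enters the vertex `tgt e`. -/
structure OrientedGraph (V E : Type*) where
  /-- the vertex which the edge exits -/
  src : E → V
  /-- the vertex which the edge enters -/
  tgt : E → V

variable {V E : Type*}

namespace OrientedGraph

/-- The boundary map `∂ : ℤ[E] → ℤ[V]`, `∂ e = ∑ v, sign (v, e) • v`. -/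
def boundary (Γ : OrientedGraph V E) : (E →₀ ℤ) →ₗ[ℤ] (V →₀ ℤ) :=
  Finsupp.linearCombination ℤ fun e => Finsupp.single (Γ.src e) 1 - Finsupp.single (Γ.tgt e) 1

/-- `H₁(Γ, ℤ) = ker ∂`. -/
def H1 (Γ : OrientedGraph V E) : Submodule ℤ (E →₀ ℤ) := LinearMap.ker Γ.boundary

/-- The first Betti number of the subgraph of `Γ` formed by the edges in `G`
(whose first homology is the part of `ker ∂` supported in `G`). -/
def h1 (Γ : OrientedGraph V E) (G : Finset E) : ℕ :=
  Module.finrank ℤ ↥(Γ.H1 ⊓ Finsupp.supported ℤ ℤ (G : Set E))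

/-- A subgraph, given by its set of edges, is convergent if it has more than `2 * h₁` edges. -/
def IsConvergent (Γ : OrientedGraph V E) (G : Finset E) : Prop := 2 * Γ.h1 G < G.card

/-- `Γ` is primitive log divergent with `n` loops and `2n` edges: every proper (non-empty)
subgraph is convergent. -/
structure IsPrimitiveLogDivergent [Fintype E] (Γ : OrientedGraph V E) (n : ℕ) : Prop where
  loops : Γ.h1 Finset.univ = n
  edges : Fintype.card E = 2 * n
  convergent : ∀ G : Finset E, G.Nonempty → G ≠ Finset.univ → Γ.IsConvergent G

/-- The graph polynomial: the determinant of `∑ e, A_e M_e`, where `M_e` is the symmetric matrix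
of the quadratic form `(e^∨)²` on `H₁(Γ, ℤ)` in a `ℤ`-basis `h_j` of `H₁(Γ, ℤ)`. A change of basis
multiplies it by `(± 1)² = 1`. -/
def graphPolynomial (K : Type*) [Field K] [Fintype E] (Γ : OrientedGraph V E) :
    MvPolynomial E K :=
  Matrix.det (Matrix.of fun j k : Module.Free.ChooseBasisIndex ℤ Γ.H1 =>
    ∑ e : E, MvPolynomial.X e * MvPolynomial.C
      ((((Module.Free.chooseBasis ℤ Γ.H1 j : E →₀ ℤ) e *
        (Module.Free.chooseBasis ℤ Γ.H1 k : E →₀ ℤ) e : ℤ)) : K))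

end OrientedGraph

end Graphs

/-! ### Varieties as models of their function field

An integral separated scheme `X` with function field `F` is determined by the set of its local
rings `𝒪_{X, x}`, which are local subrings of `F` (Zariski, Chevalley; EGA I, §8), and we represent
it by this set. A scheme-theoretic point of `X` is an element of the set, and

* `x` is a specialization of `y` if and only if `𝒪_{X, x} ⊆ 𝒪_{X, y}` in `F`;
* a birational morphism `X' → X` inducing the identity on `F` sends `S` to `R` if and only if
  `S` dominates `R`, that is `R ≤ S` in the order of `LocalSubring F`.

Subsets of `X`, in particular closed ones, are again sets of local subrings. -/

section Models

variable {F : Type*} [Field F]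

/-- The points of `Spec A`, for a subring `A` of `F`: the localizations of `A` at its primes. -/
def specModel (A : Subring F) : Set (LocalSubring F) :=
  {R | ∃ (p : Ideal A) (_ : p.IsPrime), R = LocalSubring.ofPrime A p}

/-- The rational function `f` is regular at the point `R` and vanishes there. -/
def VanishesAt (R : LocalSubring F) (f : F) : Prop :=
  ∃ h : f ∈ R.toSubring, (⟨f, h⟩ : R.toSubring) ∈ IsLocalRing.maximalIdeal R.toSubring

/-- The stalk at `R` of the radical ideal sheaf of a closed subset `W`: the functions
in the local ring `R` that vanish at all points of `W` of which `R` is a specialization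
(all of them are points of `Spec R`). It is the unit ideal if `R ∉ W`. -/
def vanishingIdeal (W : Set (LocalSubring F)) (R : LocalSubring F) : Ideal R.toSubring :=
  ⨅ (T : LocalSubring F) (_ : T ∈ W) (h : R.toSubring ≤ T.toSubring),
    (IsLocalRing.maximalIdeal T.toSubring).comap (Subring.inclusion h)

/-- The coordinate ring `R[I / x]` of an affine chart of the blowup of `Spec R` in the
ideal `I`, where `x ∈ I` is non-zero. -/
def blowupChart (R : Subring F) (I : Ideal R) (x : R) : Subring F :=
  Subring.closure ((R : Set F) ∪ {z | ∃ y ∈ I, z = (y : F) / (x : F)})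

/-- The blowup of `X` along the closed subset `Z` (with its reduced structure). -/
def blowup (X Z : Set (LocalSubring F)) : Set (LocalSubring F) :=
  {S | ∃ R ∈ X, ∃ x ∈ vanishingIdeal Z R, x ≠ 0 ∧
    S ∈ specModel (blowupChart R.toSubring (vanishingIdeal Z R) x)}

/-- The inverse image of the subset `W` under the birational morphism to a model containing `W`
from the model `X'`. -/
def inverseImage (X' W : Set (LocalSubring F)) : Set (LocalSubring F) :=
  {S | S ∈ X' ∧ ∃ R ∈ W, R ≤ S}

/-- The set of specializations in `X` of the points of `U`. It is the closure of `U` in `X` if `U`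
is locally closed (and `X` is Noetherian). -/
def closureIn (X U : Set (LocalSubring F)) : Set (LocalSubring F) :=
  {S | S ∈ X ∧ ∃ T ∈ U, S.toSubring ≤ T.toSubring}

/-- The strict transform of the closed subset `W` in the blowup `X'` of a model along `Z`: the
closure of the inverse image of `W \ Z`. -/
def strictTransform (X' Z W : Set (LocalSubring F)) : Set (LocalSubring F) :=
  closureIn X' (inverseImage X' (W \ Z))

/-- The result of a sequence of blowups starting with a given model. -/
structure Stage (F : Type*) [Field F] where
  /-- the variety that has been reached -/
  space : Set (LocalSubring F)
  /-- strict transforms of closed subsets of the initial variety -/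
  strict : Set (LocalSubring F) → Set (LocalSubring F)
  /-- the union of (the inverse images of) all exceptional divisors -/
  exceptional : Set (LocalSubring F)

/-- No blowup at all. -/
def Stage.initial (X : Set (LocalSubring F)) : Stage F where
  space := X
  strict W := W
  exceptional := ∅

/-- Blow up, in the variety that has been reached, the strict transform of `L`. -/
def Stage.next (P : Stage F) (L : Set (LocalSubring F)) : Stage F where
  space := blowup P.space (P.strict L)
  strict W := strictTransform (blowup P.space (P.strict L)) (P.strict L) (P.strict W)
  exceptional := inverseImage (blowup P.space (P.strict L)) (P.strict L ∪ P.exceptional)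

/-- `B` is a (simple) normal crossings divisor in `X`: at every point, the local ring of `X` is
regular and `B` is cut out by the product of some members of a regular system of parameters
(by the empty product `1` at points outside `B`). -/
def IsNormalCrossingsDivisor (X B : Set (LocalSubring F)) : Prop :=
  B ⊆ X ∧ ∀ R ∈ X, IsRegularLocalRing R.toSubring ∧
    ∃ (d : ℕ) (t : Fin d → R.toSubring), ringKrullDim R.toSubring = d ∧
      Ideal.span (Set.range t) = IsLocalRing.maximalIdeal R.toSubring ∧
      ∃ J : Finset (Fin d), vanishingIdeal B R = Ideal.span {∏ j ∈ J, t j}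

/-- The irreducible components of the closed subset `B` of `X`: the closures of the points
of `B` which are not specializations of other points of `B`. -/
def components (X B : Set (LocalSubring F)) : Set (Set (LocalSubring F)) :=
  {C | ∃ D ∈ B, (∀ T ∈ B, D.toSubring ≤ T.toSubring → T = D) ∧ C = closureIn X {D}}

/-- The faces of `B`: the non-empty intersections of (one or more) components. -/
def faces (X B : Set (LocalSubring F)) : Set (Set (LocalSubring F)) :=
  {C | C.Nonempty ∧ ∃ 𝒞 ⊆ components X B, 𝒞.Nonempty ∧ C = ⋂₀ 𝒞}

variable (K : Type*) [Field K] [Algebra K F]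

/-- The rational differential form `ω` of degree `m` is regular at the point `R`: it lies in the
image of `⋀^m Ω_{R/K}`, which is the `R`-span of the forms `d s₁ ∧ ⋯ ∧ d s_m`, `s_i ∈ R`. -/
def IsRegularFormAt {m : ℕ} (ω : ⋀[F]^m (Ω[F⁄K])) (R : LocalSubring F) : Prop :=
  ω ∈ Submodule.span R.toSubring
    {θ : ⋀[F]^m (Ω[F⁄K]) | ∃ s : Fin m → F, (∀ i, s i ∈ R.toSubring) ∧
      θ = exteriorPower.ιMulti F m fun i => KaehlerDifferential.D K F (s i)}

/-- A real point of the `K`-variety `X`, i.e. a `K`-morphism `Spec ℝ → X`: a point of `X` with a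
local homomorphism of `K`-algebras from its local ring to `ℝ`. -/
structure RealPoint [Algebra K ℝ] (X : Set (LocalSubring F)) where
  /-- the image of `Spec ℝ` -/
  point : LocalSubring F
  point_mem : point ∈ X
  /-- the value of regular functions -/
  eval : point.toSubring →+* ℝ
  isLocalHom_eval : IsLocalHom eval
  eval_algebraMap : ∀ (c : K) (h : algebraMap K F c ∈ point.toSubring),
    eval ⟨algebraMap K F c, h⟩ = algebraMap K ℝ c

/-- The Euclidean topology on the set of real points: the coarsest one for which
every rational function has an open domain in `X(ℝ)` and is continuous there. -/
instance [Algebra K ℝ] (X : Set (LocalSubring F)) : TopologicalSpace (RealPoint K X) :=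
  TopologicalSpace.generateFrom
    {U | ∃ (f : F) (O : Set ℝ), IsOpen O ∧
      U = {p | ∃ h : f ∈ p.point.toSubring, p.eval ⟨f, h⟩ ∈ O}}

end Models

section ProjectiveSpace

variable (K : Type*) [Field K] (m : ℕ)

/-- The function field `K(a_0, …, a_{m-1})` of `ℙ^m`, where `a_i = A_i / A_m` in terms of the
homogeneous coordinates `A_0, …, A_m`. -/
abbrev FunctionField : Type _ := FractionRing (MvPolynomial (Fin m) K)

/-- The rational function `A_j / A_m` on `ℙ^m`. -/
def affineCoord (j : Fin (m + 1)) : FunctionField K m :=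
  Fin.lastCases (motive := fun _ => FunctionField K m) 1
    (fun i => algebraMap (MvPolynomial (Fin m) K) (FunctionField K m) (MvPolynomial.X i)) j

/-- The rational function `A_i / A_j` on `ℙ^m`. -/
def coordRatio (i j : Fin (m + 1)) : FunctionField K m := affineCoord K m i / affineCoord K m j

/-- The coordinate ring `K[A_0 / A_j, …, A_m / A_j]` of the affine chart `A_j ≠ 0` of `ℙ^m`. -/
def chartRing (j : Fin (m + 1)) : Subring (FunctionField K m) :=
  (Algebra.adjoin K (Set.range fun i => coordRatio K m i j)).toSubring

/-- The projective space `ℙ^m` over `K`. -/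
def projectiveSpace : Set (LocalSubring (FunctionField K m)) :=
  ⋃ j, specModel (chartRing K m j)

/-- The closed subset of `ℙ^m` defined by a set of homogeneous polynomials in the coordinates:
those points `R` for which, on a chart `A_j ≠ 0` that contains `R`, all dehomogenized equations
vanish at `R`. -/
def zeroLocus (T : Set (MvPolynomial (Fin (m + 1)) K)) :
    Set (LocalSubring (FunctionField K m)) :=
  {R | ∃ j, R ∈ specModel (chartRing K m j) ∧
    (∀ G ∈ T, VanishesAt R (MvPolynomial.aeval (fun i => coordRatio K m i j) G))}

/-- The coordinate linear space `L : A_e = 0, e ∈ S`. -/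
def coordSubspace (S : Finset (Fin (m + 1))) : Set (LocalSubring (FunctionField K m)) :=
  zeroLocus K m (MvPolynomial.X '' (S : Set (Fin (m + 1))))

/-- The coordinate simplex `Δ : A_0 A_1 ⋯ A_m = 0`, the union of the coordinate hyperplanes. -/
def coordSimplex : Set (LocalSubring (FunctionField K m)) :=
  zeroLocus K m {∏ e, MvPolynomial.X e}

/-- The tower of blowups of `ℙ^m` that is obtained by blowing up, one after the other, the strict
transforms of the coordinate linear spaces given by the sets `S₁, …, S_r`. -/
def tower (S : List (Finset (Fin (m + 1)))) : Stage (FunctionField K m) :=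
  S.foldl (fun P s => P.next (coordSubspace K m s)) (Stage.initial (projectiveSpace K m))

/-- The image in `ℙ^m(ℝ)` of the real point `p` of a model that dominates `ℙ^m` has a vector of
non-negative homogeneous coordinates `(A_i / A_j)_i`, for some `j` with `A_j ≠ 0`. -/
def LiesOverPositiveSimplex [Algebra K ℝ] {X : Set (LocalSubring (FunctionField K m))}
    (p : RealPoint K X) : Prop :=
  ∃ j, ∀ i, ∃ h : coordRatio K m i j ∈ p.point.toSubring, 0 ≤ p.eval ⟨coordRatio K m i j, h⟩

/-- The strict transform of the simplex `σ^m(ℝ)` of real points with non-negative coordinates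
under a sequence of blowups of `ℙ^m`: the closure, in the real points, of the inverse image of the
part of `σ^m(ℝ)` outside the centres. -/
def strictPositiveSimplex [Algebra K ℝ] (P : Stage (FunctionField K m)) :
    Set (RealPoint K P.space) :=
  closure {p | LiesOverPositiveSimplex K m p ∧ p.point ∉ P.exceptional}

variable {V : Type*}

variable {m} in
/-- The graph hypersurface `X_Γ : Ψ_Γ = 0`. -/
def graphHypersurface (Γ : OrientedGraph V (Fin (m + 1))) :
    Set (LocalSubring (FunctionField K m)) :=
  zeroLocus K m {Γ.graphPolynomial K}

variable {m} in
/-- The rational form `η_Γ = Ω_m(A) / Ψ_Γ²` on `ℙ^m`, which is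
`d a_0 ∧ ⋯ ∧ d a_{m-1} / Ψ_Γ(a_0, …, a_{m-1}, 1)²` on the chart `A_m ≠ 0`. -/
def graphForm (Γ : OrientedGraph V (Fin (m + 1))) :
    ⋀[FunctionField K m]^m (Ω[FunctionField K m⁄K]) :=
  ((MvPolynomial.aeval (affineCoord K m) (Γ.graphPolynomial K)) ^ 2)⁻¹ •
    exteriorPower.ιMulti (FunctionField K m) m
      fun i => KaehlerDifferential.D K (FunctionField K m) (affineCoord K m i.castSucc)

end ProjectiveSpace

end GraphMotive

end

/-!
The tower blows up all coordinate linear spaces `L_S : A_e = 0 (e ∈ S)` for which the subgraph `S`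
has a cycle, in an order in which larger sets `S` come before smaller ones. The set of all edges,
for which `L_S` is empty, is not needed. If `S` has a cycle, the graph polynomial `Ψ` vanishes on
`L_S`, because each of its monomials involves an edge of `S`
(`coordSubspace_subset_graphHypersurface`).

All of this is toric. A stage of the tower that has blown up the sets of an upper set `𝓢` is the
blowup `ratioModel` of projective space in the product of the coordinate ideals
`(A_e : e ∈ S)`, `S ∈ 𝓢` (`IsBlowupOf`). It is covered by affine spaces (`exists_isAdapted`): for an
order `π` of the edges and a position `j` such that the sets of edges after position `i` are in `𝓢`
exactly for `i < j`, there is a chart with coordinates `z_i = A_{π(i+1)} / A_{π(min i j)}`. On such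
a chart the ideal of a further set `S` is a monomial times the ideal of a linear coordinate
subspace, which is the strict transform of `L_S`
(`isMultipleOfCoordIdeal_strictCoordSubspace`). Hence blowing up that strict transform amounts to
adding `S` to `𝓢` (`blowup_ratioModel`, `IsBlowupOf.next`), and `exists_tower` follows by induction.

The ratios `A_e / A_{π(0)}` are monomials in the chart coordinates (`div_eq_prod_chartCoord`): `z_i`
occurs in those with `e` in the set `S_i = vanishingEdges π j i`, and with exponent one. By the
Cauchy–Binet formula, `n! Ψ` is a sum of monomials, one for each choice of `n` edges, weighted with
the squares of minors. Such a monomial with non-zero weight is divisible by `z_i` at least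
`h₁(S_i)` times (`h1_le_card`), and the greedy choice of edges with respect to `π` attains equality
for all `i` at once (`exists_coordMatrix_adapted`). So `Ψ` is, up to the factor `n!`, the product of
`∏ z_i ^ h₁(S_i)` and a polynomial `f` with non-negative coefficients and positive constant term
(`exists_strict_equation`), and the strict transform of the graph hypersurface lies in `f = 0`
(`vanishesAt_of_mem_strict_graphHypersurface`). The three claims follow.

* Along `z_i = 0` the form has order `#S_i - 1 - 2 h₁(S_i)`, which is non-negative because `S_i` is
  a non-empty proper subgraph (`isRegularFormAt_graphForm`).
* The total transform of the simplex is the union of the hyperplanes `z_i = 0` of the charts. The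
  chart coordinates vanishing at a point are part of a regular system of parameters, by the Jacobian
  criterion (`isRegular_of_isLocAt_adjoin`). Each face contains the origin of a chart
  (`exists_origin_mem_face`), where `f` does not vanish.
* At real points of the strict transform of the positive simplex all `z_i` are non-negative
  (`eval_chartCoord_nonneg`), so that `f` is positive there (`aeval_pos`).
-/

namespace GraphMotive

/-! ### Local subrings of a field -/

section LocalSubrings

variable {F : Type*} [Field F]

theorem vanishesAt_iff {R : LocalSubring F} {f : F} :
    VanishesAt R f ↔ f ∈ R.toSubring ∧ (f ≠ 0 → f⁻¹ ∉ R.toSubring) := by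
  constructor
  · rintro ⟨h, hm⟩
    refine ⟨h, fun h0 hinv => ?_⟩
    refine (IsLocalRing.mem_maximalIdeal _).1 hm ?_
    exact .of_mul_eq_one ⟨f⁻¹, hinv⟩ (Subtype.ext (mul_inv_cancel₀ h0))
  · rintro ⟨h, hn⟩
    refine ⟨h, (IsLocalRing.mem_maximalIdeal _).2 fun hu => ?_⟩
    obtain ⟨v, hv⟩ := isUnit_iff_exists_inv.1 hu
    have hv' : f * (v : F) = 1 := congrArg Subtype.val hv
    refine hn (left_ne_zero_of_mul_eq_one hv') ?_
    rw [inv_eq_of_mul_eq_one_right hv']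
    exact v.2

theorem VanishesAt.mem {R : LocalSubring F} {f : F} (h : VanishesAt R f) : f ∈ R.toSubring := h.1

theorem vanishesAt_zero (R : LocalSubring F) : VanishesAt R 0 :=
  vanishesAt_iff.2 ⟨R.toSubring.zero_mem, fun h => absurd rfl h⟩

theorem not_vanishesAt_one (R : LocalSubring F) : ¬ VanishesAt R 1 := fun h =>
  (vanishesAt_iff.1 h).2 one_ne_zero (by simp [R.toSubring.one_mem])

theorem ne_zero_of_not_vanishesAt {R : LocalSubring F} {f : F} (h : ¬ VanishesAt R f) : f ≠ 0 := by
  rintro rfl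
  exact h (vanishesAt_zero R)

theorem inv_mem_of_not_vanishesAt {R : LocalSubring F} {f : F} (hf : f ∈ R.toSubring)
    (h : ¬ VanishesAt R f) : f⁻¹ ∈ R.toSubring := by
  by_contra hn
  exact h (vanishesAt_iff.2 ⟨hf, fun _ => hn⟩)

theorem not_vanishesAt_of_inv_mem {R : LocalSubring F} {f : F} (h0 : f ≠ 0)
    (h : f⁻¹ ∈ R.toSubring) : ¬ VanishesAt R f := fun hv => (vanishesAt_iff.1 hv).2 h0 h

theorem VanishesAt.add {R : LocalSubring F} {f g : F} (hf : VanishesAt R f)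
    (hg : VanishesAt R g) : VanishesAt R (f + g) := by
  obtain ⟨hf, hf'⟩ := hf
  obtain ⟨hg, hg'⟩ := hg
  exact ⟨add_mem hf hg, Ideal.add_mem _ hf' hg'⟩

theorem VanishesAt.mul_left {R : LocalSubring F} {f g : F} (hf : f ∈ R.toSubring)
    (hg : VanishesAt R g) : VanishesAt R (f * g) := by
  obtain ⟨hg, hg'⟩ := hg
  exact ⟨mul_mem hf hg, Ideal.mul_mem_left _ (⟨f, hf⟩ : R.toSubring) hg'⟩

theorem VanishesAt.mul_right {R : LocalSubring F} {f g : F} (hf : VanishesAt R f)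
    (hg : g ∈ R.toSubring) : VanishesAt R (f * g) := mul_comm g f ▸ hf.mul_left hg

theorem VanishesAt.sum {R : LocalSubring F} {ι : Type*} (s : Finset ι) (f : ι → F)
    (h : ∀ i ∈ s, VanishesAt R (f i)) : VanishesAt R (∑ i ∈ s, f i) := by
  induction s using Finset.induction_on with
  | empty => simpa using vanishesAt_zero R
  | insert a s ha ih =>
    rw [Finset.sum_insert ha]
    exact (h a (Finset.mem_insert_self _ _)).add (ih fun i hi => h i (Finset.mem_insert_of_mem hi))

theorem VanishesAt.or_of_mul {R : LocalSubring F} {f g : F} (hf : f ∈ R.toSubring)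
    (hg : g ∈ R.toSubring) (h : VanishesAt R (f * g)) : VanishesAt R f ∨ VanishesAt R g := by
  by_contra! hc
  refine not_vanishesAt_of_inv_mem (mul_ne_zero (ne_zero_of_not_vanishesAt hc.1)
    (ne_zero_of_not_vanishesAt hc.2)) ?_ h
  rw [mul_inv]
  exact mul_mem (inv_mem_of_not_vanishesAt hf hc.1) (inv_mem_of_not_vanishesAt hg hc.2)

theorem VanishesAt.of_pow {R : LocalSubring F} {f : F} (hf : f ∈ R.toSubring) {n : ℕ}
    (h : VanishesAt R (f ^ n)) : VanishesAt R f := by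
  induction n with
  | zero => exact absurd (by simpa using h) (not_vanishesAt_one R)
  | succ n ih =>
    rw [pow_succ] at h
    exact (h.or_of_mul (pow_mem hf n) hf).elim ih id

theorem VanishesAt.exists_of_prod {R : LocalSubring F} {ι : Type*} (s : Finset ι) (f : ι → F)
    (hf : ∀ i ∈ s, f i ∈ R.toSubring) (h : VanishesAt R (∏ i ∈ s, f i)) :
    ∃ i ∈ s, VanishesAt R (f i) := by
  induction s using Finset.induction_on with
  | empty => exact absurd (by simpa using h) (not_vanishesAt_one R)
  | insert a s ha ih =>
    rw [Finset.prod_insert ha] at h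
    have hs : ∀ i ∈ s, f i ∈ R.toSubring := fun i hi => hf i (Finset.mem_insert_of_mem hi)
    rcases h.or_of_mul (hf a (Finset.mem_insert_self _ _)) (prod_mem hs) with h | h
    · exact ⟨a, Finset.mem_insert_self _ _, h⟩
    · obtain ⟨i, hi, h⟩ := ih hs h
      exact ⟨i, Finset.mem_insert_of_mem hi, h⟩

theorem VanishesAt.of_prod_mem {R : LocalSubring F} {ι : Type*} {s : Finset ι} {f : ι → F}
    (hf : ∀ i ∈ s, f i ∈ R.toSubring) {i : ι} (hi : i ∈ s) (h : VanishesAt R (f i)) :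
    VanishesAt R (∏ i ∈ s, f i) := by
  rw [← Finset.mul_prod_erase _ _ hi]
  exact h.mul_right (prod_mem fun j hj => hf j (Finset.mem_of_mem_erase hj))

/-- A function vanishing at a point vanishes at its specializations. -/
theorem VanishesAt.of_le {R T : LocalSubring F} {f : F} (h : R.toSubring ≤ T.toSubring)
    (hf : f ∈ R.toSubring) (hT : VanishesAt T f) : VanishesAt R f :=
  vanishesAt_iff.2 ⟨hf, fun h0 hi => (vanishesAt_iff.1 hT).2 h0 (h hi)⟩

theorem vanishesAt_iff_of_dominates {R T : LocalSubring F} (h : R ≤ T) {f : F}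
    (hf : f ∈ R.toSubring) : VanishesAt T f ↔ VanishesAt R f := by
  refine ⟨fun hT => hT.of_le h.1 hf, fun hR => ?_⟩
  by_contra hT
  have hu : IsUnit (Subring.inclusion h.1 ⟨f, hf⟩) := by
    by_contra hu
    exact hT ⟨h.1 hf, (IsLocalRing.mem_maximalIdeal _).2 hu⟩
  obtain ⟨hf', hm⟩ := hR
  exact (IsLocalRing.mem_maximalIdeal _).1 hm (h.2.map_nonunit _ hu)

theorem dominates_iff {R T : LocalSubring F} :
    R ≤ T ↔ R.toSubring ≤ T.toSubring ∧ ∀ f, VanishesAt R f → VanishesAt T f := by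
  refine ⟨fun h => ⟨h.1, fun f hf => (vanishesAt_iff_of_dominates h hf.mem).2 hf⟩, ?_⟩
  rintro ⟨h, hv⟩
  refine ⟨h, ⟨fun f hu => ?_⟩⟩
  by_contra hn
  obtain ⟨h1, h2⟩ := hv f ⟨f.2, (IsLocalRing.mem_maximalIdeal _).2 hn⟩
  exact (IsLocalRing.mem_maximalIdeal _).1 h2 hu

theorem inv_mem_of_dominates {R T : LocalSubring F} (h : R ≤ T) {f : F} (hf : f ∈ R.toSubring)
    (h0 : f ≠ 0) (hT : f⁻¹ ∈ T.toSubring) : f⁻¹ ∈ R.toSubring :=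
  inv_mem_of_not_vanishesAt hf fun hv =>
    not_vanishesAt_of_inv_mem h0 hT ((vanishesAt_iff_of_dominates h hf).2 hv)

theorem mem_vanishingIdeal {W : Set (LocalSubring F)} {R : LocalSubring F} {f : R.toSubring} :
    f ∈ vanishingIdeal W R ↔
      ∀ T ∈ W, R.toSubring ≤ T.toSubring → VanishesAt T (f : F) := by
  simp only [vanishingIdeal, Ideal.mem_iInf, Ideal.mem_comap]
  exact ⟨fun h T hT hRT => ⟨hRT f.2, h T hT hRT⟩, fun h T hT hRT => (h T hT hRT).2⟩

/-- The local ring `T` is a localization of its subring `A`, that is, `T` is a point of `Spec A`. -/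
def IsLocAt (A : Subring F) (T : LocalSubring F) : Prop :=
  A ≤ T.toSubring ∧ ∀ t ∈ T.toSubring, ∃ a ∈ A, ∃ b ∈ A, ¬ VanishesAt T b ∧ t = a * b⁻¹

theorem mem_ofPrime_iff {A : Subring F} {p : Ideal A} [p.IsPrime] {t : F} :
    t ∈ (LocalSubring.ofPrime A p).toSubring ↔
      ∃ a ∈ A, ∃ b : A, b ∉ p ∧ t = a * (b : F)⁻¹ := by
  constructor
  · intro ht
    obtain ⟨⟨a, b⟩, hab⟩ := IsLocalization.surj p.primeCompl
      (⟨t, ht⟩ : (LocalSubring.ofPrime A p).toSubring)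
    have hab' : t * (b : A) = (a : F) := congrArg Subtype.val hab
    have hb0 : ((b : A) : F) ≠ 0 := fun h => b.2 (by
      rw [show (b : A) = 0 from Subtype.ext h]; exact p.zero_mem)
    exact ⟨a, a.2, b, b.2, by rw [← hab', mul_inv_cancel_right₀ hb0]⟩
  · rintro ⟨a, ha, b, hb, rfl⟩
    have hu := IsLocalization.map_units (LocalSubring.ofPrime A p).toSubring
      (⟨b, hb⟩ : p.primeCompl)
    obtain ⟨v, hv⟩ := isUnit_iff_exists_inv.1 hu
    have hv' : (b : F) * (v : F) = 1 := congrArg Subtype.val hv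
    rw [inv_eq_of_mul_eq_one_right hv']
    exact mul_mem (LocalSubring.le_ofPrime A p ha) v.2

theorem vanishesAt_ofPrime_iff {A : Subring F} {p : Ideal A} [p.IsPrime] (a : A) :
    VanishesAt (LocalSubring.ofPrime A p) (a : F) ↔ a ∈ p := by
  have h := IsLocalization.AtPrime.to_map_mem_maximal_iff (LocalSubring.ofPrime A p).toSubring p a
  rw [← h]
  exact ⟨fun ⟨_, h⟩ => h, fun h => ⟨LocalSubring.le_ofPrime A p a.2, h⟩⟩

theorem isLocAt_ofPrime {A : Subring F} (p : Ideal A) [p.IsPrime] :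
    IsLocAt A (LocalSubring.ofPrime A p) := by
  refine ⟨LocalSubring.le_ofPrime A p, fun t ht => ?_⟩
  obtain ⟨a, ha, b, hb, rfl⟩ := mem_ofPrime_iff.1 ht
  exact ⟨a, ha, b, b.2, fun h => hb ((vanishesAt_ofPrime_iff b).1 h), rfl⟩

/-- If `R` is a point of `Spec A` and `A` is contained in a local ring `R'`, and functions
in `A` that vanish at `R'` vanish at `R`, then `R` is contained in `R'`. -/
theorem IsLocAt.le_of_vanishesAt {A : Subring F} {R R' : LocalSubring F} (h : IsLocAt A R)
    (hA : A ≤ R'.toSubring) (hv : ∀ a ∈ A, VanishesAt R' a → VanishesAt R a) :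
    R.toSubring ≤ R'.toSubring := by
  intro t ht
  obtain ⟨a, ha, b, hb, hbv, rfl⟩ := h.2 t ht
  exact mul_mem (hA ha) (inv_mem_of_not_vanishesAt (hA hb) fun h' => hbv (hv b hb h'))

theorem IsLocAt.le_of_dominates {A : Subring F} {R R' T : LocalSubring F} (h : IsLocAt A R)
    (hRT : R.toSubring ≤ T.toSubring) (hR'T : R' ≤ T) (hA : A ≤ R'.toSubring) :
    R.toSubring ≤ R'.toSubring :=
  h.le_of_vanishesAt hA fun _ ha hv =>
    ((vanishesAt_iff_of_dominates hR'T (hA ha)).2 hv).of_le hRT (h.1 ha)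

theorem IsLocAt.ext {A : Subring F} {R R' : LocalSubring F} (h : IsLocAt A R) (h' : IsLocAt A R')
    (hv : ∀ a ∈ A, VanishesAt R a ↔ VanishesAt R' a) : R = R' :=
  LocalSubring.toSubring_injective <| le_antisymm
    (h.le_of_vanishesAt h'.1 fun a ha => (hv a ha).2)
    (h'.le_of_vanishesAt h.1 fun a ha => (hv a ha).1)

/-- The prime ideal of functions in `A` that vanish at a point `T` with `A ⊆ T`. -/
def centerIdeal (A : Subring F) (T : LocalSubring F) (h : A ≤ T.toSubring) : Ideal A :=
  (IsLocalRing.maximalIdeal T.toSubring).comap (Subring.inclusion h)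

instance (A : Subring F) (T : LocalSubring F) (h : A ≤ T.toSubring) :
    (centerIdeal A T h).IsPrime := by
  unfold centerIdeal
  infer_instance

theorem mem_centerIdeal {A : Subring F} {T : LocalSubring F} {h : A ≤ T.toSubring} {a : A} :
    a ∈ centerIdeal A T h ↔ VanishesAt T (a : F) :=
  ⟨fun h' => ⟨h a.2, h'⟩, fun h' => h'.2⟩

/-- A local ring containing `A` dominates a point of `Spec A`. -/
theorem exists_isLocAt_le {A : Subring F} {T : LocalSubring F} (h : A ≤ T.toSubring) :
    ∃ R, IsLocAt A R ∧ R ≤ T := by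
  refine ⟨LocalSubring.ofPrime A (centerIdeal A T h), isLocAt_ofPrime _, ?_⟩
  have hv : ∀ a : A, VanishesAt (LocalSubring.ofPrime A (centerIdeal A T h)) (a : F) ↔
      VanishesAt T (a : F) := fun a => by rw [vanishesAt_ofPrime_iff, mem_centerIdeal]
  refine dominates_iff.2 ⟨(isLocAt_ofPrime _).le_of_vanishesAt h fun a ha => (hv ⟨a, ha⟩).2, ?_⟩
  intro f hf
  obtain ⟨a, ha, b, hb, rfl⟩ := mem_ofPrime_iff.1 hf.mem
  have hb0 : ¬ VanishesAt T (b : F) := fun h' => hb (mem_centerIdeal.2 h')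
  have hbne := ne_zero_of_not_vanishesAt hb0
  have : VanishesAt (LocalSubring.ofPrime A (centerIdeal A T h)) a := by
    have := hf.mul_right (LocalSubring.le_ofPrime A _ b.2)
    rwa [inv_mul_cancel_right₀ hbne] at this
  exact ((hv ⟨a, ha⟩).1 this).mul_right (inv_mem_of_not_vanishesAt (h b.2) hb0)

theorem mem_specModel_iff {A : Subring F} {T : LocalSubring F} :
    T ∈ specModel A ↔ IsLocAt A T := by
  constructor
  · rintro ⟨p, hp, rfl⟩
    exact isLocAt_ofPrime p
  · intro h
    refine ⟨centerIdeal A T h.1, inferInstance, h.ext (isLocAt_ofPrime _) fun a ha => ?_⟩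
    rw [vanishesAt_ofPrime_iff ⟨a, ha⟩, mem_centerIdeal]

theorem IsLocAt.eq_of_le {A : Subring F} {R T : LocalSubring F} (h : IsLocAt A T)
    (hRT : R ≤ T) (hA : A ≤ R.toSubring) : R = T :=
  LocalSubring.toSubring_injective <| le_antisymm hRT.1 (h.le_of_dominates le_rfl hRT hA)

theorem IsLocAt.of_le {A C : Subring F} {T : LocalSubring F} (h : IsLocAt A T) (hAC : A ≤ C)
    (hC : C ≤ T.toSubring) : IsLocAt C T :=
  ⟨hC, fun t ht => by
    obtain ⟨a, ha, b, hb, h⟩ := h.2 t ht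
    exact ⟨a, hAC ha, b, hAC hb, h⟩⟩

end LocalSubrings

/-! ### Iterated blowups of coordinate ideals -/

section Models

variable {F : Type*} [Field F] (K : Type*) [Field K] [Algebra K F] {ι : Type*} (a : ι → F)

/-- A chart of the blowup of a projective space in the product of the coordinate ideals
`(a_f : f ∈ S)`, `S ∈ 𝓢`: the one on which the ideal of `S` is generated by `a_{c(S)}`. -/
def ratioRing (𝓢 : Finset (Finset ι)) (c : Finset ι → ι) : Subring F :=
  (Algebra.adjoin K {x : F | ∃ S ∈ 𝓢, ∃ f ∈ S, x = a f / a (c S)}).toSubring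

/-- The blowup of a projective space with homogeneous coordinates `a` in the product of the
coordinate ideals `(a_f : f ∈ S)`, `S ∈ 𝓢`, as the union of the charts `ratioRing`. -/
def ratioModel (𝓢 : Finset (Finset ι)) : Set (LocalSubring F) :=
  {T | ∃ c : Finset ι → ι, (∀ S ∈ 𝓢, c S ∈ S) ∧ IsLocAt (ratioRing K a 𝓢 c) T}

variable {K a}

theorem adjoin_toSubring_le {s : Set F} {T : Subring F} (hK : ∀ k : K, algebraMap K F k ∈ T)
    (hs : ∀ x ∈ s, x ∈ T) : (Algebra.adjoin K s).toSubring ≤ T := by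
  intro x hx
  change x ∈ Algebra.adjoin K s at hx
  induction hx using Algebra.adjoin_induction with
  | mem x hx => exact hs x hx
  | algebraMap r => exact hK r
  | add x y _ _ hx hy => exact add_mem hx hy
  | mul x y _ _ hx hy => exact mul_mem hx hy

theorem algebraMap_mem_adjoin (s : Set F) (k : K) :
    algebraMap K F k ∈ (Algebra.adjoin K s).toSubring :=
  (Algebra.adjoin K s).algebraMap_mem k

theorem ratioRing_le {𝓢 : Finset (Finset ι)} {c : Finset ι → ι} {T : Subring F}
    (hK : ∀ k : K, algebraMap K F k ∈ T) (hs : ∀ S ∈ 𝓢, ∀ f ∈ S, a f / a (c S) ∈ T) :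
    ratioRing K a 𝓢 c ≤ T :=
  adjoin_toSubring_le hK (by rintro _ ⟨S, hS, f, hf, rfl⟩; exact hs S hS f hf)

theorem div_mem_ratioRing {𝓢 : Finset (Finset ι)} {c : Finset ι → ι} {S : Finset ι} (hS : S ∈ 𝓢)
    {f : ι} (hf : f ∈ S) : a f / a (c S) ∈ ratioRing K a 𝓢 c :=
  Algebra.subset_adjoin ⟨S, hS, f, hf, rfl⟩

theorem algebraMap_mem_ratioRing {𝓢 : Finset (Finset ι)} {c : Finset ι → ι} (k : K) :
    algebraMap K F k ∈ ratioRing K a 𝓢 c := algebraMap_mem_adjoin _ k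

theorem algebraMap_mem_of_mem_ratioModel {𝓢 : Finset (Finset ι)} {T : LocalSubring F}
    (hT : T ∈ ratioModel K a 𝓢) (k : K) : algebraMap K F k ∈ T.toSubring := by
  obtain ⟨c, -, h⟩ := hT
  exact h.1 (algebraMap_mem_ratioRing k)

theorem ratioRing_mono {𝓢 𝓣 : Finset (Finset ι)} (h : 𝓢 ⊆ 𝓣) (c : Finset ι → ι) :
    ratioRing K a 𝓢 c ≤ ratioRing K a 𝓣 c :=
  ratioRing_le algebraMap_mem_ratioRing fun _ hS _ hf => div_mem_ratioRing (h hS) hf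

/-- The iterated blowup is separated: a local ring dominates at most one of its points. -/
theorem ratioModel_separated (ha : ∀ i, a i ≠ 0) {𝓢 : Finset (Finset ι)} {R R' T : LocalSubring F}
    (hR : R ∈ ratioModel K a 𝓢) (hR' : R' ∈ ratioModel K a 𝓢) (h : R ≤ T) (h' : R' ≤ T) :
    R = R' := by
  have key : ∀ {R R' : LocalSubring F}, R ∈ ratioModel K a 𝓢 → R' ∈ ratioModel K a 𝓢 → R ≤ T →
      R' ≤ T → R.toSubring ≤ R'.toSubring := by
    rintro R R' ⟨c, hc, hR⟩ ⟨c', hc', hR'⟩ h h'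
    refine hR.le_of_dominates h.1 h' (ratioRing_le
      (fun k => hR'.1 (algebraMap_mem_ratioRing k)) fun S hS f hf => ?_)
    have h1 : a (c S) / a (c' S) ∈ R'.toSubring := hR'.1 (div_mem_ratioRing hS (hc S hS))
    have h2 : a (c' S) / a (c S) ∈ T.toSubring := h.1 (hR.1 (div_mem_ratioRing hS (hc' S hS)))
    have h3 : a (c' S) / a (c S) ∈ R'.toSubring := by
      rw [← inv_div] at h2 ⊢
      exact inv_mem_of_dominates h' h1 (div_ne_zero (ha _) (ha _)) h2
    rw [← div_mul_div_cancel₀ (ha (c' S))]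
    exact mul_mem (hR'.1 (div_mem_ratioRing hS hf)) h3
  exact LocalSubring.toSubring_injective (le_antisymm (key hR hR' h h') (key hR' hR h' h))

theorem exists_mem_ratioModel_le {𝓢 𝓣 : Finset (Finset ι)} (hST : 𝓢 ⊆ 𝓣) {T : LocalSubring F}
    (hT : T ∈ ratioModel K a 𝓣) : ∃ R ∈ ratioModel K a 𝓢, R ≤ T := by
  obtain ⟨c, hc, h⟩ := hT
  obtain ⟨R, hR, hRT⟩ := exists_isLocAt_le ((ratioRing_mono hST c).trans h.1)
  exact ⟨R, ⟨c, fun S hS => hc S (hST hS), hR⟩, hRT⟩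

/-- The stalk at `R` of the ideal of `Z` is an invertible multiple of the ideal generated by the
`a_e`, `e ∈ S`. -/
def IsMultipleOfCoordIdeal (a : ι → F) (Z : Set (LocalSubring F)) (S : Finset ι)
    (R : LocalSubring F) : Prop :=
  ∃ g : F, g ≠ 0 ∧ (∀ e ∈ S, a e / g ∈ R.toSubring) ∧
    ∀ f : R.toSubring, f ∈ vanishingIdeal Z R ↔
      ∃ r : ι → F, (∀ e ∈ S, r e ∈ R.toSubring) ∧ (f : F) = ∑ e ∈ S, r e * (a e / g)

theorem blowupChart_le {R : Subring F} {I : Ideal R} {x : R} {T : Subring F} (hR : R ≤ T)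
    (h : ∀ y ∈ I, (y : F) / (x : F) ∈ T) : blowupChart R I x ≤ T := by
  refine Subring.closure_le.2 (Set.union_subset hR ?_)
  rintro _ ⟨y, hy, rfl⟩
  exact h y hy

theorem le_blowupChart {R : Subring F} {I : Ideal R} {x : R} : R ≤ blowupChart R I x :=
  fun _ h => Subring.subset_closure (Or.inl h)

theorem div_mem_blowupChart {R : Subring F} {I : Ideal R} {x y : R} (h : y ∈ I) :
    (y : F) / (x : F) ∈ blowupChart R I x :=
  Subring.subset_closure (Or.inr ⟨y, h, rfl⟩)

theorem mem_vanishingIdeal_of_isMultiple {Z : Set (LocalSubring F)} {S : Finset ι}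
    {R : LocalSubring F} {g : F} (hg : ∀ e ∈ S, a e / g ∈ R.toSubring)
    (h : ∀ f : R.toSubring, f ∈ vanishingIdeal Z R ↔
      ∃ r : ι → F, (∀ e ∈ S, r e ∈ R.toSubring) ∧ (f : F) = ∑ e ∈ S, r e * (a e / g))
    {e : ι} (he : e ∈ S) : (⟨a e / g, hg e he⟩ : R.toSubring) ∈ vanishingIdeal Z R := by
  refine (h _).2 ⟨fun i => if i = e then 1 else 0, fun i _ => ?_, ?_⟩
  · dsimp only
    split_ifs
    exacts [R.toSubring.one_mem, R.toSubring.zero_mem]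
  · simp [Finset.sum_ite_eq', he]

/-- Blowing up a subset whose ideal is locally an invertible multiple of the coordinate ideal of `S`
is the same as blowing up that coordinate ideal. -/
theorem blowup_ratioModel [DecidableEq ι] (ha : ∀ i, a i ≠ 0) {𝓢 : Finset (Finset ι)}
    {S : Finset ι} (hS : S ∉ 𝓢) {Z : Set (LocalSubring F)}
    (hZ : ∀ R ∈ ratioModel K a 𝓢, IsMultipleOfCoordIdeal a Z S R) :
    blowup (ratioModel K a 𝓢) Z = ratioModel K a (insert S 𝓢) := by
  ext T
  constructor
  · rintro ⟨R, hRm, x, hxI, hx0, hT⟩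
    rw [mem_specModel_iff] at hT
    obtain ⟨g, hg0, hg, hI⟩ := hZ R hRm
    have hRT : R.toSubring ≤ T.toSubring := le_blowupChart.trans hT.1
    have hmem : ∀ e ∈ S, a e / g / x ∈ T.toSubring := fun e he =>
      hT.1 (div_mem_blowupChart (mem_vanishingIdeal_of_isMultiple hg hI he))
    obtain ⟨r, hr, hxr⟩ := (hI x).1 hxI
    have hx0' : (x : F) ≠ 0 := fun h => hx0 (Subtype.ext h)
    -- one of the summands of `1 = ∑ r_e a_e / (g x)` is a unit at `T`
    obtain ⟨c₀, hc₀, hv⟩ : ∃ c₀ ∈ S, ¬ VanishesAt T (a c₀ / g / x) := by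
      by_contra! hcon
      refine not_vanishesAt_one T ?_
      have h1 : (1 : F) = ∑ e ∈ S, r e * (a e / g / x) := by
        rw [← div_self hx0']
        nth_rw 1 [hxr]
        rw [Finset.sum_div]
        exact Finset.sum_congr rfl fun e _ => mul_div_assoc _ _ _
      rw [h1]
      exact VanishesAt.sum _ _ fun e he => (hcon e he).mul_left (hRT (hr e he))
    obtain ⟨c, hc, hR⟩ := hRm
    have hne : ∀ S' ∈ 𝓢, S' ≠ S := fun S' hS' h => hS (h ▸ hS')
    have hcc : ∀ S' ∈ 𝓢, Function.update c S c₀ S' = c S' := fun S' hS' =>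
      Function.update_of_ne (hne S' hS') _ _
    have hA : ratioRing K a (insert S 𝓢) (Function.update c S c₀) ≤ T.toSubring := by
      refine ratioRing_le (fun k => hRT (hR.1 (algebraMap_mem_ratioRing k))) fun S' hS' f hf => ?_
      rcases Finset.mem_insert.1 hS' with rfl | hS'
      · rw [Function.update_self]
        have : a f / a c₀ = a f / g / x * (a c₀ / g / x)⁻¹ := by
          have := ha c₀
          field_simp
        rw [this]
        exact mul_mem (hmem f hf) (inv_mem_of_not_vanishesAt (hmem c₀ hc₀) hv)
      · rw [hcc S' hS']
        exact hRT (hR.1 (div_mem_ratioRing hS' hf))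
    refine ⟨Function.update c S c₀, fun S' hS' => ?_, ?_⟩
    · rcases Finset.mem_insert.1 hS' with rfl | hS'
      · rwa [Function.update_self]
      · rw [hcc S' hS']
        exact hc S' hS'
    obtain ⟨R', hR', hR'T⟩ := exists_isLocAt_le hA
    have hRR' : R.toSubring ≤ R'.toSubring := by
      refine hR.le_of_dominates hRT hR'T (le_trans (ratioRing_le algebraMap_mem_ratioRing
        fun S' hS' f hf => ?_) hR'.1)
      rw [← hcc S' hS']
      exact div_mem_ratioRing (Finset.mem_insert_of_mem hS') hf
    have hq : ∀ e ∈ S, a e / a c₀ ∈ R'.toSubring := fun e he => by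
      have := hR'.1 (div_mem_ratioRing (K := K) (a := a) (c := Function.update c S c₀)
        (Finset.mem_insert_self S 𝓢) he)
      rwa [Function.update_self] at this
    have hinv : (a c₀ / g / x)⁻¹ ∈ R'.toSubring := by
      have : (a c₀ / g / x)⁻¹ = ∑ e ∈ S, r e * (a e / a c₀) := by
        have h1 : (a c₀ / g / x)⁻¹ = x * (g / a c₀) := by
          have := ha c₀
          field_simp
        rw [h1]
        nth_rw 1 [hxr]
        rw [Finset.sum_mul]
        refine Finset.sum_congr rfl fun e _ => ?_
        field_simp
      rw [this]
      exact sum_mem fun e he => mul_mem (hRR' (hr e he)) (hq e he)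
    have hu : a c₀ / g / x ∈ R'.toSubring := by
      have hn0 := ne_zero_of_not_vanishesAt hv
      have := inv_mem_of_dominates hR'T hinv (inv_ne_zero hn0) (by rw [inv_inv]; exact hmem c₀ hc₀)
      rwa [inv_inv] at this
    have hle : blowupChart R.toSubring (vanishingIdeal Z R) x ≤ R'.toSubring := by
      refine blowupChart_le hRR' fun y hy => ?_
      obtain ⟨s, hs, hys⟩ := (hI y).1 hy
      have : (y : F) / x = ∑ e ∈ S, s e * ((a e / a c₀) * (a c₀ / g / x)) := by
        rw [hys, Finset.sum_div]
        refine Finset.sum_congr rfl fun e _ => ?_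
        have := ha c₀
        field_simp
      rw [this]
      exact sum_mem fun e he => mul_mem (hRR' (hs e he)) (mul_mem (hq e he) hu)
    exact (hT.eq_of_le hR'T hle) ▸ hR'
  · rintro ⟨c, hc, hT⟩
    have hsub : 𝓢 ⊆ insert S 𝓢 := Finset.subset_insert _ _
    obtain ⟨R, hR, hRT⟩ := exists_isLocAt_le ((ratioRing_mono hsub c).trans hT.1)
    have hRm : R ∈ ratioModel K a 𝓢 := ⟨c, fun S hS => hc S (hsub hS), hR⟩
    obtain ⟨g, hg0, hg, hI⟩ := hZ R hRm
    have hcS : c S ∈ S := hc S (Finset.mem_insert_self _ _)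
    have hq : ∀ e ∈ S, a e / a (c S) ∈ T.toSubring := fun e he =>
      hT.1 (div_mem_ratioRing (Finset.mem_insert_self _ _) he)
    refine ⟨R, hRm, ⟨a (c S) / g, hg _ hcS⟩, mem_vanishingIdeal_of_isMultiple hg hI hcS,
      fun h => div_ne_zero (ha _) hg0 (congrArg Subtype.val h), ?_⟩
    rw [mem_specModel_iff]
    refine hT.of_le (ratioRing_le (fun k => le_blowupChart (hR.1 (algebraMap_mem_ratioRing k)))
      fun S' hS' f hf => ?_) (blowupChart_le hRT.1 fun y hy => ?_)
    · rcases Finset.mem_insert.1 hS' with rfl | hS'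
      · have := div_mem_blowupChart (x := (⟨a (c S') / g, hg _ hcS⟩ : R.toSubring))
          (mem_vanishingIdeal_of_isMultiple hg hI hf)
        convert this using 1
        have := ha (c S')
        change a f / a (c S') = a f / g / (a (c S') / g)
        field_simp
      · exact le_blowupChart (hR.1 (div_mem_ratioRing hS' hf))
    · obtain ⟨s, hs, hys⟩ := (hI y).1 hy
      have : (y : F) / (a (c S) / g) = ∑ e ∈ S, s e * (a e / a (c S)) := by
        rw [hys, Finset.sum_div]
        refine Finset.sum_congr rfl fun e _ => ?_
        have := ha (c S)
        field_simp
      change (y : F) / (a (c S) / g) ∈ T.toSubring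
      rw [this]
      exact sum_mem fun e he => mul_mem (hRT.1 (hs e he)) (hq e he)

/-- The blowup is an isomorphism over the points at which the ideal that is blown up is
the unit ideal. -/
theorem eq_of_mem_ratioModel_insert [DecidableEq ι] (ha : ∀ i, a i ≠ 0)
    {𝓢 : Finset (Finset ι)} {S : Finset ι} {Z : Set (LocalSubring F)} {R T : LocalSubring F}
    (hR : R ∈ ratioModel K a 𝓢)
    (hZ : IsMultipleOfCoordIdeal a Z S R) (htop : vanishingIdeal Z R = ⊤)
    (hT : T ∈ ratioModel K a (insert S 𝓢)) (hRT : R ≤ T) : R = T := by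
  obtain ⟨c, hc, hT⟩ := hT
  have hsub : 𝓢 ⊆ insert S 𝓢 := Finset.subset_insert _ _
  obtain ⟨R₀, hR₀, hR₀T⟩ := exists_isLocAt_le ((ratioRing_mono hsub c).trans hT.1)
  obtain rfl := ratioModel_separated ha hR ⟨c, fun S hS => hc S (hsub hS), hR₀⟩ hRT hR₀T
  refine hT.eq_of_le hRT (ratioRing_le (fun k => hR₀.1 (algebraMap_mem_ratioRing k))
    fun S' hS' f hf => ?_)
  rcases Finset.mem_insert.1 hS' with rfl | hS'
  · obtain ⟨g, hg0, hg, hI⟩ := hZ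
    obtain ⟨r, hr, h1⟩ := (hI 1).1 (by rw [htop]; trivial)
    obtain ⟨e, he, hv⟩ : ∃ e ∈ S', ¬ VanishesAt R (a e / g) := by
      by_contra! hcon
      refine not_vanishesAt_one R ?_
      rw [show (1 : F) = ((1 : R.toSubring) : F) from rfl, h1]
      exact VanishesAt.sum _ _ fun e he => (hcon e he).mul_left (hr e he)
    have hcS : c S' ∈ S' := hc _ (Finset.mem_insert_self _ _)
    have hinv := inv_mem_of_not_vanishesAt (hg e he) hv
    have h2 : a (c S') / a e ∈ R.toSubring := by
      have : a (c S') / a e = a (c S') / g * (a e / g)⁻¹ := by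
        have := ha e
        field_simp
      rw [this]
      exact mul_mem (hg _ hcS) hinv
    have h3 : a e / a (c S') ∈ R.toSubring := by
      rw [← inv_div]
      refine inv_mem_of_dominates hRT h2 (div_ne_zero (ha _) (ha _)) ?_
      rw [inv_div]
      exact hT.1 (div_mem_ratioRing (Finset.mem_insert_self _ _) he)
    have : a f / a (c S') = a f / g * (a e / g)⁻¹ * (a e / a (c S')) := by
      have := ha e
      field_simp
    rw [this]
    exact mul_mem (mul_mem (hg f hf) hinv) h3
  · exact hR₀.1 (div_mem_ratioRing hS' hf)

end Models

/-! ### Points of affine spaces -/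

section Coordinates

open MvPolynomial

variable {K : Type*} [Field K] {σ : Type*}

/-- The ideal of a linear subspace `X_i = 0`, `i ∈ J`, of an affine space. -/
noncomputable def coordIdeal (K : Type*) [Field K] (J : Set σ) : Ideal (MvPolynomial σ K) :=
  Ideal.span (X '' J)

theorem coordIdeal_eq_ker (J : Set σ) :
    coordIdeal K J = RingHom.ker (aeval (fun i => if i ∈ J then 0 else X i) :
      MvPolynomial σ K →ₐ[K] MvPolynomial σ K) := by
  apply le_antisymm
  · refine Ideal.span_le.2 ?_
    rintro _ ⟨i, hi, rfl⟩
    simp [RingHom.mem_ker, hi]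
  · intro q hq
    have key : ∀ q : MvPolynomial σ K,
        q - aeval (fun i => if i ∈ J then 0 else X i) q ∈ coordIdeal K J := by
      intro q
      induction q using MvPolynomial.induction_on with
      | C r => simp
      | add p q hp hq =>
        rw [map_add, add_sub_add_comm]
        exact add_mem hp hq
      | mul_X p i hp =>
        rw [map_mul, aeval_X]
        split_ifs with hi
        · rw [mul_zero, sub_zero]
          exact Ideal.mul_mem_left _ _ (Ideal.subset_span ⟨i, hi, rfl⟩)
        · rw [← sub_mul]
          exact Ideal.mul_mem_right _ _ hp
    have := key q
    rwa [RingHom.mem_ker.1 hq, sub_zero] at this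

instance (J : Set σ) : (coordIdeal K J).IsPrime := by
  rw [coordIdeal_eq_ker]
  exact RingHom.ker_isPrime _

theorem X_mem_coordIdeal {J : Set σ} {i : σ} :
    (X i : MvPolynomial σ K) ∈ coordIdeal K J ↔ i ∈ J := by
  refine ⟨fun h => ?_, fun h => Ideal.subset_span ⟨i, h, rfl⟩⟩
  rw [coordIdeal_eq_ker, RingHom.mem_ker, aeval_X] at h
  by_contra hi
  rw [if_neg hi] at h
  exact X_ne_zero i h

theorem coeff_zero_eq_zero_of_mem_coordIdeal {J : Set σ} {q : MvPolynomial σ K}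
    (h : q ∈ coordIdeal K J) : coeff 0 q = 0 := by
  have : coordIdeal K J ≤ RingHom.ker (constantCoeff : MvPolynomial σ K →+* K) := by
    refine Ideal.span_le.2 ?_
    rintro _ ⟨i, hi, rfl⟩
    simp [RingHom.mem_ker]
  simpa [RingHom.mem_ker, constantCoeff_eq] using this h

variable {F : Type*} [Field F] [Algebra K F] {x : σ → F}

theorem mem_adjoin_range_iff {t : F} : t ∈ (Algebra.adjoin K (Set.range x)).toSubring ↔
    ∃ q : MvPolynomial σ K, aeval x q = t := by
  rw [Algebra.adjoin_range_eq_range_aeval]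
  rfl

theorem aeval_mem {T : Subring F} (hT : (Algebra.adjoin K (Set.range x)).toSubring ≤ T)
    (q : MvPolynomial σ K) : aeval x q ∈ T := hT (mem_adjoin_range_iff.2 ⟨q, rfl⟩)

theorem coord_mem {T : Subring F} (hT : (Algebra.adjoin K (Set.range x)).toSubring ≤ T)
    (i : σ) : x i ∈ T := hT (Algebra.subset_adjoin ⟨i, rfl⟩)

/-- The point of an affine space given by a prime ideal of the polynomial ring. -/
theorem exists_isLocAt_vanishesAt_iff (hx : AlgebraicIndependent K x) (p : Ideal (MvPolynomial σ K))
    [p.IsPrime] : ∃ T : LocalSubring F, IsLocAt (Algebra.adjoin K (Set.range x)).toSubring T ∧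
      ∀ q, VanishesAt T (aeval x q) ↔ q ∈ p := by
  let e : (Algebra.adjoin K (Set.range x)).toSubring →+* MvPolynomial σ K :=
    (hx.aevalEquiv.symm : Algebra.adjoin K (Set.range x) →+* MvPolynomial σ K)
  have he : ∀ q (h : aeval x q ∈ (Algebra.adjoin K (Set.range x)).toSubring),
      e ⟨aeval x q, h⟩ = q := fun q h => by
    have : hx.aevalEquiv q = ⟨aeval x q, h⟩ := Subtype.ext (hx.algebraMap_aevalEquiv q)
    change hx.aevalEquiv.symm ⟨aeval x q, h⟩ = q
    rw [← this, AlgEquiv.symm_apply_apply]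
  refine ⟨LocalSubring.ofPrime _ (p.comap e), isLocAt_ofPrime _, fun q => ?_⟩
  have hq : aeval x q ∈ (Algebra.adjoin K (Set.range x)).toSubring :=
    mem_adjoin_range_iff.2 ⟨q, rfl⟩
  have := vanishesAt_ofPrime_iff (p := p.comap e) ⟨aeval x q, hq⟩
  rw [this, Ideal.mem_comap, he]

end Coordinates

section FunctionField

variable {K : Type*} [Field K] {m : ℕ}

/-- Any `m` elements that generate the function field of `ℙ^m` are algebraically independent. -/
theorem algebraicIndependent_of_forall_mem {x : Fin m → FunctionField K m}
    (h : ∀ i : Fin m, ∃ u ∈ Algebra.adjoin K (Set.range x), ∃ v ∈ Algebra.adjoin K (Set.range x),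
      affineCoord K m i.castSucc = u / v) : AlgebraicIndependent K x := by
  have hX : AlgebraicIndependent K
      (fun i => algebraMap (MvPolynomial (Fin m) K) (FunctionField K m) (MvPolynomial.X i)) := by
    have := (MvPolynomial.algebraicIndependent_X (Fin m) K).map'
      (f := IsScalarTower.toAlgHom K (MvPolynomial (Fin m) K) (FunctionField K m))
      (IsFractionRing.injective _ _)
    exact this
  have halg : Algebra.IsAlgebraic (Algebra.adjoin K (Set.range x)) (FunctionField K m) := by
    have hmem : ∀ u ∈ Algebra.adjoin K (Set.range x),
        IsAlgebraic (Algebra.adjoin K (Set.range x)) u := fun u hu =>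
      isAlgebraic_algebraMap (⟨u, hu⟩ : Algebra.adjoin K (Set.range x))
    have hpol : ∀ p : MvPolynomial (Fin m) K, IsAlgebraic (Algebra.adjoin K (Set.range x))
        (algebraMap (MvPolynomial (Fin m) K) (FunctionField K m) p) := by
      intro p
      induction p using MvPolynomial.induction_on with
      | C r =>
        exact hmem _ ((Algebra.adjoin K (Set.range x)).algebraMap_mem r)
      | add p q hp hq =>
        rw [map_add]
        exact hp.add hq
      | mul_X p i hp =>
        obtain ⟨u, hu, v, hv, huv⟩ := h i
        rw [affineCoord, Fin.lastCases_castSucc] at huv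
        rw [map_mul, huv, div_eq_mul_inv]
        exact hp.mul ((hmem u hu).mul (hmem v hv).inv)
    refine ⟨fun y => ?_⟩
    obtain ⟨p, q, -, rfl⟩ := IsFractionRing.div_surjective (A := MvPolynomial (Fin m) K) y
    rw [div_eq_mul_inv]
    exact (hpol p).mul (hpol q).inv
  exact (Algebra.IsAlgebraic.isTranscendenceBasis_of_lift_le_trdeg_of_finite K x
    hX.lift_cardinalMk_le_trdeg).1

theorem affineCoord_ne_zero (j : Fin (m + 1)) : affineCoord K m j ≠ 0 := by
  induction j using Fin.lastCases with
  | last => simp [affineCoord]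
  | cast i =>
    simp only [affineCoord, Fin.lastCases_castSucc]
    exact (map_ne_zero_iff _ (IsFractionRing.injective _ _)).2 (MvPolynomial.X_ne_zero i)

end FunctionField

/-! ### The part of projective space outside the centres -/

section ProjectiveSpace

variable {K : Type*} [Field K] {m : ℕ}

theorem chartRing_le {j : Fin (m + 1)} {T : Subring (FunctionField K m)}
    (hK : ∀ k : K, algebraMap K (FunctionField K m) k ∈ T)
    (h : ∀ i, affineCoord K m i / affineCoord K m j ∈ T) : chartRing K m j ≤ T :=
  adjoin_toSubring_le hK (by rintro _ ⟨i, rfl⟩; exact h i)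

theorem div_mem_chartRing (i j : Fin (m + 1)) :
    affineCoord K m i / affineCoord K m j ∈ chartRing K m j :=
  Algebra.subset_adjoin ⟨i, rfl⟩

theorem algebraMap_mem_chartRing (j : Fin (m + 1)) (k : K) :
    algebraMap K (FunctionField K m) k ∈ chartRing K m j := algebraMap_mem_adjoin _ k

theorem mem_projectiveSpace_iff {T : LocalSubring (FunctionField K m)} :
    T ∈ projectiveSpace K m ↔ ∃ j, IsLocAt (chartRing K m j) T := by
  simp only [projectiveSpace, Set.mem_iUnion, mem_specModel_iff]

theorem ratioRing_singleton_univ (c : Finset (Fin (m + 1)) → Fin (m + 1)) :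
    ratioRing K (affineCoord K m) {Finset.univ} c = chartRing K m (c Finset.univ) :=
  le_antisymm
    (ratioRing_le (algebraMap_mem_chartRing _) fun S hS f _ => by
      rw [Finset.mem_singleton.1 hS]
      exact div_mem_chartRing _ _)
    (chartRing_le algebraMap_mem_ratioRing fun i =>
      div_mem_ratioRing (Finset.mem_singleton_self _) (Finset.mem_univ i))

theorem projectiveSpace_eq_ratioModel :
    projectiveSpace K m = ratioModel K (affineCoord K m) {Finset.univ} := by
  ext T
  rw [mem_projectiveSpace_iff]
  constructor
  · rintro ⟨j, hj⟩
    refine ⟨fun _ => j, fun S hS => ?_, ?_⟩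
    · rw [Finset.mem_singleton.1 hS]
      exact Finset.mem_univ j
    · rwa [ratioRing_singleton_univ]
  · rintro ⟨c, -, h⟩
    rw [ratioRing_singleton_univ] at h
    exact ⟨_, h⟩

theorem mem_coordSubspace_iff {S : Finset (Fin (m + 1))} {T : LocalSubring (FunctionField K m)} :
    T ∈ coordSubspace K m S ↔ ∃ j, IsLocAt (chartRing K m j) T ∧
      ∀ e ∈ S, VanishesAt T (affineCoord K m e / affineCoord K m j) := by
  simp only [coordSubspace, zeroLocus, Set.mem_ofPred_eq, mem_specModel_iff, Set.forall_mem_image,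
    MvPolynomial.aeval_X, Finset.mem_coe, coordRatio]

theorem zeroLocus_subset (G : Set (MvPolynomial (Fin (m + 1)) K)) :
    zeroLocus K m G ⊆ projectiveSpace K m := by
  rintro T ⟨j, hj, -⟩
  exact Set.mem_iUnion.2 ⟨j, hj⟩

theorem vanishesAt_div_of_mem_coordSubspace {S : Finset (Fin (m + 1))}
    {T : LocalSubring (FunctionField K m)} (hT : T ∈ coordSubspace K m S) {j : Fin (m + 1)}
    (hj : ∀ i, affineCoord K m i / affineCoord K m j ∈ T.toSubring) {e : Fin (m + 1)}
    (he : e ∈ S) : VanishesAt T (affineCoord K m e / affineCoord K m j) := by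
  obtain ⟨j', hj', hv⟩ := mem_coordSubspace_iff.1 hT
  rw [← div_mul_div_cancel₀ (affineCoord_ne_zero j')]
  exact (hv e he).mul_right (hj j')

theorem mem_coordSubspace_of_vanishesAt {S : Finset (Fin (m + 1))}
    {T : LocalSubring (FunctionField K m)} (hT : T ∈ projectiveSpace K m) {j : Fin (m + 1)}
    (hv : ∀ e ∈ S, VanishesAt T (affineCoord K m e / affineCoord K m j)) :
    T ∈ coordSubspace K m S := by
  obtain ⟨j', hj'⟩ := mem_projectiveSpace_iff.1 hT
  refine mem_coordSubspace_iff.2 ⟨j', hj', fun e he => ?_⟩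
  rw [← div_mul_div_cancel₀ (affineCoord_ne_zero j)]
  exact (hv e he).mul_right (hj'.1 (div_mem_chartRing _ _))

theorem mem_coordSubspace_of_le {S : Finset (Fin (m + 1))}
    {T T' : LocalSubring (FunctionField K m)} (hT : T ∈ projectiveSpace K m)
    (hT' : T' ∈ coordSubspace K m S) (h : T.toSubring ≤ T'.toSubring) :
    T ∈ coordSubspace K m S := by
  obtain ⟨j, hj⟩ := mem_projectiveSpace_iff.1 hT
  refine mem_coordSubspace_iff.2 ⟨j, hj, fun e he => ?_⟩
  exact (vanishesAt_div_of_mem_coordSubspace hT'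
    (fun i => h (hj.1 (div_mem_chartRing i j))) he).of_le
    h (hj.1 (div_mem_chartRing e j))

variable (K m) in
/-- The points of projective space outside the linear spaces `a_e = 0`, `e ∈ S`, for `S ∈ 𝓢`.
They are also the points of the blowup `ratioModel` outside the exceptional divisors. -/
def outside (𝓢 : Finset (Finset (Fin (m + 1)))) : Set (LocalSubring (FunctionField K m)) :=
  {T | T ∈ projectiveSpace K m ∧ ∀ S ∈ 𝓢, T ∉ coordSubspace K m S}

theorem outside_subset_ratioModel {𝓢 : Finset (Finset (Fin (m + 1)))} (h𝓢 : Finset.univ ∈ 𝓢) :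
    outside K m 𝓢 ⊆ ratioModel K (affineCoord K m) 𝓢 := by
  rintro T ⟨hT, hS⟩
  obtain ⟨j, hj⟩ := mem_projectiveSpace_iff.1 hT
  have hex : ∀ S : Finset (Fin (m + 1)), ∃ e, S ∈ 𝓢 → e ∈ S ∧
      ¬ VanishesAt T (affineCoord K m e / affineCoord K m j) := by
    intro S
    by_contra! hcon
    have hS𝓢 := (hcon 0).1
    exact hS S hS𝓢 (mem_coordSubspace_iff.2 ⟨j, hj, fun e he => (hcon e).2 he⟩)
  choose c hc using hex
  have hinv : ∀ S ∈ 𝓢, affineCoord K m j / affineCoord K m (c S) ∈ T.toSubring := fun S hS => by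
    rw [← inv_div]
    exact inv_mem_of_not_vanishesAt (hj.1 (div_mem_chartRing _ _)) (hc S hS).2
  have hA : ratioRing K (affineCoord K m) 𝓢 c ≤ T.toSubring :=
    ratioRing_le (fun k => hj.1 (algebraMap_mem_chartRing j k)) fun S hS f hf => by
      rw [← div_mul_div_cancel₀ (affineCoord_ne_zero j)]
      exact mul_mem (hj.1 (div_mem_chartRing _ _)) (hinv S hS)
  refine ⟨c, fun S hS => (hc S hS).1, ?_⟩
  obtain ⟨R, hR, hRT⟩ := exists_isLocAt_le hA
  have hdiv : ∀ i, affineCoord K m i / affineCoord K m (c Finset.univ) ∈ R.toSubring := fun i =>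
    hR.1 (div_mem_ratioRing h𝓢 (Finset.mem_univ i))
  have : chartRing K m j ≤ R.toSubring := by
    refine chartRing_le (fun k => hR.1 (algebraMap_mem_ratioRing k)) fun i => ?_
    rw [← div_mul_div_cancel₀ (affineCoord_ne_zero (c Finset.univ))]
    refine mul_mem (hdiv i) ?_
    rw [← inv_div]
    refine inv_mem_of_dominates hRT (hdiv j) (div_ne_zero (affineCoord_ne_zero _)
      (affineCoord_ne_zero _)) ?_
    rw [inv_div]
    exact hj.1 (div_mem_chartRing _ _)
  exact (hj.eq_of_le hRT this) ▸ hR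

end ProjectiveSpace

/-! ### Toric charts -/

section Charts

variable {K : Type*} [Field K] {m : ℕ}

/-- The indices after position `i` in the order given by `π`; position `i` is excluded. -/
def tail (π : Equiv.Perm (Fin (m + 1))) (i : Fin (m + 1)) : Finset (Fin (m + 1)) :=
  Finset.univ.filter fun e => i < π.symm e

theorem apply_mem_tail {π : Equiv.Perm (Fin (m + 1))} {i l : Fin (m + 1)} :
    π l ∈ tail π i ↔ i < l := by simp [tail]

theorem mem_tail {π : Equiv.Perm (Fin (m + 1))} {i e : Fin (m + 1)} :
    e ∈ tail π i ↔ i < π.symm e := by simp [tail]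

variable (K) in
/-- The coordinates `a_{π(i + 1)} / a_{π(min i j)}`, `0 ≤ i < m`, of the toric chart given by
`(π, j)`. It is the one where the `a_e` are divisible by each other in the order given by `π`, up to
position `j`, and `a_{π(j)}` divides all later ones. -/
noncomputable def chartCoord (π : Equiv.Perm (Fin (m + 1))) (j : Fin (m + 1)) (i : Fin m) :
    FunctionField K m :=
  affineCoord K m (π i.succ) / affineCoord K m (π (min i.castSucc j))

variable (K) in
/-- The coordinate ring of the toric chart given by `(π, j)`. -/
noncomputable def toricRing (π : Equiv.Perm (Fin (m + 1))) (j : Fin (m + 1)) :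
    Subring (FunctionField K m) :=
  (Algebra.adjoin K (Set.range (chartCoord K π j))).toSubring

theorem algebraMap_mem_toricRing (π : Equiv.Perm (Fin (m + 1))) (j : Fin (m + 1)) (k : K) :
    algebraMap K (FunctionField K m) k ∈ toricRing K π j := algebraMap_mem_adjoin _ k

theorem div_mem_toricRing (π : Equiv.Perm (Fin (m + 1))) {i j : Fin (m + 1)} (hij : i ≤ j)
    {l : Fin (m + 1)} (hil : i ≤ l) :
    affineCoord K m (π l) / affineCoord K m (π i) ∈ toricRing K π j := by
  have hz : ∀ l, chartCoord K π j l ∈ toricRing K π j := fun l => Algebra.subset_adjoin ⟨l, rfl⟩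
  have key : ∀ l : Fin (m + 1), l ≤ j → i ≤ l →
      affineCoord K m (π l) / affineCoord K m (π i) ∈ toricRing K π j := by
    intro l
    induction l using Fin.induction with
    | zero =>
      intro _ hil
      rw [Fin.le_zero_iff.1 hil, div_self (affineCoord_ne_zero _)]
      exact one_mem _
    | succ l ih =>
      intro hlj hil
      rcases hil.eq_or_lt with rfl | hlt
      · rw [div_self (affineCoord_ne_zero _)]
        exact one_mem _
      have hlj' : l.castSucc ≤ j := Fin.castSucc_lt_succ.le.trans hlj
      have hz := hz l
      rw [chartCoord, min_eq_left hlj'] at hz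
      rw [← div_mul_div_cancel₀ (affineCoord_ne_zero (π l.castSucc))]
      exact mul_mem hz (ih hlj' (Fin.le_castSucc_iff.2 hlt))
  rcases le_or_gt l j with hlj | hlj
  · exact key l hlj hil
  obtain ⟨l, rfl⟩ := Fin.exists_succ_eq.2 (Fin.ne_zero_of_lt hlj)
  have hz := hz l
  rw [chartCoord, min_eq_right (Fin.le_castSucc_iff.2 hlj)] at hz
  rw [← div_mul_div_cancel₀ (affineCoord_ne_zero (π j))]
  exact mul_mem hz (key j le_rfl hij)

theorem toricRing_le {π : Equiv.Perm (Fin (m + 1))} {j : Fin (m + 1)}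
    {T : Subring (FunctionField K m)} (hK : ∀ k : K, algebraMap K (FunctionField K m) k ∈ T)
    (h : ∀ i, chartCoord K π j i ∈ T) : toricRing K π j ≤ T :=
  adjoin_toSubring_le hK (by rintro _ ⟨i, rfl⟩; exact h i)

theorem chartRing_le_toricRing (π : Equiv.Perm (Fin (m + 1))) (j : Fin (m + 1)) :
    chartRing K m (π 0) ≤ toricRing K π j :=
  chartRing_le (algebraMap_mem_toricRing π j) fun i => by
    have := div_mem_toricRing (K := K) π (Fin.zero_le j) (Fin.zero_le (π.symm i))
    rwa [Equiv.apply_symm_apply] at this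

/-- Exactly up to position `j`, the tails of `π` belong to the family `𝓢` of sets of coordinates
that have been blown up. The toric charts with this property cover the blowup if `𝓢` is an upper
set. -/
structure IsAdapted (𝓢 : Finset (Finset (Fin (m + 1)))) (π : Equiv.Perm (Fin (m + 1)))
    (j : Fin (m + 1)) : Prop where
  tail_mem : ∀ i < j, tail π i ∈ 𝓢
  tail_notMem : tail π j ∉ 𝓢

/-- If some edge of `S` is at one of the positions `0, …, j`, then there is a first one. -/
theorem exists_first (π : Equiv.Perm (Fin (m + 1))) (j : Fin (m + 1)) {S : Finset (Fin (m + 1))}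
    (h : ¬ S ⊆ tail π j) : ∃ i ≤ j, π i ∈ S ∧ ∀ e ∈ S, i ≤ π.symm e := by
  obtain ⟨e, he, hej⟩ := Finset.not_subset.1 h
  rw [mem_tail, not_lt] at hej
  obtain ⟨e₀, he₀, hmin⟩ := S.exists_min_image π.symm ⟨e, he⟩
  exact ⟨π.symm e₀, (hmin e he).trans hej, by rwa [Equiv.apply_symm_apply], hmin⟩

theorem IsAdapted.not_subset {𝓢 : Finset (Finset (Fin (m + 1)))}
    (h𝓢 : IsUpperSet (𝓢 : Set (Finset (Fin (m + 1)))))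
    {π : Equiv.Perm (Fin (m + 1))} {j : Fin (m + 1)} (h : IsAdapted 𝓢 π j)
    {S : Finset (Fin (m + 1))} (hS : S ∈ 𝓢) : ¬ S ⊆ tail π j := fun hle =>
  h.tail_notMem (h𝓢 hle hS)

theorem div_mem_toricRing_of_first (π : Equiv.Perm (Fin (m + 1))) {i j : Fin (m + 1)} (hij : i ≤ j)
    {S : Finset (Fin (m + 1))} (hmin : ∀ e ∈ S, i ≤ π.symm e) {e : Fin (m + 1)} (he : e ∈ S) :
    affineCoord K m e / affineCoord K m (π i) ∈ toricRing K π j := by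
  have := div_mem_toricRing (K := K) π hij (hmin e he)
  rwa [Equiv.apply_symm_apply] at this

/-- A point of the blowup lies in a toric chart once the coordinates of the chart are regular. -/
theorem isLocAt_toricRing {𝓢 : Finset (Finset (Fin (m + 1)))}
    (h𝓢 : IsUpperSet (𝓢 : Set (Finset (Fin (m + 1)))))
    {π : Equiv.Perm (Fin (m + 1))} {j : Fin (m + 1)} (h : IsAdapted 𝓢 π j)
    {R : LocalSubring (FunctionField K m)} (hR : R ∈ ratioModel K (affineCoord K m) 𝓢)
    (hz : toricRing K π j ≤ R.toSubring) : IsLocAt (toricRing K π j) R := by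
  obtain ⟨c, hc, hR⟩ := hR
  obtain ⟨R₀, hR₀, hR₀R⟩ := exists_isLocAt_le hz
  refine (hR.eq_of_le hR₀R (ratioRing_le (fun k => hR₀.1 (algebraMap_mem_toricRing π j k))
    fun S hS f hf => ?_)) ▸ hR₀
  obtain ⟨i, hij, hi, hmin⟩ := exists_first π j (h.not_subset h𝓢 hS)
  have h1 : ∀ e ∈ S, affineCoord K m e / affineCoord K m (π i) ∈ R₀.toSubring := fun e he =>
    hR₀.1 (div_mem_toricRing_of_first π hij hmin he)
  rw [← div_mul_div_cancel₀ (affineCoord_ne_zero (π i))]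
  refine mul_mem (h1 f hf) ?_
  rw [← inv_div]
  refine inv_mem_of_dominates hR₀R (h1 _ (hc S hS)) (div_ne_zero (affineCoord_ne_zero _)
    (affineCoord_ne_zero _)) ?_
  rw [inv_div]
  exact hR.1 (div_mem_ratioRing hS hi)

/-- The adapted toric charts cover the blowup. -/
theorem exists_isAdapted {𝓢 : Finset (Finset (Fin (m + 1)))}
    (h𝓢 : IsUpperSet (𝓢 : Set (Finset (Fin (m + 1)))))
    (huniv : Finset.univ ∈ 𝓢) (hempty : ∅ ∉ 𝓢) {R : LocalSubring (FunctionField K m)}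
    (hR : R ∈ ratioModel K (affineCoord K m) 𝓢) :
    ∃ π j, IsAdapted 𝓢 π j ∧ IsLocAt (toricRing K π j) R := by
  have hRm := hR
  obtain ⟨c, hc, hR⟩ := hR
  have hK : ∀ k : K, algebraMap K (FunctionField K m) k ∈ R.toSubring := fun k =>
    hR.1 (algebraMap_mem_ratioRing k)
  have hdiv : ∀ S ∈ 𝓢, ∀ f ∈ S, affineCoord K m f / affineCoord K m (c S) ∈ R.toSubring :=
    fun S hS f hf => hR.1 (div_mem_ratioRing hS hf)
  suffices key : ∀ k : Fin (m + 1), (∃ π j, IsAdapted 𝓢 π j ∧ toricRing K π j ≤ R.toSubring) ∨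
      ∃ π, (∀ i < k, tail π i ∈ 𝓢) ∧ toricRing K π k ≤ R.toSubring by
    have : ∃ π j, IsAdapted 𝓢 π j ∧ toricRing K π j ≤ R.toSubring := by
      rcases key (Fin.last m) with h | ⟨π, hπ, hle⟩
      · exact h
      · refine ⟨π, Fin.last m, ⟨hπ, ?_⟩, hle⟩
        have : tail π (Fin.last m) = ∅ := by
          ext e
          simp [mem_tail, Fin.le_last]
        rwa [this]
    obtain ⟨π, j, h, hle⟩ := this
    exact ⟨π, j, h, isLocAt_toricRing h𝓢 h hRm hle⟩
  intro k
  induction k using Fin.induction with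
  | zero =>
    refine Or.inr ⟨Equiv.swap 0 (c Finset.univ), fun i hi => absurd hi (Fin.not_lt_zero i),
      toricRing_le hK fun i => ?_⟩
    rw [chartCoord, min_eq_right (Fin.zero_le _), Equiv.swap_apply_left]
    exact hdiv _ huniv _ (Finset.mem_univ _)
  | succ k ih =>
    rcases ih with h | ⟨π, hπ, hle⟩
    · exact Or.inl h
    by_cases ht : tail π k.castSucc ∈ 𝓢
    swap
    · exact Or.inl ⟨π, k.castSucc, ⟨hπ, ht⟩, hle⟩
    -- move the generator of the ideal of the tail to the position `k + 1`
    obtain ⟨l₀, hl₀⟩ := π.surjective (c (tail π k.castSucc))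
    have hkl : k.castSucc < l₀ := apply_mem_tail.1 (hl₀ ▸ hc _ ht)
    have hlt : ∀ l ≤ k.castSucc, Equiv.swap k.succ l₀ l = l := fun l hl =>
      Equiv.swap_apply_of_ne_of_ne (hl.trans_lt Fin.castSucc_lt_succ).ne (hl.trans_lt hkl).ne
    have hgt : ∀ l, k.castSucc < l → k.castSucc < Equiv.swap k.succ l₀ l := by
      intro l hl
      by_contra! hcon
      have := hlt _ hcon
      rw [Equiv.swap_apply_self] at this
      rw [← this] at hcon
      exact absurd hl hcon.not_gt
    have htail : ∀ i ≤ k.castSucc,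
        tail (Equiv.trans (Equiv.swap k.succ l₀) π) i = tail π i := by
      intro i hi
      ext e
      rw [mem_tail, mem_tail, Equiv.symm_trans_apply, Equiv.symm_swap]
      generalize π.symm e = l
      rcases le_or_gt l k.castSucc with h | h
      · rw [hlt l h]
      · exact ⟨fun _ => hi.trans_lt h, fun _ => hi.trans_lt (hgt l h)⟩
    refine Or.inr ⟨Equiv.trans (Equiv.swap k.succ l₀) π, fun i hi => ?_,
      toricRing_le hK fun l => ?_⟩
    · rw [htail i (Fin.le_castSucc_iff.2 hi)]
      rcases (Fin.le_castSucc_iff.2 hi).eq_or_lt with rfl | h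
      exacts [ht, hπ i h]
    · rw [chartCoord, Equiv.trans_apply, Equiv.trans_apply]
      rcases lt_or_ge k.castSucc l.castSucc with hl | hl
      · have h1 : k.succ ≤ l.castSucc := Fin.castSucc_lt_iff_succ_le.1 hl
        rw [min_eq_right h1, Equiv.swap_apply_left, hl₀]
        exact hdiv _ ht _ (apply_mem_tail.2 (hgt _ (hl.trans Fin.castSucc_lt_succ)))
      · rw [min_eq_left (hl.trans Fin.castSucc_lt_succ.le), hlt _ hl]
        refine hle (div_mem_toricRing π hl ?_)
        by_contra! hcon
        have h2 := hlt _ (hcon.le.trans hl)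
        rw [Equiv.swap_apply_self] at h2
        rw [← h2] at hcon
        exact absurd hcon Fin.castSucc_lt_succ.not_gt

/-- Outside the centres the coordinates up to position `j` are invertible. -/
theorem IsAdapted.not_vanishesAt {𝓢 : Finset (Finset (Fin (m + 1)))}
    {π : Equiv.Perm (Fin (m + 1))} {j : Fin (m + 1)} (h : IsAdapted 𝓢 π j)
    {T : LocalSubring (FunctionField K m)} (hT : T ∈ outside K m 𝓢)
    (hle : toricRing K π j ≤ T.toSubring) {i : Fin (m + 1)} (hi : i ≤ j) :
    ¬ VanishesAt T (affineCoord K m (π i) / affineCoord K m (π 0)) := by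
  intro hv
  induction i using Fin.cases with
  | zero =>
    rw [div_self (affineCoord_ne_zero _)] at hv
    exact not_vanishesAt_one T hv
  | succ i =>
    refine hT.2 _ (h.tail_mem i.castSucc (Fin.castSucc_lt_succ.trans_le hi))
      (mem_coordSubspace_of_vanishesAt hT.1 (j := π 0) fun e he => ?_)
    have : i.succ ≤ π.symm e := Fin.castSucc_lt_iff_succ_le.1 (mem_tail.1 he)
    have h2 := div_mem_toricRing (K := K) π hi this
    rw [Equiv.apply_symm_apply] at h2
    rw [← div_mul_div_cancel₀ (affineCoord_ne_zero (π i.succ))]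
    exact hv.mul_left (hle h2)

theorem IsAdapted.mem_outside {𝓢 : Finset (Finset (Fin (m + 1)))}
    (h𝓢 : IsUpperSet (𝓢 : Set (Finset (Fin (m + 1)))))
    {π : Equiv.Perm (Fin (m + 1))} {j : Fin (m + 1)} (h : IsAdapted 𝓢 π j)
    {T : LocalSubring (FunctionField K m)} (hT : IsLocAt (toricRing K π j) T)
    (hv : ∀ i ≤ j, ¬ VanishesAt T (affineCoord K m (π i) / affineCoord K m (π 0))) :
    T ∈ outside K m 𝓢 := by
  have hchart : chartRing K m (π 0) ≤ T.toSubring := (chartRing_le_toricRing π j).trans hT.1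
  have hloc : IsLocAt (chartRing K m (π 0)) T := by
    obtain ⟨R, hR, hRT⟩ := exists_isLocAt_le hchart
    refine (hT.eq_of_le hRT (toricRing_le (fun k => hR.1 (algebraMap_mem_chartRing _ k))
      fun i => ?_)) ▸ hR
    rw [chartCoord, ← div_mul_div_cancel₀ (affineCoord_ne_zero (π 0))]
    refine mul_mem (hR.1 (div_mem_chartRing _ _)) ?_
    rw [← inv_div]
    refine inv_mem_of_dominates hRT (hR.1 (div_mem_chartRing _ _)) (div_ne_zero
      (affineCoord_ne_zero _) (affineCoord_ne_zero _)) (inv_mem_of_not_vanishesAt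
      (hchart (div_mem_chartRing _ _)) (hv _ (min_le_right _ _)))
  refine ⟨mem_projectiveSpace_iff.2 ⟨_, hloc⟩, fun S hS hTS => ?_⟩
  obtain ⟨i, hij, hi, -⟩ := exists_first π j (h.not_subset h𝓢 hS)
  exact hv i hij (vanishesAt_div_of_mem_coordSubspace hTS
    (fun e => hchart (div_mem_chartRing _ _)) hi)

end Charts

section Charts

variable {K : Type*} [Field K] {m : ℕ}

/-- The set of edges `e` such that `a_e` vanishes along the divisor where the `i`-th coordinate
of the toric chart `(π, j)` does. -/
def vanishingEdges (π : Equiv.Perm (Fin (m + 1))) (j : Fin (m + 1)) (i : Fin m) :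
    Finset (Fin (m + 1)) :=
  if i.castSucc < j then tail π i.castSucc else {π i.succ}

theorem apply_mem_vanishingEdges {π : Equiv.Perm (Fin (m + 1))} {j : Fin (m + 1)} {i : Fin m}
    {l : Fin (m + 1)} : π l ∈ vanishingEdges π j i ↔
      (i.castSucc < j ∧ i.castSucc < l) ∨ l = i.succ := by
  unfold vanishingEdges
  split_ifs with h
  · rw [apply_mem_tail]
    simp only [h, true_and]
    exact ⟨Or.inl, fun h' => h'.elim id fun h' => h' ▸ Fin.castSucc_lt_succ⟩
  · simp [h]

theorem zero_notMem_vanishingEdges (π : Equiv.Perm (Fin (m + 1))) (j : Fin (m + 1)) (i : Fin m) :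
    π 0 ∉ vanishingEdges π j i := by
  rw [apply_mem_vanishingEdges]
  rintro (⟨-, h⟩ | h)
  · exact Fin.not_lt_zero _ h
  · exact Fin.succ_ne_zero _ h.symm

/-- The homogeneous coordinates of projective space are monomials in the coordinates of a toric
chart. -/
theorem div_eq_prod_chartCoord (π : Equiv.Perm (Fin (m + 1))) (j e : Fin (m + 1)) :
    affineCoord K m e / affineCoord K m (π 0) =
      ∏ i with e ∈ vanishingEdges π j i, chartCoord K π j i := by
  obtain ⟨l, rfl⟩ := π.surjective e
  induction l using WellFoundedLT.induction with
  | ind l ih =>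
    induction l using Fin.cases with
    | zero =>
      rw [div_self (affineCoord_ne_zero _), Finset.filter_false_of_mem, Finset.prod_empty]
      exact fun i _ => zero_notMem_vanishingEdges π j i
    | succ l =>
      have h1 : affineCoord K m (π l.succ) / affineCoord K m (π 0) = chartCoord K π j l *
          (affineCoord K m (π (min l.castSucc j)) / affineCoord K m (π 0)) :=
        (div_mul_div_cancel₀ (affineCoord_ne_zero _)).symm
      have h2 : Finset.univ.filter (fun i => π l.succ ∈ vanishingEdges π j i) =
          insert l (Finset.univ.filter fun i =>
            π (min l.castSucc j) ∈ vanishingEdges π j i) := by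
        ext i
        simp only [Finset.mem_filter, Finset.mem_univ, true_and, Finset.mem_insert,
          apply_mem_vanishingEdges]
        simp only [Fin.lt_def, Fin.ext_iff, Fin.val_castSucc, Fin.val_succ, Fin.coe_min]
        omega
      rw [h1, h2, Finset.prod_insert, ih _ ((min_le_left _ _).trans_lt Fin.castSucc_lt_succ)]
      simp only [Finset.mem_filter, Finset.mem_univ, true_and, apply_mem_vanishingEdges]
      simp only [Fin.lt_def, Fin.ext_iff, Fin.val_castSucc, Fin.val_succ, Fin.coe_min]
      omega

theorem algebraicIndependent_chartCoord (π : Equiv.Perm (Fin (m + 1))) (j : Fin (m + 1)) :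
    AlgebraicIndependent K (chartCoord K π j) := by
  refine algebraicIndependent_of_forall_mem fun i => ?_
  have h : ∀ e, affineCoord K m e / affineCoord K m (π 0) ∈
      Algebra.adjoin K (Set.range (chartCoord K π j)) := fun e =>
    chartRing_le_toricRing π j (div_mem_chartRing _ _)
  refine ⟨_, h i.castSucc, _, h (Fin.last m), ?_⟩
  have hl : affineCoord K m (Fin.last m) = 1 := by simp [affineCoord]
  rw [hl, div_div_div_cancel_right₀ (affineCoord_ne_zero _), div_one]

theorem chartCoord_mem {π : Equiv.Perm (Fin (m + 1))} {j : Fin (m + 1)}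
    {T : Subring (FunctionField K m)} (hT : toricRing K π j ≤ T) (i : Fin m) :
    chartCoord K π j i ∈ T := coord_mem hT i

/-- The closure in the blowup `ratioModel` of the part of `coordSubspace K m S` outside the
centres. -/
def strictCoordSubspace (K : Type*) [Field K] (𝓢 : Finset (Finset (Fin (m + 1))))
    (S : Finset (Fin (m + 1))) : Set (LocalSubring (FunctionField K m)) :=
  closureIn (ratioModel K (affineCoord K m) 𝓢) (coordSubspace K m S ∩ outside K m 𝓢)

theorem vanishingIdeal_eq_top_of_notMem {F : Type*} [Field F] {X U : Set (LocalSubring F)}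
    {R : LocalSubring F} (hR : R ∈ X) (hRZ : R ∉ closureIn X U) :
    vanishingIdeal (closureIn X U) R = ⊤ := by
  refine Ideal.eq_top_iff_one _ |>.2 (mem_vanishingIdeal.2 fun T hT hRT => ?_)
  obtain ⟨-, T', hT', hTT'⟩ := hT
  exact absurd ⟨hR, T', hT', hRT.trans hTT'⟩ hRZ

/-- The point of a toric chart that is generic on the linear subspace where some coordinates
vanish. -/
theorem exists_generic_point (π : Equiv.Perm (Fin (m + 1))) (j : Fin (m + 1)) (J : Set (Fin m)) :
    ∃ T : LocalSubring (FunctionField K m), IsLocAt (toricRing K π j) T ∧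
      ∀ q, VanishesAt T (MvPolynomial.aeval (chartCoord K π j) q) ↔ q ∈ coordIdeal K J :=
  exists_isLocAt_vanishesAt_iff (algebraicIndependent_chartCoord (K := K) π j) _

theorem generic_point_vanishesAt_coord {π : Equiv.Perm (Fin (m + 1))} {j : Fin (m + 1)}
    {J : Set (Fin m)} {T : LocalSubring (FunctionField K m)}
    (hT : ∀ q, VanishesAt T (MvPolynomial.aeval (chartCoord K π j) q) ↔ q ∈ coordIdeal K J)
    (i : Fin m) : VanishesAt T (chartCoord K π j i) ↔ i ∈ J := by
  have := hT (MvPolynomial.X i)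
  rwa [MvPolynomial.aeval_X, X_mem_coordIdeal] at this

/-- The generic point of a linear subspace of a toric chart contains the local rings of all points
of that subspace. -/
theorem IsLocAt.le_generic_point {π : Equiv.Perm (Fin (m + 1))} {j : Fin (m + 1)}
    {J : Set (Fin m)} {R T : LocalSubring (FunctionField K m)} (hR : IsLocAt (toricRing K π j) R)
    (hT : IsLocAt (toricRing K π j) T)
    (hTJ : ∀ q, VanishesAt T (MvPolynomial.aeval (chartCoord K π j) q) ↔ q ∈ coordIdeal K J)
    (hRJ : ∀ i ∈ J, VanishesAt R (chartCoord K π j i)) : R.toSubring ≤ T.toSubring := by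
  refine hR.le_of_vanishesAt hT.1 fun t ht hv => ?_
  obtain ⟨q, rfl⟩ := mem_adjoin_range_iff.1 ht
  have hq := (hTJ q).1 hv
  have : ∀ q ∈ coordIdeal K J, VanishesAt R (MvPolynomial.aeval (chartCoord K π j) q) := by
    intro q hq
    induction hq using Submodule.span_induction with
    | mem q hq =>
      obtain ⟨i, hi, rfl⟩ := hq
      rw [MvPolynomial.aeval_X]
      exact hRJ i hi
    | zero =>
      rw [map_zero]
      exact vanishesAt_zero R
    | add p q _ _ hp hq =>
      rw [map_add]
      exact hp.add hq
    | smul p q _ hq =>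
      rw [smul_eq_mul, map_mul]
      exact hq.mul_left (aeval_mem hR.1 p)
  exact this q hq

/-- On an adapted chart the coordinate ideal of `S` is a monomial times the ideal of a linear
coordinate subspace of the chart, and that subspace is the strict transform of `a_e = 0`,
`e ∈ S`. -/
theorem isMultipleOfCoordIdeal_strictCoordSubspace {𝓢 : Finset (Finset (Fin (m + 1)))}
    (h𝓢 : IsUpperSet (𝓢 : Set (Finset (Fin (m + 1))))) (huniv : Finset.univ ∈ 𝓢) (hempty : ∅ ∉ 𝓢)
    {S : Finset (Fin (m + 1))} {R : LocalSubring (FunctionField K m)}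
    (hR : R ∈ ratioModel K (affineCoord K m) 𝓢) :
    IsMultipleOfCoordIdeal (affineCoord K m) (strictCoordSubspace K 𝓢 S) S R := by
  obtain ⟨π, j, h, hloc⟩ := exists_isAdapted h𝓢 huniv hempty hR
  have hchart : ∀ {T : LocalSubring (FunctionField K m)}, toricRing K π j ≤ T.toSubring → ∀ e,
      affineCoord K m e / affineCoord K m (π 0) ∈ T.toSubring := fun hT e =>
    hT (chartRing_le_toricRing π j (div_mem_chartRing _ _))
  -- functions `a_e / a_{π(i)}`, where `i ≤ j`, vanish on the strict transform if `e ∈ S`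
  have hvan : ∀ i ≤ j, ∀ e ∈ S, affineCoord K m e / affineCoord K m (π i) ∈ toricRing K π j →
      ∀ T ∈ strictCoordSubspace K 𝓢 S, R.toSubring ≤ T.toSubring →
        VanishesAt T (affineCoord K m e / affineCoord K m (π i)) := by
    rintro i hi e he hmem T ⟨-, T', ⟨hT'S, hT'⟩, hTT'⟩ hRT
    have hle := (hloc.1.trans hRT).trans hTT'
    have h1 := vanishesAt_div_of_mem_coordSubspace hT'S (hchart hle) he
    have h2 := h.not_vanishesAt hT' hle hi
    rw [← div_mul_div_cancel₀ (affineCoord_ne_zero (π i))] at h1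
    exact ((h1.or_of_mul (hle hmem) (hchart hle _)).resolve_right h2).of_le hTT'
      (hRT (hloc.1 hmem))
  by_cases hSj : S ⊆ tail π j
  · -- the generators `a_e / a_{π(j)}` are coordinates of the chart
    have hcoord : ∀ e ∈ S, ∃ i : Fin m, j ≤ i.castSucc ∧ π i.succ = e := by
      intro e he
      have hj := mem_tail.1 (hSj he)
      obtain ⟨i, hi⟩ := Fin.exists_succ_eq.2 (Fin.ne_zero_of_lt hj)
      refine ⟨i, Fin.le_castSucc_iff.2 (hi ▸ hj), ?_⟩
      rw [hi, Equiv.apply_symm_apply]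
    have hz : ∀ i : Fin m, j ≤ i.castSucc → affineCoord K m (π i.succ) / affineCoord K m (π j) =
        chartCoord K π j i := fun i hi => by rw [chartCoord, min_eq_right hi]
    have hgen : ∀ e ∈ S, affineCoord K m e / affineCoord K m (π j) ∈ toricRing K π j := by
      intro e he
      obtain ⟨i, hi, rfl⟩ := hcoord e he
      rw [hz i hi]
      exact chartCoord_mem le_rfl i
    refine ⟨affineCoord K m (π j), affineCoord_ne_zero _, fun e he => hloc.1 (hgen e he),
      fun f => ⟨fun hf => ?_, ?_⟩⟩
    swap
    · rintro ⟨r, hr, hf⟩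
      refine mem_vanishingIdeal.2 fun T hT hRT => ?_
      rw [hf]
      exact VanishesAt.sum _ _ fun e he =>
        (hvan j le_rfl e he (hgen e he) T hT hRT).mul_left (hRT (hr e he))
    by_cases hunit : ∃ e ∈ S, ¬ VanishesAt R (affineCoord K m e / affineCoord K m (π j))
    · obtain ⟨e, he, hv⟩ := hunit
      have hi := inv_mem_of_not_vanishesAt (hloc.1 (hgen e he)) hv
      refine ⟨fun e' => if e' = e then
        (f : FunctionField K m) * (affineCoord K m e / affineCoord K m (π j))⁻¹ else 0,
        fun e' _ => ?_, ?_⟩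
      · dsimp only
        split_ifs
        exacts [mul_mem f.2 hi, zero_mem _]
      · simp only [ite_mul, zero_mul, Finset.sum_ite_eq', he, if_true]
        rw [inv_mul_cancel_right₀ (ne_zero_of_not_vanishesAt hv)]
    push Not at hunit
    -- otherwise, use the generic point of the subspace where the generators vanish
    let J : Set (Fin m) := {i | j ≤ i.castSucc ∧ π i.succ ∈ S}
    obtain ⟨T, hT, hTJ⟩ := exists_generic_point (K := K) π j J
    have hRT : R.toSubring ≤ T.toSubring := hloc.le_generic_point hT hTJ fun i hi => by
      rw [← hz i hi.1]
      exact hunit _ hi.2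
    have hTout : T ∈ outside K m 𝓢 := by
      refine h.mem_outside h𝓢 hT fun i hi hv => ?_
      rw [div_eq_prod_chartCoord π j] at hv
      obtain ⟨l, hl, hv⟩ := hv.exists_of_prod _ _ fun l _ => chartCoord_mem hT.1 l
      rw [generic_point_vanishesAt_coord hTJ] at hv
      rw [Finset.mem_filter, apply_mem_vanishingEdges] at hl
      rcases hl.2 with hl | hl
      · exact absurd hl.1 hv.1.not_gt
      · rw [hl] at hi
        exact absurd (Fin.castSucc_lt_succ.trans_le hi) hv.1.not_gt
    have hTS : T ∈ coordSubspace K m S := by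
      refine mem_coordSubspace_of_vanishesAt hTout.1 (j := π 0) fun e he => ?_
      rw [← div_mul_div_cancel₀ (affineCoord_ne_zero (π j))]
      obtain ⟨i, hi, rfl⟩ := hcoord e he
      rw [hz i hi]
      exact ((generic_point_vanishesAt_coord hTJ i).2 ⟨hi, he⟩).mul_right (hchart hT.1 _)
    have hTZ : T ∈ strictCoordSubspace K 𝓢 S :=
      ⟨outside_subset_ratioModel huniv hTout, T, ⟨hTS, hTout⟩, le_rfl⟩
    have hfv := mem_vanishingIdeal.1 hf T hTZ hRT
    obtain ⟨x, hx, y, hy, hyR, hfxy⟩ := hloc.2 f f.2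
    have hxv : VanishesAt T x := by
      have := hfv.mul_right (hT.1 hy)
      rwa [hfxy, inv_mul_cancel_right₀ (ne_zero_of_not_vanishesAt hyR)] at this
    obtain ⟨q, rfl⟩ := mem_adjoin_range_iff.1 hx
    have hq := (hTJ q).1 hxv
    have hyi := inv_mem_of_not_vanishesAt (hloc.1 hy) hyR
    have key : ∀ q ∈ coordIdeal K J, ∃ r : Fin (m + 1) → FunctionField K m,
        (∀ e ∈ S, r e ∈ R.toSubring) ∧ MvPolynomial.aeval (chartCoord K π j) q =
          ∑ e ∈ S, r e * (affineCoord K m e / affineCoord K m (π j)) := by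
      intro q hq
      induction hq using Submodule.span_induction with
      | mem q hq =>
        obtain ⟨i, hi, rfl⟩ := hq
        refine ⟨fun e => if e = π i.succ then 1 else 0, fun e _ => ?_, ?_⟩
        · dsimp only
          split_ifs
          exacts [one_mem _, zero_mem _]
        · simp only [ite_mul, zero_mul, one_mul, Finset.sum_ite_eq', hi.2, if_true,
            MvPolynomial.aeval_X, hz i hi.1]
      | zero => exact ⟨fun _ => 0, fun _ _ => zero_mem _, by simp⟩
      | add p q _ _ hp hq =>
        obtain ⟨r, hr, hp⟩ := hp
        obtain ⟨s, hs, hq⟩ := hq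
        refine ⟨fun e => r e + s e, fun e he => add_mem (hr e he) (hs e he), ?_⟩
        simp only [map_add, hp, hq, add_mul, Finset.sum_add_distrib]
      | smul p q _ hq =>
        obtain ⟨s, hs, hq⟩ := hq
        refine ⟨fun e => MvPolynomial.aeval (chartCoord K π j) p * s e,
          fun e he => mul_mem (aeval_mem hloc.1 p) (hs e he), ?_⟩
        simp only [smul_eq_mul, map_mul, hq, Finset.mul_sum, mul_assoc]
    obtain ⟨r, hr, hqr⟩ := key q hq
    refine ⟨fun e => y⁻¹ * r e, fun e he => mul_mem hyi (hr e he), ?_⟩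
    rw [hfxy, hqr, mul_comm, Finset.mul_sum]
    exact Finset.sum_congr rfl fun e _ => (mul_assoc _ _ _).symm
  · -- the coordinate ideal is invertible near `R`, which is not on the strict transform
    obtain ⟨i, hij, hi, hmin⟩ := exists_first π j hSj
    have hmem : ∀ e ∈ S, affineCoord K m e / affineCoord K m (π i) ∈ toricRing K π j :=
      fun e he => div_mem_toricRing_of_first π hij hmin he
    refine ⟨affineCoord K m (π i), affineCoord_ne_zero _, fun e he => hloc.1 (hmem e he),
      fun f => ⟨fun _ => ⟨fun e => if e = π i then (f : FunctionField K m) else 0,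
        fun e _ => ?_, ?_⟩, fun _ => mem_vanishingIdeal.2 fun T hT hRT => ?_⟩⟩
    · dsimp only
      split_ifs
      exacts [f.2, zero_mem _]
    · simp only [ite_mul, zero_mul, Finset.sum_ite_eq', hi, if_true]
      rw [div_self (affineCoord_ne_zero _), mul_one]
    · have := hvan i hij _ hi (hmem _ hi) T hT hRT
      rw [div_self (affineCoord_ne_zero _)] at this
      exact absurd this (not_vanishesAt_one T)

end Charts

/-! ### The tower of blowups -/

section Tower

variable {K : Type*} [Field K] {m : ℕ}

variable (K m) in
/-- The stage `P` of a sequence of blowups has blown up the coordinate linear spaces given by `𝓢`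
(where `Finset.univ`, which gives the empty set, is included by convention). -/
structure IsBlowupOf (P : Stage (FunctionField K m)) (𝓢 : Finset (Finset (Fin (m + 1)))) :
    Prop where
  space_eq : P.space = ratioModel K (affineCoord K m) 𝓢
  exceptional_eq : P.exceptional = ratioModel K (affineCoord K m) 𝓢 \ outside K m 𝓢
  strict_subset : ∀ W ⊆ projectiveSpace K m,
    P.strict W ⊆ closureIn (ratioModel K (affineCoord K m) 𝓢) (W ∩ outside K m 𝓢)
  strict_eq : ∀ S, P.strict (coordSubspace K m S) = strictCoordSubspace K 𝓢 S

theorem coordSubspace_univ : coordSubspace K m Finset.univ = ∅ := by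
  refine Set.eq_empty_of_forall_notMem fun T hT => ?_
  obtain ⟨j, -, hv⟩ := mem_coordSubspace_iff.1 hT
  have := hv j (Finset.mem_univ j)
  rw [div_self (affineCoord_ne_zero _)] at this
  exact not_vanishesAt_one T this

theorem outside_singleton_univ : outside K m {Finset.univ} = projectiveSpace K m := by
  ext T
  simp [outside, coordSubspace_univ (K := K)]

theorem isBlowupOf_initial :
    IsBlowupOf K m (Stage.initial (projectiveSpace K m)) {Finset.univ} where
  space_eq := projectiveSpace_eq_ratioModel
  exceptional_eq := by
    rw [outside_singleton_univ, projectiveSpace_eq_ratioModel, Set.sdiff_self]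
    rfl
  strict_subset W hW T hT := by
    rw [outside_singleton_univ, ← projectiveSpace_eq_ratioModel]
    exact ⟨hW hT, T, ⟨hT, hW hT⟩, le_rfl⟩
  strict_eq S := by
    ext T
    unfold strictCoordSubspace
    rw [outside_singleton_univ, ← projectiveSpace_eq_ratioModel]
    constructor
    · intro hT
      exact ⟨zeroLocus_subset _ hT, T, ⟨hT, zeroLocus_subset _ hT⟩, le_rfl⟩
    · rintro ⟨hT, T', ⟨hT', -⟩, hle⟩
      exact mem_coordSubspace_of_le hT hT' hle

theorem outside_insert_subset (𝓢 : Finset (Finset (Fin (m + 1)))) (S : Finset (Fin (m + 1))) :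
    outside K m (insert S 𝓢) ⊆ outside K m 𝓢 := fun _ hT =>
  ⟨hT.1, fun S' hS' => hT.2 S' (Finset.mem_insert_of_mem hS')⟩

/-- A point outside the previous centres lies on the strict transform of a coordinate linear space
if and only if it lies on that space. -/
theorem mem_strictCoordSubspace_iff_of_mem_outside {𝓢 : Finset (Finset (Fin (m + 1)))}
    (huniv : Finset.univ ∈ 𝓢) {S : Finset (Fin (m + 1))} {T : LocalSubring (FunctionField K m)}
    (hT : T ∈ outside K m 𝓢) : T ∈ strictCoordSubspace K 𝓢 S ↔ T ∈ coordSubspace K m S := by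
  constructor
  · rintro ⟨-, T', ⟨hT', -⟩, hle⟩
    exact mem_coordSubspace_of_le hT.1 hT' hle
  · intro h
    exact ⟨outside_subset_ratioModel huniv hT, T, ⟨h, hT⟩, le_rfl⟩

theorem mem_outside_insert_iff {𝓢 : Finset (Finset (Fin (m + 1)))} {S : Finset (Fin (m + 1))}
    {T : LocalSubring (FunctionField K m)} :
    T ∈ outside K m (insert S 𝓢) ↔ T ∈ outside K m 𝓢 ∧ T ∉ coordSubspace K m S := by
  simp only [outside, Set.mem_ofPred_eq, Finset.forall_mem_insert]
  tauto

/-- Blowing up one more strict transform adds the corresponding factor to the product of coordinate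
ideals. -/
theorem IsBlowupOf.next {P : Stage (FunctionField K m)} {𝓢 : Finset (Finset (Fin (m + 1)))}
    (hP : IsBlowupOf K m P 𝓢) (h𝓢 : IsUpperSet (𝓢 : Set (Finset (Fin (m + 1)))))
    (huniv : Finset.univ ∈ 𝓢) (hempty : ∅ ∉ 𝓢) {S : Finset (Fin (m + 1))} (hS : S ∉ 𝓢) :
    IsBlowupOf K m (P.next (coordSubspace K m S)) (insert S 𝓢) := by
  set Z := strictCoordSubspace K 𝓢 S with hZdef
  have hZ : ∀ R ∈ ratioModel K (affineCoord K m) 𝓢,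
      IsMultipleOfCoordIdeal (affineCoord K m) Z S R := fun R hR =>
    isMultipleOfCoordIdeal_strictCoordSubspace h𝓢 huniv hempty hR
  have hspace : blowup P.space (P.strict (coordSubspace K m S)) =
      ratioModel K (affineCoord K m) (insert S 𝓢) := by
    rw [hP.space_eq, hP.strict_eq]
    exact blowup_ratioModel affineCoord_ne_zero hS hZ
  have huniv' : Finset.univ ∈ insert S 𝓢 := Finset.mem_insert_of_mem huniv
  -- the blowup is an isomorphism outside the centre
  have hiso : ∀ {R T}, R ∈ ratioModel K (affineCoord K m) 𝓢 → R ∉ Z →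
      T ∈ ratioModel K (affineCoord K m) (insert S 𝓢) → R ≤ T → R = T := fun hR hRZ hT hRT =>
    eq_of_mem_ratioModel_insert affineCoord_ne_zero hR (hZ _ hR)
      (vanishingIdeal_eq_top_of_notMem hR hRZ) hT hRT
  have hZm : Z ⊆ ratioModel K (affineCoord K m) 𝓢 := fun T hT => hT.1
  have hout : ∀ {T}, T ∈ outside K m (insert S 𝓢) → T ∉ Z := fun hT hTZ =>
    (mem_outside_insert_iff.1 hT).2 ((mem_strictCoordSubspace_iff_of_mem_outside huniv
      (mem_outside_insert_iff.1 hT).1).1 hTZ)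
  have hstrict : ∀ W ⊆ projectiveSpace K m, (P.next (coordSubspace K m S)).strict W ⊆
      closureIn (ratioModel K (affineCoord K m) (insert S 𝓢)) (W ∩ outside K m (insert S 𝓢)) := by
    rintro W hW T ⟨hT, T₁, ⟨hT₁, Q, ⟨hQW, hQZ⟩, hQT₁⟩, hTT₁⟩
    rw [hspace] at hT hT₁
    rw [hP.strict_eq] at hQZ
    obtain ⟨hQ, Q', ⟨hQ'W, hQ'⟩, hQQ'⟩ := hP.strict_subset W hW hQW
    obtain rfl := hiso hQ hQZ hT₁ hQT₁
    refine ⟨hT, Q', ⟨hQ'W, mem_outside_insert_iff.2 ⟨hQ', fun hQ'S => hQZ ?_⟩⟩, hTT₁.trans hQQ'⟩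
    exact ⟨hQ, Q', ⟨hQ'S, hQ'⟩, hQQ'⟩
  refine ⟨hspace, ?_, hstrict, fun S' => ?_⟩
  · change inverseImage (blowup P.space (P.strict (coordSubspace K m S)))
      (P.strict (coordSubspace K m S) ∪ P.exceptional) = _
    rw [hspace, hP.strict_eq, hP.exceptional_eq]
    ext T
    constructor
    · rintro ⟨hT, R, hR, hRT⟩
      refine ⟨hT, fun hTout => ?_⟩
      have hTm := outside_subset_ratioModel huniv (outside_insert_subset _ _ hTout)
      have hRm : R ∈ ratioModel K (affineCoord K m) 𝓢 := hR.elim (fun h => hZm h) fun h => h.1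
      obtain rfl := ratioModel_separated affineCoord_ne_zero hRm hTm hRT le_rfl
      rcases hR with h | h
      · exact hout hTout h
      · exact h.2 (outside_insert_subset _ _ hTout)
    · rintro ⟨hT, hTout⟩
      obtain ⟨R, hR, hRT⟩ := exists_mem_ratioModel_le (Finset.subset_insert S 𝓢) hT
      refine ⟨hT, R, ?_, hRT⟩
      by_contra hcon
      simp only [Set.mem_union, Set.mem_sdiff, not_or, not_and, not_not] at hcon
      have hRout := hcon.2 hR
      obtain rfl := hiso hR hcon.1 hT hRT
      exact hTout (mem_outside_insert_iff.2 ⟨hRout, fun h =>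
        hcon.1 ((mem_strictCoordSubspace_iff_of_mem_outside huniv hRout).2 h)⟩)
  · refine le_antisymm (hstrict _ (zeroLocus_subset _)) ?_
    rintro T ⟨hT, T', ⟨hT'S, hT'⟩, hTT'⟩
    have hT'out := outside_insert_subset _ _ hT'
    refine ⟨hspace ▸ hT, T', ⟨hspace ▸ outside_subset_ratioModel huniv' hT', T', ⟨?_, ?_⟩, le_rfl⟩,
      hTT'⟩
    · rw [hP.strict_eq]
      exact (mem_strictCoordSubspace_iff_of_mem_outside huniv hT'out).2 hT'S
    · rw [hP.strict_eq]
      exact hout hT'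

/-- Any upper set of non-empty sets of edges can be blown up, larger sets first. -/
theorem exists_tower {𝓢 : Finset (Finset (Fin (m + 1)))}
    (h𝓢 : IsUpperSet (𝓢 : Set (Finset (Fin (m + 1))))) (huniv : Finset.univ ∈ 𝓢) (hempty : ∅ ∉ 𝓢) :
    ∃ L : List (Finset (Fin (m + 1))), (∀ s ∈ L, s ∈ 𝓢 ∧ s ≠ Finset.univ) ∧
      IsBlowupOf K m (tower K m L) 𝓢 := by
  induction hn : 𝓢.card generalizing 𝓢 with
  | zero => exact absurd huniv (by simp [Finset.card_eq_zero.1 hn])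
  | succ n ih =>
    by_cases hone : 𝓢 = {Finset.univ}
    · subst hone
      exact ⟨[], by simp, isBlowupOf_initial⟩
    obtain ⟨S, hS⟩ := 𝓢.exists_minimal ⟨_, huniv⟩
    have hSu : S ≠ Finset.univ := by
      rintro rfl
      refine hone (Finset.eq_singleton_iff_unique_mem.2 ⟨huniv, fun S' hS' => ?_⟩)
      exact Finset.eq_univ_iff_forall.2 fun e => hS.2 hS' (Finset.subset_univ _)
        (Finset.mem_univ e)
    have hupper : IsUpperSet ((𝓢.erase S : Finset _) : Set (Finset (Fin (m + 1)))) := by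
      intro A B hAB hA
      rw [Finset.mem_coe, Finset.mem_erase] at hA ⊢
      refine ⟨?_, h𝓢 hAB hA.2⟩
      rintro rfl
      exact hA.1 (le_antisymm hAB (hS.2 hA.2 hAB))
    have huniv' : Finset.univ ∈ 𝓢.erase S := Finset.mem_erase.2 ⟨hSu.symm, huniv⟩
    have hempty' : ∅ ∉ 𝓢.erase S := fun h => hempty (Finset.mem_of_mem_erase h)
    obtain ⟨L, hL, hP⟩ := ih hupper huniv' hempty' (by
      rw [Finset.card_erase_of_mem hS.1, hn, Nat.add_sub_cancel])
    refine ⟨L ++ [S], fun s hs => ?_, ?_⟩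
    · rcases List.mem_append.1 hs with hs | hs
      · exact ⟨Finset.mem_of_mem_erase (hL s hs).1, (hL s hs).2⟩
      · rw [List.mem_singleton.1 hs]
        exact ⟨hS.1, hSu⟩
    · have := hP.next hupper huniv' hempty' (Finset.notMem_erase S 𝓢)
      rw [Finset.insert_erase hS.1] at this
      rw [tower, List.foldl_append]
      exact this

end Tower

/-! ### Regular systems of parameters -/

section Regular

open IsLocalRing

/-- Elements of the maximal ideal of a regular local ring that are linearly independent modulo its
square extend to a regular system of parameters. -/
theorem exists_regular_parameters {R : Type*} [CommRing R] [IsRegularLocalRing R] {ι : Type*}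
    (J : Finset ι) (x : ι → R) (hx : ∀ i ∈ J, x i ∈ maximalIdeal R)
    (hind : ∀ c : ι → R, ∑ i ∈ J, c i * x i ∈ maximalIdeal R ^ 2 → ∀ i ∈ J, c i ∈ maximalIdeal R) :
    ∃ (d : ℕ) (t : Fin d → R), ringKrullDim R = d ∧
      Ideal.span (Set.range t) = maximalIdeal R ∧
      ∃ J' : Finset (Fin d), ∏ i ∈ J', t i = ∏ i ∈ J, x i := by
  let v : J → CotangentSpace R := fun i => (maximalIdeal R).toCotangent ⟨x i, hx i i.2⟩
  have hv : LinearIndependent (ResidueField R) v := by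
    rw [Fintype.linearIndependent_iff]
    intro g hg i
    choose c hc using fun i => residue_surjective (R := R) (g i)
    have h0 : (maximalIdeal R).toCotangent (∑ i : J, c i • ⟨x i, hx i i.2⟩) = 0 := by
      rw [map_sum, ← hg]
      refine Finset.sum_congr rfl fun i _ => ?_
      rw [map_smul, ← hc]
      rfl
    rw [Ideal.toCotangent_eq_zero] at h0
    have h1 := hind (fun i => if h : i ∈ J then c ⟨i, h⟩ else 0) (by
      convert h0 using 1
      rw [← Finset.sum_attach, AddSubmonoidClass.coe_finsetSum]
      exact Finset.sum_congr rfl fun i _ => by simp) i i.2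
    rw [dif_pos i.2] at h1
    rw [← hc, residue_eq_zero_iff]
    exact h1
  have hs := hv.linearIndepOn_id
  let b := Module.Basis.extend hs
  let _ := FiniteDimensional.fintypeBasisIndex b
  have hvb : ∀ i, v i ∈ hs.extend (Set.subset_univ _) := fun i =>
    Module.Basis.subset_extend hs ⟨i, rfl⟩
  -- lift the basis to the maximal ideal, the given elements to themselves
  have hlift : ∀ y : hs.extend (Set.subset_univ _), ∃ l : maximalIdeal R,
      (maximalIdeal R).toCotangent l = y ∧ ∀ i : J, v i = y → (l : R) = x i := by
    intro y
    by_cases h : ∃ i : J, v i = y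
    · obtain ⟨i, hi⟩ := h
      refine ⟨⟨x i, hx i i.2⟩, hi, fun i' hi' => ?_⟩
      rw [hv.injective (hi'.trans hi.symm)]
    · obtain ⟨l, hl⟩ := (maximalIdeal R).toCotangent_surjective (y : CotangentSpace R)
      exact ⟨l, hl, fun i hi => absurd ⟨i, hi⟩ h⟩
  choose l hl hlx using hlift
  let e := Fintype.equivFin (hs.extend (Set.subset_univ _))
  refine ⟨Fintype.card (hs.extend (Set.subset_univ _)), fun i => l (e.symm i), ?_, ?_, ?_⟩
  · rw [← (IsRegularLocalRing.iff_finrank_cotangentSpace R).1 inferInstance,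
      Module.finrank_eq_card_basis b]
  · have h1 : Submodule.span (ResidueField R)
        ((maximalIdeal R).toCotangent '' Set.range fun i => l (e.symm i)) = ⊤ := by
      rw [eq_top_iff, ← b.span_eq]
      refine Submodule.span_mono ?_
      rintro _ ⟨y, rfl⟩
      refine ⟨l y, ⟨e y, by simp⟩, ?_⟩
      rw [hl, Module.Basis.extend_apply_self]
    rw [CotangentSpace.span_image_eq_top_iff] at h1
    have h2 := congrArg (Submodule.map (maximalIdeal R).subtype) h1
    rw [Submodule.map_span, Submodule.map_top, Submodule.range_subtype, ← Set.range_comp] at h2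
    exact h2
  · refine ⟨J.attach.image fun i => e ⟨v i, hvb i⟩, ?_⟩
    rw [Finset.prod_image, ← Finset.prod_attach J]
    · refine Finset.prod_congr rfl fun i _ => ?_
      rw [Equiv.symm_apply_apply]
      exact hlx _ i rfl
    · intro i _ i' _ h
      exact hv.injective (congrArg Subtype.val (e.injective h))

variable {K : Type*} [Field K] {σ : Type*} [Finite σ] {F : Type*} [Field F] [Algebra K F]
  {x : σ → F}

/-- The local ring of an affine space at a point is regular, and those coordinates that vanish at
the point are part of a regular system of parameters. -/
theorem isRegular_of_isLocAt_adjoin (hx : AlgebraicIndependent K x) {R : LocalSubring F}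
    (hR : IsLocAt (Algebra.adjoin K (Set.range x)).toSubring R) (J : Finset σ)
    (hJ : ∀ i ∈ J, VanishesAt R (x i)) :
    IsRegularLocalRing R.toSubring ∧ ∃ (d : ℕ) (t : Fin d → R.toSubring),
      ringKrullDim R.toSubring = d ∧
      Ideal.span (Set.range t) = maximalIdeal R.toSubring ∧
      ∃ J' : Finset (Fin d), ((∏ i ∈ J', t i : R.toSubring) : F) = ∏ i ∈ J, x i := by
  let φ : MvPolynomial σ K →+* R.toSubring :=
    (MvPolynomial.aeval x : MvPolynomial σ K →ₐ[K] F).toRingHom.codRestrict R.toSubring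
      (aeval_mem hR.1)
  let _ : Algebra (MvPolynomial σ K) R.toSubring := φ.toAlgebra
  let p : Ideal (MvPolynomial σ K) := (maximalIdeal R.toSubring).comap φ
  have hval : ∀ q, ((algebraMap (MvPolynomial σ K) R.toSubring q : R.toSubring) : F) =
      MvPolynomial.aeval x q := fun _ => rfl
  have hinj : Function.Injective (algebraMap (MvPolynomial σ K) R.toSubring) := fun q q' h =>
    hx (congrArg Subtype.val h)
  have hp : ∀ q, q ∈ p ↔ VanishesAt R (MvPolynomial.aeval x q) := fun q =>
    ⟨fun h => ⟨_, h⟩, fun h => h.2⟩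
  have hloc : IsLocalization.AtPrime R.toSubring p := by
    refine ⟨fun s => ?_, fun y => ?_, fun h => ⟨1, by rw [hinj h]⟩⟩
    · by_contra hu
      exact s.2 ((mem_maximalIdeal _).2 hu)
    · obtain ⟨a, ha, b, hb, hbv, hy⟩ := hR.2 y y.2
      obtain ⟨q, rfl⟩ := mem_adjoin_range_iff.1 ha
      obtain ⟨s, rfl⟩ := mem_adjoin_range_iff.1 hb
      refine ⟨⟨q, ⟨s, fun h => hbv ((hp s).1 h)⟩⟩, Subtype.ext ?_⟩
      rw [Subring.coe_mul, hval, hval, hy]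
      exact inv_mul_cancel_right₀ (ne_zero_of_not_vanishesAt hbv) _
  have hreg : IsRegularLocalRing R.toSubring :=
    IsRegularLocalRing.of_ringEquiv
      (IsLocalization.algEquiv p.primeCompl (Localization.AtPrime p) R.toSubring).toRingEquiv
  refine ⟨hreg, ?_⟩
  have hX : ∀ i ∈ J, MvPolynomial.X i ∈ p := fun i hi =>
    (hp _).2 (by rw [MvPolynomial.aeval_X]; exact hJ i hi)
  obtain ⟨d, t, hd, ht, J', hJ'⟩ := exists_regular_parameters J
    (fun i => algebraMap (MvPolynomial σ K) R.toSubring (MvPolynomial.X i)) hX (by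
    intro c hc i hi
    -- clear denominators and apply the derivation with respect to the `i`-th coordinate
    obtain ⟨s, hs⟩ := IsLocalization.exist_integer_multiples_of_finset p.primeCompl (J.image c)
    have hs' : ∀ j, ∃ n : MvPolynomial σ K, j ∈ J →
        algebraMap _ R.toSubring n = algebraMap _ R.toSubring (s : MvPolynomial σ K) * c j := by
      intro j
      by_cases hj : j ∈ J
      · obtain ⟨n, hn⟩ := hs (c j) (Finset.mem_image_of_mem c hj)
        exact ⟨n, fun _ => hn.trans (Algebra.smul_def _ _)⟩
      · exact ⟨0, fun h => absurd h hj⟩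
    choose n hn using hs'
    have hN : algebraMap _ R.toSubring (∑ j ∈ J, n j * MvPolynomial.X j) ∈
        maximalIdeal R.toSubring ^ 2 := by
      have : algebraMap _ R.toSubring (∑ j ∈ J, n j * MvPolynomial.X j) =
          algebraMap _ R.toSubring (s : MvPolynomial σ K) * ∑ j ∈ J, c j *
            algebraMap (MvPolynomial σ K) R.toSubring (MvPolynomial.X j) := by
        rw [map_sum, Finset.mul_sum]
        refine Finset.sum_congr rfl fun j hj => ?_
        rw [map_mul, hn j hj, mul_assoc]
      rw [this]
      exact Ideal.mul_mem_left _ _ hc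
    rw [← IsLocalization.AtPrime.map_eq_maximalIdeal p, ← Ideal.map_pow,
      IsLocalization.mem_map_algebraMap_iff p.primeCompl] at hN
    obtain ⟨⟨⟨q, hq⟩, s'⟩, hqs⟩ := hN
    rw [← map_mul] at hqs
    have hqs := hinj hqs
    have hder : ∀ q ∈ p ^ 2, MvPolynomial.pderiv i q ∈ p := by
      intro q hq
      rw [pow_two] at hq
      induction hq using Submodule.mul_induction_on' with
      | mem_mul_mem a ha b hb =>
        rw [Derivation.leibniz]
        exact add_mem (Ideal.mul_mem_right _ _ ha) (Ideal.mul_mem_right _ _ hb)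
      | add a _ b _ ha hb =>
        rw [map_add]
        exact add_mem ha hb
    have h1 := hder q hq
    have hXsum : ∑ j ∈ J, n j * MvPolynomial.X j ∈ p :=
      sum_mem fun j hj => Ideal.mul_mem_left _ _ (hX j hj)
    dsimp only at hqs
    rw [← hqs, Derivation.leibniz, smul_eq_mul, smul_eq_mul, map_sum] at h1
    have h2 := (Ideal.add_mem_iff_right _ (Ideal.mul_mem_right _ _ hXsum)).1 h1
    have h3 := (Ideal.IsPrime.mem_or_mem inferInstance h2).resolve_left s'.2
    have h4 : ∑ j ∈ J, MvPolynomial.pderiv i (n j * MvPolynomial.X j) - n i ∈ p := by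
      have : n i = ∑ j ∈ J, n j * MvPolynomial.pderiv i (MvPolynomial.X j : MvPolynomial σ K) := by
        rw [Finset.sum_eq_single_of_mem i hi, MvPolynomial.pderiv_X_self, mul_one]
        intro j _ hji
        rw [MvPolynomial.pderiv_X_of_ne hji, mul_zero]
      rw [this]
      rw [← Finset.sum_sub_distrib]
      refine sum_mem fun j hj => ?_
      rw [Derivation.leibniz, smul_eq_mul, smul_eq_mul, add_sub_cancel_left]
      exact Ideal.mul_mem_right _ _ (hX j hj)
    have h5 : n i ∈ p := by
      simpa only [sub_sub_cancel] using sub_mem h3 h4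
    have h6 : algebraMap _ R.toSubring (s : MvPolynomial σ K) * c i ∈
        maximalIdeal R.toSubring := by
      rw [← hn i hi]
      exact h5
    exact (Ideal.IsPrime.mem_or_mem inferInstance h6).resolve_left s.2)
  refine ⟨d, t, hd, ht, J', ?_⟩
  rw [hJ', ← Subring.subtype_apply, map_prod]
  refine Finset.prod_congr rfl fun i _ => ?_
  rw [Subring.subtype_apply, hval, MvPolynomial.aeval_X]

end Regular

/-! ### The total transform of the coordinate simplex -/

section Simplex

variable {K : Type*} [Field K] {m : ℕ} {𝓢 : Finset (Finset (Fin (m + 1)))}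

/-- Adapted toric charts are open in the blowup. -/
theorem IsAdapted.mem_ratioModel (h𝓢 : IsUpperSet (𝓢 : Set (Finset (Fin (m + 1)))))
    (huniv : Finset.univ ∈ 𝓢) {π : Equiv.Perm (Fin (m + 1))} {j : Fin (m + 1)}
    (h : IsAdapted 𝓢 π j) {T : LocalSubring (FunctionField K m)}
    (hT : IsLocAt (toricRing K π j) T) : T ∈ ratioModel K (affineCoord K m) 𝓢 := by
  have hex : ∀ S, ∃ i, S ∈ 𝓢 → i ≤ j ∧ π i ∈ S ∧ ∀ e ∈ S, i ≤ π.symm e := by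
    intro S
    by_cases hS : S ∈ 𝓢
    · obtain ⟨i, hi⟩ := exists_first π j (h.not_subset h𝓢 hS)
      exact ⟨i, fun _ => hi⟩
    · exact ⟨0, fun h => absurd h hS⟩
  choose c hc using hex
  have hle : ratioRing K (affineCoord K m) 𝓢 (fun S => π (c S)) ≤ toricRing K π j :=
    ratioRing_le (algebraMap_mem_toricRing π j) fun S hS f hf =>
      div_mem_toricRing_of_first π (hc S hS).1 (hc S hS).2.2 hf
  have hge : toricRing K π j ≤ ratioRing K (affineCoord K m) 𝓢 (fun S => π (c S)) := by
    refine toricRing_le algebraMap_mem_ratioRing fun i => ?_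
    have key : ∀ k : Fin (m + 1), k ≤ j → k < i.succ →
        affineCoord K m (π i.succ) / affineCoord K m (π k) ∈
          ratioRing K (affineCoord K m) 𝓢 (fun S => π (c S)) := by
      intro k hkj hki
      obtain ⟨S, hS, hSk, hSi⟩ : ∃ S ∈ 𝓢, c S = k ∧ π i.succ ∈ S := by
        induction k using Fin.cases with
        | zero =>
          refine ⟨Finset.univ, huniv, ?_, Finset.mem_univ _⟩
          have := (hc _ huniv).2.2 (π 0) (Finset.mem_univ _)
          rw [Equiv.symm_apply_apply] at this
          exact Fin.le_zero_iff.1 this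
        | succ k =>
          have hS := h.tail_mem k.castSucc (Fin.castSucc_lt_succ.trans_le hkj)
          refine ⟨_, hS, le_antisymm ?_ ?_, apply_mem_tail.2 (Fin.castSucc_lt_succ.trans hki)⟩
          · have := (hc _ hS).2.2 (π k.succ) (apply_mem_tail.2 Fin.castSucc_lt_succ)
            rwa [Equiv.symm_apply_apply] at this
          · exact Fin.castSucc_lt_iff_succ_le.1 (apply_mem_tail.1 (hc _ hS).2.1)
      rw [← hSk]
      exact div_mem_ratioRing (c := fun S => π (c S)) hS hSi
    exact key _ (min_le_right _ _) ((min_le_left _ _).trans_lt Fin.castSucc_lt_succ)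
  rw [le_antisymm hge hle] at hT
  exact ⟨_, fun S hS => (hc S hS).2.1, hT⟩

/-- On a toric chart, the total transform of the coordinate simplex is the union of the coordinate
hyperplanes. -/
theorem mem_inverseImage_coordSimplex_iff {π : Equiv.Perm (Fin (m + 1))} {j : Fin (m + 1)}
    {T : LocalSubring (FunctionField K m)} (hT : T ∈ ratioModel K (affineCoord K m) 𝓢)
    (hle : toricRing K π j ≤ T.toSubring) :
    T ∈ inverseImage (ratioModel K (affineCoord K m) 𝓢) (coordSimplex K m) ↔
      ∃ i, VanishesAt T (chartCoord K π j i) := by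
  have hchart : chartRing K m (π 0) ≤ T.toSubring := (chartRing_le_toricRing π j).trans hle
  constructor
  · rintro ⟨-, Q, ⟨j', hj', hv⟩, hQT⟩
    rw [mem_specModel_iff] at hj'
    have hv := (vanishesAt_iff_of_dominates hQT (hv _ rfl).mem).2 (hv _ rfl)
    rw [map_prod] at hv
    obtain ⟨e, -, hv⟩ := hv.exists_of_prod _ _ fun e _ => by
      rw [MvPolynomial.aeval_X]
      exact hQT.1 (hj'.1 (div_mem_chartRing e j'))
    rw [MvPolynomial.aeval_X, coordRatio] at hv
    have hv := hv.mul_right (hchart (div_mem_chartRing j' _))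
    rw [div_mul_div_cancel₀ (affineCoord_ne_zero j'), div_eq_prod_chartCoord π j] at hv
    obtain ⟨i, -, hi⟩ := hv.exists_of_prod _ _ fun i _ => chartCoord_mem hle i
    exact ⟨i, hi⟩
  · rintro ⟨i, hi⟩
    obtain ⟨Q, hQ, hQT⟩ := exists_isLocAt_le hchart
    refine ⟨hT, Q, ⟨π 0, mem_specModel_iff.2 hQ, ?_⟩, hQT⟩
    rintro _ rfl
    rw [map_prod]
    refine VanishesAt.of_prod_mem (i := π i.succ) (fun e _ => ?_) (Finset.mem_univ _) ?_
    · rw [MvPolynomial.aeval_X]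
      exact hQ.1 (div_mem_chartRing e _)
    · rw [MvPolynomial.aeval_X]
      refine VanishesAt.of_le hQT.1 (hQ.1 (div_mem_chartRing _ _)) ?_
      rw [coordRatio, div_eq_prod_chartCoord π j]
      exact VanishesAt.of_prod_mem (fun l _ => chartCoord_mem hle l)
        (Finset.mem_filter.2 ⟨Finset.mem_univ i, apply_mem_vanishingEdges.2 (Or.inr rfl)⟩) hi

theorem prod_X_dvd {σ : Type*} [Fintype σ] (J : Finset σ) {q : MvPolynomial σ K}
    (h : ∀ i ∈ J, q ∈ coordIdeal K {i}) : ∏ i ∈ J, MvPolynomial.X i ∣ q := by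
  refine Finset.prod_dvd_of_isRelPrime (fun i _ i' _ hii' => ?_) fun i hi => ?_
  · refine (MvPolynomial.X_prime.irreducible.isRelPrime_iff_not_dvd).2 fun hd => hii' ?_
    rwa [MvPolynomial.X_dvd_X] at hd
  · have := h i hi
    rwa [coordIdeal, Set.image_singleton, Ideal.mem_span_singleton] at this

/-- At a point of an adapted chart, the total transform of the simplex is cut out by the product of
those chart coordinates that vanish at the point. -/
theorem isNormalCrossingsDivisor_coordSimplex
    (h𝓢 : IsUpperSet (𝓢 : Set (Finset (Fin (m + 1))))) (huniv : Finset.univ ∈ 𝓢) (hempty : ∅ ∉ 𝓢) :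
    IsNormalCrossingsDivisor (ratioModel K (affineCoord K m) 𝓢)
      (inverseImage (ratioModel K (affineCoord K m) 𝓢) (coordSimplex K m)) := by
  refine ⟨fun T hT => hT.1, fun R hR => ?_⟩
  obtain ⟨π, j, h, hloc⟩ := exists_isAdapted h𝓢 huniv hempty hR
  let J : Finset (Fin m) := Finset.univ.filter fun i => VanishesAt R (chartCoord K π j i)
  obtain ⟨hreg, d, t, hd, ht, J', hJ'⟩ := isRegular_of_isLocAt_adjoin
    (algebraicIndependent_chartCoord (K := K) π j) hloc J fun i hi => (Finset.mem_filter.1 hi).2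
  refine ⟨hreg, d, t, hd, ht, J', le_antisymm (fun f hf => ?_) ?_⟩
  · obtain ⟨x, hx, y, hy, hyR, hfxy⟩ := hloc.2 f f.2
    obtain ⟨q, rfl⟩ := mem_adjoin_range_iff.1 hx
    have hq : ∏ i ∈ J, MvPolynomial.X i ∣ q := by
      refine prod_X_dvd J fun i hi => ?_
      obtain ⟨T, hT, hTJ⟩ := exists_generic_point (K := K) π j {i}
      have hRT := hloc.le_generic_point hT hTJ (by
        rintro _ rfl
        exact (Finset.mem_filter.1 hi).2)
      have hTB := (mem_inverseImage_coordSimplex_iff (h.mem_ratioModel h𝓢 huniv hT) hT.1).2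
        ⟨i, (generic_point_vanishesAt_coord hTJ i).2 rfl⟩
      have hv := (mem_vanishingIdeal.1 hf T hTB hRT).mul_right (hT.1 hy)
      rw [hfxy, inv_mul_cancel_right₀ (ne_zero_of_not_vanishesAt hyR)] at hv
      exact (hTJ q).1 hv
    obtain ⟨r, rfl⟩ := hq
    refine Ideal.mem_span_singleton.2 ⟨⟨MvPolynomial.aeval (chartCoord K π j) r * y⁻¹,
      mul_mem (aeval_mem hloc.1 r) (inv_mem_of_not_vanishesAt (hloc.1 hy) hyR)⟩, Subtype.ext ?_⟩
    rw [Subring.coe_mul, hJ', hfxy, map_mul, map_prod, mul_assoc]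
    simp only [MvPolynomial.aeval_X]
  · rw [Ideal.span_singleton_le_iff_mem, mem_vanishingIdeal]
    intro T hT hRT
    obtain ⟨i, hi⟩ := (mem_inverseImage_coordSimplex_iff hT.1 (hloc.1.trans hRT)).1 hT
    rw [hJ']
    refine VanishesAt.of_prod_mem (fun i _ => hRT (chartCoord_mem hloc.1 i)) (i := i) ?_ hi
    exact Finset.mem_filter.2 ⟨Finset.mem_univ i, hi.of_le hRT (chartCoord_mem hloc.1 i)⟩

/-- A face of the total transform of the simplex contains the origin of some toric chart. -/
theorem exists_origin_mem_face (h𝓢 : IsUpperSet (𝓢 : Set (Finset (Fin (m + 1)))))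
    (huniv : Finset.univ ∈ 𝓢) (hempty : ∅ ∉ 𝓢) {C : Set (LocalSubring (FunctionField K m))}
    (hC : C ∈ faces (ratioModel K (affineCoord K m) 𝓢)
      (inverseImage (ratioModel K (affineCoord K m) 𝓢) (coordSimplex K m))) :
    ∃ π j, IsAdapted 𝓢 π j ∧ ∃ O ∈ C, IsLocAt (toricRing K π j) O ∧
      ∀ q, VanishesAt O (MvPolynomial.aeval (chartCoord K π j) q) ↔
        q ∈ coordIdeal K Set.univ := by
  obtain ⟨⟨R, hR⟩, 𝒞, h𝒞, ⟨C₀, hC₀⟩, rfl⟩ := hC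
  have hRm : R ∈ ratioModel K (affineCoord K m) 𝓢 := by
    obtain ⟨D, -, -, rfl⟩ := h𝒞 hC₀
    exact (hR _ hC₀).1
  obtain ⟨π, j, h, hloc⟩ := exists_isAdapted h𝓢 huniv hempty hRm
  obtain ⟨O, hO, hOJ⟩ := exists_generic_point (K := K) π j Set.univ
  refine ⟨π, j, h, O, fun C' hC' => ?_, hO, hOJ⟩
  have hRC := hR C' hC'
  obtain ⟨D, hD, hmax, rfl⟩ := h𝒞 hC'
  obtain ⟨-, D', rfl, hRD⟩ := hRC
  refine ⟨h.mem_ratioModel h𝓢 huniv hO, D', rfl, ?_⟩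
  have hle := hloc.1.trans hRD
  obtain ⟨i, hi⟩ := (mem_inverseImage_coordSimplex_iff hD.1 hle).1 hD
  obtain ⟨T, hT, hTJ⟩ := exists_generic_point (K := K) π j {i}
  have hDT := (isLocAt_toricRing h𝓢 h hD.1 hle).le_generic_point hT hTJ (by
    rintro _ rfl
    exact hi)
  rw [← hmax T ((mem_inverseImage_coordSimplex_iff (h.mem_ratioModel h𝓢 huniv hT) hT.1).2
    ⟨i, (generic_point_vanishesAt_coord hTJ i).2 rfl⟩) hDT]
  exact hO.le_generic_point hT hTJ fun l _ =>
    (generic_point_vanishesAt_coord hOJ l).2 (Set.mem_univ l)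

end Simplex

/-! ### The graph polynomial -/

section CauchyBinet

/-- A symmetrized form of the Cauchy–Binet formula. -/
theorem factorial_mul_det_sum {ι E R : Type*} [Fintype ι] [DecidableEq ι] [Fintype E] [CommRing R]
    (x : E → R) (v : E → ι → R) :
    ((Fintype.card ι).factorial : R) *
        Matrix.det (Matrix.of fun j k => ∑ e, x e * (v e j * v e k)) =
      ∑ φ : ι → E, (Matrix.of fun j k => v (φ j) k).det ^ 2 * ∏ j, x (φ j) := by
  have h1 : Matrix.det (Matrix.of fun j k => ∑ e, x e * (v e j * v e k)) =
      ∑ φ : ι → E, (∏ j, x (φ j) * v (φ j) j) * (Matrix.of fun j k => v (φ j) k).det := by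
    have hrow : (Matrix.of fun j k => ∑ e, x e * (v e j * v e k)) =
        fun j => ∑ e, (x e * v e j) • v e := by
      ext j k
      simp [mul_assoc]
    have := (Matrix.detRowAlternating (n := ι) (R := R)).toMultilinearMap.map_sum
      (fun j e => (x e * v e j) • v e)
    rw [hrow]
    refine this.trans (Finset.sum_congr rfl fun φ _ => ?_)
    exact (Matrix.detRowAlternating (n := ι) (R := R)).toMultilinearMap.map_smul_univ _ _
  have h2 : ∀ σ : Equiv.Perm ι, Matrix.det (Matrix.of fun j k => ∑ e, x e * (v e j * v e k)) =
      ∑ φ : ι → E, (∏ j, x (φ j)) * (Matrix.of fun j k => v (φ j) k).det *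
        ((Equiv.Perm.sign σ : ℤ) * ∏ j, v (φ (σ j)) j) := by
    intro σ
    rw [h1, ← (Equiv.arrowCongr σ.symm (Equiv.refl E)).sum_comp]
    refine Finset.sum_congr rfl fun φ _ => ?_
    have h3 : (Matrix.of fun j k => v ((Equiv.arrowCongr σ.symm (Equiv.refl E)) φ j) k) =
        (Matrix.of fun j k => v (φ j) k).submatrix σ id := rfl
    rw [h3, Matrix.det_permute, Finset.prod_mul_distrib]
    have h4 : ∏ j, x ((Equiv.arrowCongr σ.symm (Equiv.refl E)) φ j) = ∏ j, x (φ j) :=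
      Equiv.prod_comp σ fun j => x (φ j)
    rw [h4]
    simp only [Equiv.arrowCongr_apply, Equiv.coe_refl, Function.comp_apply, id, Equiv.symm_symm]
    ring
  have h5 : ((Fintype.card ι).factorial : R) *
      Matrix.det (Matrix.of fun j k => ∑ e, x e * (v e j * v e k)) =
      ∑ _σ : Equiv.Perm ι, Matrix.det (Matrix.of fun j k => ∑ e, x e * (v e j * v e k)) := by
    rw [Finset.sum_const, Finset.card_univ, Fintype.card_perm, nsmul_eq_mul]
  rw [h5, Finset.sum_congr rfl fun σ _ => h2 σ, Finset.sum_comm]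
  refine Finset.sum_congr rfl fun φ _ => ?_
  rw [← Finset.mul_sum]
  have h6 : ∑ σ : Equiv.Perm ι, (((Equiv.Perm.sign σ : ℤ) : R) * ∏ j, v (φ (σ j)) j) =
      (Matrix.of fun j k => v (φ j) k).det := by
    rw [Matrix.det_apply']
    rfl
  rw [h6]
  ring

end CauchyBinet

namespace OrientedGraph

variable {V E : Type*} (Γ : OrientedGraph V E)

theorem h1_empty : Γ.h1 ∅ = 0 := by
  rw [h1, Finset.coe_empty, Finsupp.supported_empty, inf_bot_eq, finrank_bot]

section Rank

variable [Finite E]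

theorem finrank_le_of_le {P Q : Submodule ℤ (E →₀ ℤ)} (h : P ≤ Q) :
    Module.finrank ℤ P ≤ Module.finrank ℤ Q :=
  LinearMap.finrank_le_finrank_of_injective (Submodule.inclusion_injective h)

theorem h1_mono {D D' : Finset E} (h : D ⊆ D') : Γ.h1 D ≤ Γ.h1 D' :=
  finrank_le_of_le (inf_le_inf_left _ (Finsupp.supported_mono (Finset.coe_subset.2 h)))

/-- Adding an edge `e` to a graph adds an independent cycle if and only if some cycle passes
through `e`. -/
theorem h1_insert [DecidableEq E] {D : Finset E} {e : E} (he : e ∉ D) :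
    Γ.h1 (insert e D) = Γ.h1 D +
      if ∃ w ∈ Γ.H1, w ∈ Finsupp.supported ℤ ℤ ((insert e D : Finset E) : Set E) ∧ w e ≠ 0
      then 1 else 0 := by
  let P : Submodule ℤ (E →₀ ℤ) := Γ.H1 ⊓ Finsupp.supported ℤ ℤ ((insert e D : Finset E) : Set E)
  let ev : P →ₗ[ℤ] ℤ := (Finsupp.lapply e).comp P.subtype
  have hker : (LinearMap.ker ev).map P.subtype = Γ.H1 ⊓ Finsupp.supported ℤ ℤ (D : Set E) := by
    ext w
    simp only [Submodule.mem_map, LinearMap.mem_ker, Submodule.mem_inf]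
    constructor
    · rintro ⟨⟨w, hw1, hw2⟩, hwe, rfl⟩
      refine ⟨hw1, (Finsupp.mem_supported' _ _).2 fun e' he' => ?_⟩
      by_cases h : e' = e
      · rw [h]
        exact hwe
      · refine (Finsupp.mem_supported' _ _).1 hw2 e' ?_
        rw [Finset.coe_insert]
        exact fun h' => h'.elim h he'
    · rintro ⟨hw1, hw2⟩
      refine ⟨⟨w, hw1, Finsupp.supported_mono
        (Finset.coe_subset.2 (Finset.subset_insert e D)) hw2⟩, ?_, rfl⟩
      exact (Finsupp.mem_supported' _ _).1 hw2 e he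
  have h1 := Submodule.finrank_quotient_add_finrank (LinearMap.ker ev)
  rw [ev.quotKerEquivRange.finrank_eq] at h1
  have h2 : Module.finrank ℤ (LinearMap.ker ev) = Γ.h1 D := by
    rw [OrientedGraph.h1, ← hker]
    exact (Submodule.equivMapOfInjective _ P.subtype_injective _).finrank_eq
  have h3 : Module.finrank ℤ (LinearMap.range ev) = if ∃ w ∈ Γ.H1,
      w ∈ Finsupp.supported ℤ ℤ ((insert e D : Finset E) : Set E) ∧ w e ≠ 0 then 1 else 0 := by
    split_ifs with h
    · obtain ⟨w, hw1, hw2, hwe⟩ := h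
      apply le_antisymm
      · exact (Submodule.finrank_le _).trans (Module.finrank_self ℤ).le
      · have : Nontrivial (LinearMap.range ev) :=
          ⟨⟨⟨w e, ⟨w, hw1, hw2⟩, rfl⟩, 0, fun h => hwe (congrArg Subtype.val h)⟩⟩
        exact Module.finrank_pos
    · push Not at h
      have : LinearMap.range ev = ⊥ := by
        rw [LinearMap.range_eq_bot]
        ext ⟨w, hw1, hw2⟩
        exact h w hw1 hw2
      rw [this, finrank_bot]
  rw [h2, h3] at h1
  rw [add_comm]
  exact h1.symm

/-- The matrix of the coordinates `φ j`, for `j` in the index set of the chosen basis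
of `H₁(Γ, ℤ)`. -/
noncomputable def coordMatrix (φ : Module.Free.ChooseBasisIndex ℤ Γ.H1 → E) :
    Matrix (Module.Free.ChooseBasisIndex ℤ Γ.H1) (Module.Free.ChooseBasisIndex ℤ Γ.H1) ℤ :=
  Matrix.of fun j k => (Module.Free.chooseBasis ℤ Γ.H1 k : E →₀ ℤ) (φ j)

theorem coordMatrix_mulVec (φ : Module.Free.ChooseBasisIndex ℤ Γ.H1 → E) (w : Γ.H1) :
    (Γ.coordMatrix φ).mulVec ((Module.Free.chooseBasis ℤ Γ.H1).repr w) =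
      fun j => (w : E →₀ ℤ) (φ j) := by
  ext j
  nth_rw 2 [← (Module.Free.chooseBasis ℤ Γ.H1).sum_repr w]
  rw [AddSubmonoidClass.coe_finsetSum, Finsupp.finsetSum_apply, Matrix.mulVec, dotProduct]
  refine Finset.sum_congr rfl fun k _ => ?_
  rw [Submodule.coe_smul, Finsupp.smul_apply, smul_eq_mul, mul_comm]
  rfl

/-- A cycle is determined by its coefficients at edges for which the corresponding minor does
not vanish. -/
theorem det_coordMatrix_ne_zero_iff (φ : Module.Free.ChooseBasisIndex ℤ Γ.H1 → E) :
    (Γ.coordMatrix φ).det ≠ 0 ↔ ∀ w ∈ Γ.H1, (∀ j, w (φ j) = 0) → w = 0 := by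
  constructor
  · intro h w hw hw0
    have h1 := Γ.coordMatrix_mulVec φ ⟨w, hw⟩
    have h2 := Matrix.eq_zero_of_mulVec_eq_zero h (h1.trans (funext hw0))
    have h3 : (Module.Free.chooseBasis ℤ Γ.H1).repr ⟨w, hw⟩ = 0 := DFunLike.coe_injective h2
    exact congrArg Subtype.val ((LinearEquiv.map_eq_zero_iff _).1 h3)
  · intro h h0
    obtain ⟨c, hc, hc0⟩ := Matrix.exists_mulVec_eq_zero_iff.2 h0
    refine hc ?_
    let w := (Module.Free.chooseBasis ℤ Γ.H1).equivFun.symm c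
    have hw : ⇑((Module.Free.chooseBasis ℤ Γ.H1).repr w) = c :=
      (Module.Free.chooseBasis ℤ Γ.H1).equivFun.apply_symm_apply c
    have h1 := Γ.coordMatrix_mulVec φ w
    rw [hw, hc0] at h1
    have h2 : w = 0 := Subtype.ext (h w w.2 fun j => (congrFun h1 j).symm)
    rw [← hw, h2, map_zero]
    rfl

/-- Cycles supported on `D` are determined by their coefficients at those chosen edges that lie
in `D`. -/
theorem h1_le_card [DecidableEq E] (D : Finset E)
    {φ : Module.Free.ChooseBasisIndex ℤ Γ.H1 → E}
    (h : (Γ.coordMatrix φ).det ≠ 0) :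
    Γ.h1 D ≤ (Finset.univ.filter fun j => φ j ∈ D).card := by
  let f : ↥(Γ.H1 ⊓ Finsupp.supported ℤ ℤ (D : Set E)) →ₗ[ℤ]
      ((Finset.univ.filter fun j => φ j ∈ D : Finset _) → ℤ) :=
    LinearMap.pi fun j => (Finsupp.lapply (φ j)).comp (Submodule.subtype _)
  have hf : Function.Injective f := by
    rw [← LinearMap.ker_eq_bot, LinearMap.ker_eq_bot']
    rintro ⟨w, hw1, hw2⟩ h0
    refine Subtype.ext ((Γ.det_coordMatrix_ne_zero_iff φ).1 h w hw1 fun j => ?_)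
    by_cases hj : φ j ∈ D
    · exact congrFun h0 ⟨j, Finset.mem_filter.2 ⟨Finset.mem_univ j, hj⟩⟩
    · exact (Finsupp.mem_supported' _ _).1 hw2 _ hj
  have := LinearMap.finrank_le_finrank_of_injective hf
  rwa [Module.finrank_fintype_fun_eq_card, Fintype.card_coe] at this

theorem h1_univ [Fintype E] :
    Γ.h1 Finset.univ = Fintype.card (Module.Free.ChooseBasisIndex ℤ Γ.H1) := by
  rw [h1, Finset.coe_univ, Finsupp.supported_univ, inf_top_eq,
    Module.finrank_eq_card_chooseBasisIndex]

end Rank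

end OrientedGraph

namespace OrientedGraph

section Minors

variable {V : Type*} {m : ℕ} (Γ : OrientedGraph V (Fin (m + 1)))

/-- A basis of the matroid of minors that is adapted to an order of the edges: it is found
greedily, and is made up of those edges `e` for which the rank of the cycles supported on the
edges from `e` on is not that of the cycles supported on later edges. -/
theorem exists_coordMatrix_adapted (π : Equiv.Perm (Fin (m + 1))) :
    ∃ φ : Module.Free.ChooseBasisIndex ℤ Γ.H1 → Fin (m + 1), (Γ.coordMatrix φ).det ≠ 0 ∧
      ∀ i, (Finset.univ.filter fun j => φ j ∈ tail π i).card = Γ.h1 (tail π i) := by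
  let T : ℕ → Finset (Fin (m + 1)) := fun k => Finset.univ.filter fun e => k ≤ (π.symm e : ℕ)
  have hT : ∀ k e, e ∈ T k ↔ k ≤ (π.symm e : ℕ) := fun k e => by simp [T]
  have hstep : ∀ k : Fin (m + 1), T k = insert (π k) (T (k + 1)) ∧ π k ∉ T (k + 1) := by
    refine fun k => ⟨?_, by simp [hT]⟩
    ext e
    obtain ⟨l, rfl⟩ := π.surjective e
    simp only [hT, Finset.mem_insert, Equiv.symm_apply_apply, EmbeddingLike.apply_eq_iff_eq,
      Fin.ext_iff]
    omega
  let I : Finset (Fin (m + 1)) :=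
    Finset.univ.filter fun e => Γ.h1 (T (π.symm e)) ≠ Γ.h1 (T (π.symm e + 1))
  have hcard : ∀ t k, t + k = m + 1 → (I.filter fun e => e ∈ T k).card = Γ.h1 (T k) := by
    intro t
    induction t with
    | zero =>
      rintro k hk
      have : T k = ∅ := by
        ext e
        have := (π.symm e).2
        simp only [hT, Finset.notMem_empty, iff_false]
        omega
      simp [this, h1_empty]
    | succ t ih =>
      intro k hk
      have ih := ih (k + 1) (by omega)
      obtain ⟨h1, h2⟩ := hstep ⟨k, by omega⟩
      dsimp only at h1 h2
      have h3 := Γ.h1_insert h2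
      rw [← h1] at h3
      have h4 : (I.filter fun e => e ∈ T k) = if π ⟨k, by omega⟩ ∈ I then
          insert (π ⟨k, by omega⟩) (I.filter fun e => e ∈ T (k + 1)) else
          I.filter fun e => e ∈ T (k + 1) := by
        split_ifs with h
        · ext e
          simp only [h1, Finset.mem_filter, Finset.mem_insert]
          constructor
          · rintro ⟨h5, h6 | h6⟩
            exacts [Or.inl h6, Or.inr ⟨h5, h6⟩]
          · rintro (h6 | h6)
            exacts [⟨h6 ▸ h, Or.inl h6⟩, ⟨h6.1, Or.inr h6.2⟩]
        · ext e
          simp only [h1, Finset.mem_filter, Finset.mem_insert]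
          constructor
          · rintro ⟨h5, h6 | h6⟩
            exacts [absurd (h6 ▸ h5) h, ⟨h5, h6⟩]
          · rintro h6
            exact ⟨h6.1, Or.inr h6.2⟩
      have h5 : π ⟨k, by omega⟩ ∈ I ↔ Γ.h1 (T k) ≠ Γ.h1 (T (k + 1)) := by simp [I]
      rw [h4]
      by_cases h6 : ∃ w ∈ Γ.H1, w ∈ Finsupp.supported ℤ ℤ (T k : Set (Fin (m + 1))) ∧
          w (π ⟨k, by omega⟩) ≠ 0
      · rw [if_pos h6] at h3
        rw [if_pos (h5.2 (by omega)), Finset.card_insert_of_notMem (by simp [h2]), ih, h3]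
      · rw [if_neg h6, add_zero] at h3
        rw [if_neg fun h => h5.1 h h3, ih, h3]
  have hT0 : T 0 = Finset.univ := by
    ext e
    simp [hT]
  have hcardI : Fintype.card I = Fintype.card (Module.Free.ChooseBasisIndex ℤ Γ.H1) := by
    have := hcard (m + 1) 0 rfl
    rw [hT0, h1_univ] at this
    simpa using this
  let φ := Fintype.equivOfCardEq hcardI
  refine ⟨fun j => φ.symm j, ?_, fun i => ?_⟩
  · rw [det_coordMatrix_ne_zero_iff]
    intro w hw hw0
    by_contra hne
    obtain ⟨e, he⟩ := Finsupp.ne_iff.1 hne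
    obtain ⟨e, he, hmin⟩ := w.support.exists_min_image π.symm ⟨e, Finsupp.mem_support_iff.2 he⟩
    obtain ⟨k, rfl⟩ := π.surjective e
    rw [Finsupp.mem_support_iff] at he
    obtain ⟨h1, h2⟩ := hstep k
    have h3 := Γ.h1_insert h2
    rw [if_pos, ← h1] at h3
    · have hI : π k ∈ I := by
        refine Finset.mem_filter.2 ⟨Finset.mem_univ _, ?_⟩
        rw [Equiv.symm_apply_apply]
        omega
      refine he ?_
      have := hw0 (φ ⟨π k, hI⟩)
      rwa [Equiv.symm_apply_apply] at this
    · refine ⟨w, hw, (Finsupp.mem_supported' _ _).2 fun e' he' => ?_, he⟩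
      by_contra hne'
      have h5 := hmin e' (Finsupp.mem_support_iff.2 hne')
      rw [Equiv.symm_apply_apply] at h5
      rw [Finset.mem_coe, ← h1, hT] at he'
      exact he' h5
  · have htail : tail π i = T (i + 1) := by
      ext e
      rw [mem_tail, hT, Fin.lt_def, Nat.succ_le_iff]
    rw [htail, ← hcard (m - i) (i + 1) (by omega)]
    refine Finset.card_bij (fun j _ => φ.symm j) (fun j hj => ?_) (fun j _ j' _ h => ?_)
      (fun e he => ?_)
    · exact Finset.mem_filter.2 ⟨(φ.symm j).2, (Finset.mem_filter.1 hj).2⟩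
    · exact φ.symm.injective (Subtype.ext h)
    · refine ⟨φ ⟨e, (Finset.mem_filter.1 he).1⟩, ?_, ?_⟩
      · simpa using (Finset.mem_filter.1 he).2
      · rw [Equiv.symm_apply_apply]

variable {K : Type*} [Field K]

/-- The graph polynomial as a sum of monomials with non-negative coefficients; the factorial counts
the orders of the `h₁` edges of a minor. -/
theorem factorial_mul_aeval_graphPolynomial {A : Type*} [CommRing A] [Algebra K A]
    (b : Fin (m + 1) → A) :
    ((Γ.h1 Finset.univ).factorial : A) * MvPolynomial.aeval b (Γ.graphPolynomial K) =
      ∑ φ : Module.Free.ChooseBasisIndex ℤ Γ.H1 → Fin (m + 1),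
        (((Γ.coordMatrix φ).det ^ 2 : ℤ) : A) * ∏ j, b (φ j) := by
  have h1 : MvPolynomial.aeval b (Γ.graphPolynomial K) = Matrix.det (Matrix.of
      fun j k => ∑ e, b e * ((((Module.Free.chooseBasis ℤ Γ.H1 j : Fin (m + 1) →₀ ℤ) e : ℤ) : A) *
        (((Module.Free.chooseBasis ℤ Γ.H1 k : Fin (m + 1) →₀ ℤ) e : ℤ) : A))) := by
    rw [graphPolynomial, AlgHom.map_det]
    congr 1
    ext j k
    simp [AlgHom.mapMatrix_apply, Matrix.map_apply]
  rw [h1, h1_univ, factorial_mul_det_sum b fun e j =>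
    (((Module.Free.chooseBasis ℤ Γ.H1 j : Fin (m + 1) →₀ ℤ) e : ℤ) : A)]
  refine Finset.sum_congr rfl fun φ _ => ?_
  congr 1
  rw [Int.cast_pow, Int.cast_det]
  rfl

/-- The graph polynomial is homogeneous. -/
theorem aeval_smul_graphPolynomial {A : Type*} [Field A] [CharZero A] [Algebra K A]
    (b : Fin (m + 1) → A) (c : A) :
    MvPolynomial.aeval (fun e => b e * c) (Γ.graphPolynomial K) =
      MvPolynomial.aeval b (Γ.graphPolynomial K) * c ^ Γ.h1 Finset.univ := by
  refine mul_left_cancel₀ (Nat.cast_ne_zero.2 (Nat.factorial_ne_zero (Γ.h1 Finset.univ))) ?_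
  rw [← mul_assoc, factorial_mul_aeval_graphPolynomial, factorial_mul_aeval_graphPolynomial,
    Finset.sum_mul]
  refine Finset.sum_congr rfl fun φ _ => ?_
  rw [Finset.prod_mul_distrib, Finset.prod_const, Finset.card_univ, ← h1_univ, mul_assoc]

/-- In the coordinates of an adapted toric chart, the graph polynomial is the product of a monomial
and a polynomial with non-negative coefficients and a positive constant term. -/
theorem exists_strict_equation {𝓢 : Finset (Finset (Fin (m + 1)))}
    (h𝓢 : ∀ S, S ∈ 𝓢 ↔ 0 < Γ.h1 S) {π : Equiv.Perm (Fin (m + 1))} {j : Fin (m + 1)}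
    (h : IsAdapted 𝓢 π j) :
    ∃ f : MvPolynomial (Fin m) ℤ, (∀ s, 0 ≤ f.coeff s) ∧ 0 < f.coeff 0 ∧
      ((Γ.h1 Finset.univ).factorial : FunctionField K m) * MvPolynomial.aeval
        (fun e => affineCoord K m e / affineCoord K m (π 0)) (Γ.graphPolynomial K) =
      (∏ i, chartCoord K π j i ^ Γ.h1 (vanishingEdges π j i)) *
        MvPolynomial.aeval (chartCoord K π j) f := by
  let N : (Module.Free.ChooseBasisIndex ℤ Γ.H1 → Fin (m + 1)) → Fin m → ℕ := fun φ i =>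
    (Finset.univ.filter fun l => φ l ∈ vanishingEdges π j i).card
  let s : (Module.Free.ChooseBasisIndex ℤ Γ.H1 → Fin (m + 1)) → Fin m →₀ ℕ := fun φ =>
    Finsupp.equivFunOnFinite.symm fun i => N φ i - Γ.h1 (vanishingEdges π j i)
  let f : MvPolynomial (Fin m) ℤ :=
    ∑ φ, MvPolynomial.monomial (s φ) ((Γ.coordMatrix φ).det ^ 2)
  have hcoeff : ∀ t, f.coeff t = ∑ φ, if s φ = t then (Γ.coordMatrix φ).det ^ 2 else 0 := by
    intro t
    simp [f, MvPolynomial.coeff_sum, MvPolynomial.coeff_monomial]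
  have hnonneg : ∀ t φ, 0 ≤ if s φ = t then (Γ.coordMatrix φ).det ^ 2 else 0 := fun t φ => by
    split_ifs
    exacts [sq_nonneg _, le_rfl]
  refine ⟨f, fun t => ?_, ?_, ?_⟩
  · rw [hcoeff]
    exact Finset.sum_nonneg fun φ _ => hnonneg t φ
  · rw [hcoeff]
    obtain ⟨φ, hφ, htail⟩ := Γ.exists_coordMatrix_adapted π
    refine Finset.sum_pos' (fun φ _ => hnonneg 0 φ) ⟨φ, Finset.mem_univ φ, ?_⟩
    rw [if_pos]
    · positivity
    ext i
    change N φ i - Γ.h1 (vanishingEdges π j i) = 0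
    refine Nat.sub_eq_zero_of_le ?_
    by_cases hi : i.castSucc < j
    · have : vanishingEdges π j i = tail π i.castSucc := if_pos hi
      rw [this, ← htail]
      exact (congrArg (fun D => (Finset.univ.filter fun l => φ l ∈ D).card) this).le
    · -- the last part of the order supports no cycle, so the basis does not meet it
      have h0 : Γ.h1 (tail π j) = 0 := by
        by_contra hne
        exact h.tail_notMem ((h𝓢 _).2 (Nat.pos_of_ne_zero hne))
      have h2 : N φ i ≤ (Finset.univ.filter fun l => φ l ∈ tail π j).card := by
        refine Finset.card_le_card fun l hl => ?_
        have := (Finset.mem_filter.1 hl).2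
        rw [vanishingEdges, if_neg hi, Finset.mem_singleton] at this
        refine Finset.mem_filter.2 ⟨Finset.mem_univ l, ?_⟩
        rw [this]
        exact apply_mem_tail.2 ((not_lt.1 hi).trans_lt Fin.castSucc_lt_succ)
      rw [htail, h0] at h2
      exact h2.trans (Nat.zero_le _)
  · rw [factorial_mul_aeval_graphPolynomial, map_sum, Finset.mul_sum]
    refine Finset.sum_congr rfl fun φ _ => ?_
    by_cases hφ : (Γ.coordMatrix φ).det = 0
    · simp [hφ]
    have h1 : ∏ l, affineCoord K m (φ l) / affineCoord K m (π 0) =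
        ∏ i, chartCoord K π j i ^ N φ i := by
      simp_rw [div_eq_prod_chartCoord π j, Finset.prod_filter]
      rw [Finset.prod_comm]
      refine Finset.prod_congr rfl fun i _ => ?_
      rw [← Finset.prod_filter, Finset.prod_const]
    rw [h1, MvPolynomial.aeval_monomial, Finsupp.prod_fintype _ _ fun i => pow_zero _,
      mul_left_comm, ← Finset.prod_mul_distrib]
    congr 1
    · simp
    · refine Finset.prod_congr rfl fun i _ => ?_
      rw [← pow_add]
      congr 1
      exact (Nat.add_sub_cancel' (Γ.h1_le_card (vanishingEdges π j i) hφ)).symm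

end Minors

end OrientedGraph

/-! ### The graph hypersurface and its strict transform -/

section Hypersurface

variable {K : Type*} [Field K] {m : ℕ} {V : Type*} {Γ : OrientedGraph V (Fin (m + 1))}
  {𝓢 : Finset (Finset (Fin (m + 1)))} {π : Equiv.Perm (Fin (m + 1))} {j : Fin (m + 1)}

theorem charZero_functionField [CharZero K] : CharZero (FunctionField K m) :=
  charZero_of_injective_algebraMap (algebraMap K (FunctionField K m)).injective

theorem aeval_int_eq (z : Fin m → FunctionField K m) (f : MvPolynomial (Fin m) ℤ) :
    MvPolynomial.aeval z f =
      MvPolynomial.aeval z (MvPolynomial.map (algebraMap ℤ K) f) :=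
  (MvPolynomial.aeval_map_algebraMap K z f).symm

theorem aeval_int_mem {T : Subring (FunctionField K m)} {z : Fin m → FunctionField K m}
    (hz : ∀ i, z i ∈ T) (f : MvPolynomial (Fin m) ℤ) : MvPolynomial.aeval z f ∈ T := by
  induction f using MvPolynomial.induction_on with
  | C r =>
    rw [MvPolynomial.aeval_C, eq_intCast]
    exact intCast_mem T r
  | add p q hp hq =>
    rw [map_add]
    exact add_mem hp hq
  | mul_X p i hp =>
    rw [map_mul, MvPolynomial.aeval_X]
    exact mul_mem hp (hz i)

/-- A coordinate of an adapted chart that is not exceptional does not divide the graph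
polynomial. -/
theorem h1_vanishingEdges_eq_zero (h𝓢 : ∀ S, S ∈ 𝓢 ↔ 0 < Γ.h1 S) (h : IsAdapted 𝓢 π j) {i : Fin m}
    (hi : j ≤ i.castSucc) : Γ.h1 (vanishingEdges π j i) = 0 := by
  have h0 : Γ.h1 (tail π j) = 0 := by
    by_contra hne
    exact h.tail_notMem ((h𝓢 _).2 (Nat.pos_of_ne_zero hne))
  refine Nat.le_zero.1 (h0 ▸ Γ.h1_mono ?_)
  rw [vanishingEdges, if_neg hi.not_gt, Finset.singleton_subset_iff]
  exact apply_mem_tail.2 (hi.trans_lt Fin.castSucc_lt_succ)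

/-- Outside the exceptional divisors, the first `j` coordinates of an adapted chart are
invertible. -/
theorem IsAdapted.not_vanishesAt_chartCoord (h : IsAdapted 𝓢 π j)
    {T : LocalSubring (FunctionField K m)} (hT : T ∈ outside K m 𝓢)
    (hle : toricRing K π j ≤ T.toSubring) {i : Fin m} (hi : i.castSucc < j) :
    ¬ VanishesAt T (chartCoord K π j i) := by
  intro hv
  refine h.not_vanishesAt hT hle (i := i.succ) (Fin.castSucc_lt_iff_succ_le.1 hi) ?_
  rw [← div_mul_div_cancel₀ (affineCoord_ne_zero (π (min i.castSucc j)))]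
  exact hv.mul_right (hle (chartRing_le_toricRing π j (div_mem_chartRing _ _)))

/-- On an adapted chart, the strict transform of the graph hypersurface is contained in the zero
locus of the graph polynomial divided by its monomial factor. -/
theorem vanishesAt_of_mem_strict_graphHypersurface [CharZero K]
    (h𝓢 : ∀ S, S ∈ 𝓢 ↔ 0 < Γ.h1 S)
    (h : IsAdapted 𝓢 π j) {f : MvPolynomial (Fin m) ℤ}
    (hf : ((Γ.h1 Finset.univ).factorial : FunctionField K m) * MvPolynomial.aeval
        (fun e => affineCoord K m e / affineCoord K m (π 0)) (Γ.graphPolynomial K) =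
      (∏ i, chartCoord K π j i ^ Γ.h1 (vanishingEdges π j i)) *
        MvPolynomial.aeval (chartCoord K π j) f)
    {T : LocalSubring (FunctionField K m)} (hle : toricRing K π j ≤ T.toSubring)
    (hT : T ∈ closureIn (ratioModel K (affineCoord K m) 𝓢)
      (graphHypersurface K Γ ∩ outside K m 𝓢)) :
    VanishesAt T (MvPolynomial.aeval (chartCoord K π j) f) := by
  have := charZero_functionField (K := K) (m := m)
  obtain ⟨-, T', ⟨⟨j', hj', hv⟩, hT'⟩, hTT'⟩ := hT
  rw [mem_specModel_iff] at hj'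
  have hle' := hle.trans hTT'
  have hmem : affineCoord K m j' / affineCoord K m (π 0) ∈ T'.toSubring :=
    hle' (chartRing_le_toricRing π j (div_mem_chartRing _ _))
  have h1 : VanishesAt T' (MvPolynomial.aeval
      (fun e => affineCoord K m e / affineCoord K m (π 0)) (Γ.graphPolynomial K)) := by
    have h2 : (fun e => affineCoord K m e / affineCoord K m (π 0)) = fun e =>
        coordRatio K m e j' * (affineCoord K m j' / affineCoord K m (π 0)) := by
      ext e
      exact (div_mul_div_cancel₀ (affineCoord_ne_zero j')).symm
    rw [h2, Γ.aeval_smul_graphPolynomial]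
    exact (hv _ rfl).mul_right (pow_mem hmem _)
  have h3 := h1.mul_left (natCast_mem T'.toSubring (Γ.h1 Finset.univ).factorial)
  have hfmem := aeval_int_mem (chartCoord_mem (K := K) (π := π) (j := j) hle) f
  rw [hf] at h3
  refine ((h3.or_of_mul (prod_mem fun i _ => pow_mem (chartCoord_mem hle' i) _)
    (hTT' hfmem)).resolve_left fun hprod => ?_).of_le hTT' hfmem
  obtain ⟨i, -, hi⟩ := hprod.exists_of_prod _ _ fun i _ => pow_mem (chartCoord_mem hle' i) _
  rcases lt_or_ge i.castSucc j with hij | hij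
  · exact h.not_vanishesAt_chartCoord hT' hle' hij (hi.of_pow (chartCoord_mem hle' i))
  · rw [h1_vanishingEdges_eq_zero h𝓢 h hij, pow_zero] at hi
    exact not_vanishesAt_one T' hi

/-- The generic points of linear coordinate subspaces of a chart are not zeros of a polynomial with
non-zero constant term. -/
theorem not_vanishesAt_aeval_of_coeff_zero [CharZero K] {f : MvPolynomial (Fin m) ℤ}
    (hf : 0 < f.coeff 0) {J : Set (Fin m)} {T : LocalSubring (FunctionField K m)}
    (hT : ∀ q, VanishesAt T (MvPolynomial.aeval (chartCoord K π j) q) ↔ q ∈ coordIdeal K J) :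
    ¬ VanishesAt T (MvPolynomial.aeval (chartCoord K π j) f) := by
  intro hv
  rw [aeval_int_eq, hT] at hv
  have := coeff_zero_eq_zero_of_mem_coordIdeal hv
  rw [MvPolynomial.coeff_map, eq_intCast, Int.cast_eq_zero] at this
  exact hf.ne' this

theorem coordSubspace_subset_graphHypersurface [CharZero K] {S : Finset (Fin (m + 1))}
    (hS : 0 < Γ.h1 S) : coordSubspace K m S ⊆ graphHypersurface K Γ := by
  intro T hT
  have := charZero_functionField (K := K) (m := m)
  obtain ⟨j, hj, hv⟩ := mem_coordSubspace_iff.1 hT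
  refine ⟨j, mem_specModel_iff.2 hj, ?_⟩
  rintro _ rfl
  have h1 : VanishesAt T (((Γ.h1 Finset.univ).factorial : FunctionField K m) *
      MvPolynomial.aeval (fun i => coordRatio K m i j) (Γ.graphPolynomial K)) := by
    rw [Γ.factorial_mul_aeval_graphPolynomial]
    refine VanishesAt.sum _ _ fun φ _ => ?_
    by_cases hφ : (Γ.coordMatrix φ).det = 0
    · rw [hφ, zero_pow two_ne_zero, Int.cast_zero, zero_mul]
      exact vanishesAt_zero T
    · refine VanishesAt.mul_left (intCast_mem _ _) ?_
      obtain ⟨l, hl⟩ := Finset.card_pos.1 (hS.trans_le (Γ.h1_le_card S hφ))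
      exact VanishesAt.of_prod_mem (fun l _ => hj.1 (div_mem_chartRing _ _)) (Finset.mem_univ l)
        (hv _ (Finset.mem_filter.1 hl).2)
  have h2 := h1.mul_left (hj.1 (algebraMap_mem_chartRing j
    (((Γ.h1 Finset.univ).factorial : K)⁻¹)))
  rwa [map_inv₀, map_natCast, inv_mul_cancel_left₀
    (Nat.cast_ne_zero.2 (Nat.factorial_ne_zero _))] at h2

theorem coordSubspace_nonempty {S : Finset (Fin (m + 1))} (hS : S ≠ Finset.univ) :
    (coordSubspace K m S).Nonempty := by
  obtain ⟨e, he⟩ : ∃ e, e ∉ S := by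
    by_contra! h
    exact hS (Finset.eq_univ_iff_forall.2 h)
  let π : Equiv.Perm (Fin (m + 1)) := Equiv.swap 0 e
  have hπ : π 0 = e := Equiv.swap_apply_left 0 e
  obtain ⟨T, hT, hTJ⟩ := exists_generic_point (K := K) π 0 Set.univ
  have hadapted : IsAdapted {Finset.univ} π 0 := by
    refine ⟨fun i hi => absurd hi (Fin.not_lt_zero i), fun h => ?_⟩
    have := Finset.eq_univ_iff_forall.1 (Finset.mem_singleton.1 h) (π 0)
    exact absurd (apply_mem_tail.1 this) (lt_irrefl _)
  have hupper : IsUpperSet (({Finset.univ} : Finset (Finset (Fin (m + 1)))) :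
      Set (Finset (Fin (m + 1)))) := by
    intro A B hAB hA
    rw [Finset.mem_coe, Finset.mem_singleton] at hA ⊢
    exact Finset.univ_subset_iff.1 (hA ▸ hAB)
  have hP : T ∈ projectiveSpace K m := (hadapted.mem_outside hupper hT fun i hi => by
    rw [Fin.le_zero_iff.1 hi, div_self (affineCoord_ne_zero _)]
    exact not_vanishesAt_one T).1
  refine ⟨T, mem_coordSubspace_of_vanishesAt hP (j := π 0) fun e' he' => ?_⟩
  obtain ⟨l, rfl⟩ := π.surjective e'
  obtain ⟨i, rfl⟩ := Fin.exists_succ_eq.2 (show l ≠ 0 by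
    rintro rfl
    exact he (hπ ▸ he'))
  have := (generic_point_vanishesAt_coord hTJ i).2 (Set.mem_univ i)
  rwa [chartCoord, min_eq_right (Fin.zero_le _)] at this

end Hypersurface

/-! ### The differential form -/

section Form

theorem derivation_prod {K F ι : Type*} [Field K] [Field F] [Algebra K F] (s : Finset ι) (z : ι → F)
    (hz : ∀ i, z i ≠ 0) : KaehlerDifferential.D K F (∏ i ∈ s, z i) =
      ∑ i ∈ s, ((∏ l ∈ s, z l) * (z i)⁻¹) • KaehlerDifferential.D K F (z i) := by
  induction s using Finset.induction_on with
  | empty => simp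
  | insert i s hi ih =>
    rw [Finset.prod_insert hi, Derivation.leibniz, ih, Finset.sum_insert hi, add_comm,
      Finset.smul_sum]
    congr 1
    · rw [mul_right_comm, mul_inv_cancel₀ (hz i), one_mul]
    · exact Finset.sum_congr rfl fun l _ => by rw [smul_smul, mul_assoc]

variable {K : Type*} [Field K] {m : ℕ} {V : Type*} {Γ : OrientedGraph V (Fin (m + 1))}
  {𝓢 : Finset (Finset (Fin (m + 1)))} {π : Equiv.Perm (Fin (m + 1))} {j : Fin (m + 1)}

theorem chartCoord_ne_zero (i : Fin m) : chartCoord K π j i ≠ 0 :=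
  div_ne_zero (affineCoord_ne_zero _) (affineCoord_ne_zero _)

/-- The coordinates are monomials in those of a toric chart, so their logarithmic differentials are
integral combinations of the logarithmic differentials of the latter. -/
theorem exists_D_affineCoord_eq (π : Equiv.Perm (Fin (m + 1))) (j e : Fin (m + 1)) :
    ∃ M : Fin m → ℤ, KaehlerDifferential.D K (FunctionField K m) (affineCoord K m e) =
      ∑ k, (affineCoord K m e * M k * (chartCoord K π j k)⁻¹) •
        KaehlerDifferential.D K (FunctionField K m) (chartCoord K π j k) := by
  set a := affineCoord K m
  set z := chartCoord K π j
  have hb : ∀ e, KaehlerDifferential.D K (FunctionField K m) (a e / a (π 0)) =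
      ∑ k, (a e / a (π 0) * ((if e ∈ vanishingEdges π j k then 1 else 0 : ℤ) :
        FunctionField K m) * (z k)⁻¹) • KaehlerDifferential.D K (FunctionField K m) (z k) := by
    intro e
    rw [div_eq_prod_chartCoord π j e, derivation_prod _ _ chartCoord_ne_zero, Finset.sum_filter]
    refine Finset.sum_congr rfl fun k _ => ?_
    split_ifs
    · rw [Int.cast_one, mul_one]
    · rw [Int.cast_zero, mul_zero, zero_mul, zero_smul]
  refine ⟨fun k => (if e ∈ vanishingEdges π j k then 1 else 0) -
    (if Fin.last m ∈ vanishingEdges π j k then 1 else 0), ?_⟩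
  have hl : a (Fin.last m) = 1 := by simp [a, affineCoord]
  have hne : a (Fin.last m) / a (π 0) ≠ 0 :=
    div_ne_zero (affineCoord_ne_zero _) (affineCoord_ne_zero _)
  have h1 : a e / a (π 0) = a e * (a (Fin.last m) / a (π 0)) := by
    rw [hl]
    ring
  have h2 := Derivation.leibniz (KaehlerDifferential.D K (FunctionField K m)) (a e)
    (a (Fin.last m) / a (π 0))
  rw [← h1, hb, hb] at h2
  have h3 := congrArg (fun w => (a (Fin.last m) / a (π 0))⁻¹ • w) (eq_sub_of_add_eq' h2.symm)
  rw [smul_smul, inv_mul_cancel₀ hne, one_smul, Finset.smul_sum, ← Finset.sum_sub_distrib,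
    Finset.smul_sum] at h3
  rw [h3]
  refine Finset.sum_congr rfl fun k _ => ?_
  rw [smul_smul, ← sub_smul, smul_smul]
  congr 1
  have hl0 : a (Fin.last m) ≠ 0 := affineCoord_ne_zero _
  have h00 : a (π 0) ≠ 0 := affineCoord_ne_zero _
  rw [Int.cast_sub, h1]
  field_simp

/-- The form `d a_0 ∧ ⋯ ∧ d a_{m-1}` is an integral multiple of `(∏ a_i / ∏ z_k)` times
`d z_0 ∧ ⋯ ∧ d z_{m-1}`, so it becomes regular after multiplication by a function that cancels the
poles of that factor. -/
theorem isRegularFormAt_smul {T : LocalSubring (FunctionField K m)}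
    (hz : ∀ i, chartCoord K π j i ∈ T.toSubring) {c : FunctionField K m}
    (hc : c * ((∏ i : Fin m, affineCoord K m i.castSucc) * (∏ k, chartCoord K π j k)⁻¹) ∈
      T.toSubring) :
    IsRegularFormAt K (c • exteriorPower.ιMulti (FunctionField K m) m fun i : Fin m =>
      KaehlerDifferential.D K (FunctionField K m) (affineCoord K m i.castSucc)) T := by
  choose M hM using fun i : Fin m => exists_D_affineCoord_eq (K := K) π j i.castSucc
  have h1 := (exteriorPower.ιMulti (FunctionField K m) (M := Ω[FunctionField K m⁄K])
    m).toMultilinearMap.map_sum fun (i k : Fin m) =>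
      (affineCoord K m i.castSucc * M i k * (chartCoord K π j k)⁻¹) •
        KaehlerDifferential.D K (FunctionField K m) (chartCoord K π j k)
  have h2 : (exteriorPower.ιMulti (FunctionField K m) m fun i : Fin m =>
      KaehlerDifferential.D K (FunctionField K m) (affineCoord K m i.castSucc)) = _ :=
    (congrArg (exteriorPower.ιMulti (FunctionField K m) m) (funext hM)).trans h1
  rw [h2, IsRegularFormAt, Finset.smul_sum]
  refine Submodule.sum_mem _ fun r _ => ?_
  have h3 := (exteriorPower.ιMulti (FunctionField K m) (M := Ω[FunctionField K m⁄K])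
    m).toMultilinearMap.map_smul_univ (fun i : Fin m =>
      affineCoord K m i.castSucc * M i (r i) * (chartCoord K π j (r i))⁻¹) fun i =>
        KaehlerDifferential.D K (FunctionField K m) (chartCoord K π j (r i))
  rw [h3, smul_smul]
  by_cases hr : Function.Injective r
  · have hprod : ∏ i, (chartCoord K π j (r i))⁻¹ = (∏ k, chartCoord K π j k)⁻¹ := by
      rw [← Finset.prod_inv_distrib]
      exact (Equiv.ofBijective r (Finite.injective_iff_bijective.1 hr)).prod_comp
        fun k => (chartCoord K π j k)⁻¹
    have hcoef : c * ∏ i : Fin m, (affineCoord K m i.castSucc * M i (r i) *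
        (chartCoord K π j (r i))⁻¹) ∈ T.toSubring := by
      rw [Finset.prod_mul_distrib, Finset.prod_mul_distrib, hprod]
      have : c * ((∏ i : Fin m, affineCoord K m i.castSucc) * (∏ i : Fin m,
          ((M i (r i) : ℤ) : FunctionField K m)) * (∏ k, chartCoord K π j k)⁻¹) =
          c * ((∏ i : Fin m, affineCoord K m i.castSucc) * (∏ k, chartCoord K π j k)⁻¹) *
            ∏ i : Fin m, ((M i (r i) : ℤ) : FunctionField K m) := by ring
      rw [this]
      exact mul_mem hc (prod_mem fun i _ => intCast_mem _ _)
    exact Submodule.smul_mem _ (⟨_, hcoef⟩ : T.toSubring)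
      (Submodule.subset_span ⟨fun i => chartCoord K π j (r i), fun i => hz _, rfl⟩)
  · have h4 : (exteriorPower.ιMulti (FunctionField K m) (M := Ω[FunctionField K m⁄K]) m)
        (fun i => KaehlerDifferential.D K (FunctionField K m) (chartCoord K π j (r i))) = 0 := by
      obtain ⟨i, i', h, hne⟩ := Function.not_injective_iff.1 hr
      exact AlternatingMap.map_eq_zero_of_eq _ _ (by rw [h]) hne
    have h5 : (exteriorPower.ιMulti (FunctionField K m) (M := Ω[FunctionField K m⁄K])
        m).toMultilinearMap (fun i => KaehlerDifferential.D K (FunctionField K m)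
          (chartCoord K π j (r i))) = 0 := h4
    rw [h5, smul_zero]
    exact Submodule.zero_mem _

/-- The order of the form along a coordinate divisor of a toric chart is non-negative because
the corresponding subgraph is convergent. -/
theorem isRegularFormAt_graphForm [CharZero K] {n : ℕ} (hΓ : Γ.IsPrimitiveLogDivergent n)
    {f : MvPolynomial (Fin m) ℤ}
    (hf : ((Γ.h1 Finset.univ).factorial : FunctionField K m) * MvPolynomial.aeval
        (fun e => affineCoord K m e / affineCoord K m (π 0)) (Γ.graphPolynomial K) =
      (∏ i, chartCoord K π j i ^ Γ.h1 (vanishingEdges π j i)) *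
        MvPolynomial.aeval (chartCoord K π j) f)
    {T : LocalSubring (FunctionField K m)} (hle : toricRing K π j ≤ T.toSubring)
    (hv : ¬ VanishesAt T (MvPolynomial.aeval (chartCoord K π j) f)) :
    IsRegularFormAt K (graphForm K Γ) T := by
  have := charZero_functionField (K := K) (m := m)
  have hz := chartCoord_mem (K := K) (π := π) (j := j) hle
  refine isRegularFormAt_smul hz ?_
  set a := affineCoord K m with ha
  set z := chartCoord K π j with hzdef
  set N : FunctionField K m := ((Γ.h1 Finset.univ).factorial : FunctionField K m) with hN
  have hN0 : N ≠ 0 := Nat.cast_ne_zero.2 (Nat.factorial_ne_zero _)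
  set g := MvPolynomial.aeval z f with hg
  have hg0 : g ≠ 0 := ne_zero_of_not_vanishesAt hv
  have hgi : g⁻¹ ∈ T.toSubring := inv_mem_of_not_vanishesAt (aeval_int_mem hz f) hv
  have hz0 : ∀ i, z i ≠ 0 := fun i => chartCoord_ne_zero i
  have ha0 : a (π 0) ≠ 0 := affineCoord_ne_zero _
  have hcard : m + 1 = 2 * Γ.h1 Finset.univ := by
    have := hΓ.edges
    rw [Fintype.card_fin] at this
    rw [hΓ.loops]
    exact this
  -- homogeneity
  have hΨ : MvPolynomial.aeval a (Γ.graphPolynomial K) = MvPolynomial.aeval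
      (fun e => a e / a (π 0)) (Γ.graphPolynomial K) * a (π 0) ^ Γ.h1 Finset.univ := by
    rw [← Γ.aeval_smul_graphPolynomial]
    congr 2
    ext e
    rw [div_mul_cancel₀ _ ha0]
  have hprod : ∏ i : Fin m, a i.castSucc = (∏ e, a e / a (π 0)) *
      (a (π 0) ^ Γ.h1 Finset.univ) ^ 2 := by
    rw [← pow_mul, mul_comm (Γ.h1 Finset.univ), ← hcard, Finset.prod_div_distrib,
      Finset.prod_const, Finset.card_univ, Fintype.card_fin,
      div_mul_cancel₀ _ (pow_ne_zero _ ha0), Fin.prod_univ_castSucc]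
    have hl : a (Fin.last m) = 1 := by simp [a, affineCoord]
    rw [hl, mul_one]
  -- the order of the numerator along the coordinate divisors
  have hb : ∏ e, a e / a (π 0) = ∏ i, z i ^ (vanishingEdges π j i).card := by
    simp_rw [ha, div_eq_prod_chartCoord π j, Finset.prod_filter]
    rw [Finset.prod_comm]
    refine Finset.prod_congr rfl fun i _ => ?_
    rw [← Finset.prod_filter, Finset.prod_const, Finset.filter_univ_mem]
  have hconv : ∀ i, 2 * Γ.h1 (vanishingEdges π j i) + 1 ≤ (vanishingEdges π j i).card :=
    fun i => hΓ.convergent _ ⟨π i.succ, apply_mem_vanishingEdges.2 (Or.inr rfl)⟩ fun h =>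
      zero_notMem_vanishingEdges π j i (h ▸ Finset.mem_univ _)
  have hquot : ∏ i, z i ^ (vanishingEdges π j i).card =
      (∏ i, z i ^ ((vanishingEdges π j i).card - (2 * Γ.h1 (vanishingEdges π j i) + 1))) *
        (∏ i, z i ^ Γ.h1 (vanishingEdges π j i)) ^ 2 * ∏ i, z i := by
    rw [← Finset.prod_pow, ← Finset.prod_mul_distrib, ← Finset.prod_mul_distrib]
    refine Finset.prod_congr rfl fun i _ => ?_
    rw [← pow_mul, ← pow_add, ← pow_succ]
    congr 1
    have := hconv i
    omega
  have hP0 : ∏ i, z i ^ Γ.h1 (vanishingEdges π j i) ≠ 0 :=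
    Finset.prod_ne_zero_iff.2 fun i _ => pow_ne_zero _ (hz0 i)
  have hz0' : ∏ i, z i ≠ 0 := Finset.prod_ne_zero_iff.2 fun i _ => hz0 i
  have hΨ' : MvPolynomial.aeval (fun e => a e / a (π 0)) (Γ.graphPolynomial K) =
      N⁻¹ * ((∏ i, z i ^ Γ.h1 (vanishingEdges π j i)) * g) := by
    rw [← hf, inv_mul_cancel_left₀ hN0]
  have key : ((MvPolynomial.aeval a (Γ.graphPolynomial K)) ^ 2)⁻¹ *
      ((∏ i : Fin m, a i.castSucc) * (∏ k, z k)⁻¹) = N ^ 2 * (g⁻¹) ^ 2 *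
        ∏ i, z i ^ ((vanishingEdges π j i).card - (2 * Γ.h1 (vanishingEdges π j i) + 1)) := by
    rw [hΨ, hprod, hb, hquot, hΨ']
    field_simp
  rw [key]
  exact mul_mem (mul_mem (pow_mem (natCast_mem _ _) _) (pow_mem hgi _))
    (prod_mem fun i _ => pow_mem (hz i) _)

/-- The generic point of a coordinate divisor of a chart does not lie on the strict transform of the
graph hypersurface. -/
theorem not_vanishesAt_of_ringKrullDim_eq_one [CharZero K] {f : MvPolynomial (Fin m) ℤ}
    (hf : 0 < f.coeff 0) {D : LocalSubring (FunctionField K m)} (hD : IsLocAt (toricRing K π j) D)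
    (hdim : ringKrullDim D.toSubring = 1) {i : Fin m} (hi : VanishesAt D (chartCoord K π j i)) :
    ¬ VanishesAt D (MvPolynomial.aeval (chartCoord K π j) f) := by
  obtain ⟨T, hT, hTJ⟩ := exists_generic_point (K := K) π j {i}
  have hDT := hD.le_generic_point hT hTJ (by
    rintro _ rfl
    exact hi)
  have hKD : Ring.KrullDimLE 1 D.toSubring := by
    rw [Ring.krullDimLE_iff, hdim]
    exact le_rfl
  have hmax := Ring.krullDimLE_one_iff_of_noZeroDivisors.1 hKD (centerIdeal D.toSubring T hDT)
    (fun h => by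
      have : (⟨_, hi.mem⟩ : D.toSubring) ∈ centerIdeal D.toSubring T hDT :=
        mem_centerIdeal.2 ((generic_point_vanishesAt_coord hTJ i).2 rfl)
      rw [h, Ideal.mem_bot] at this
      exact chartCoord_ne_zero i (congrArg Subtype.val this)) inferInstance
  rintro ⟨hmem, hv⟩
  rw [← IsLocalRing.eq_maximalIdeal hmax] at hv
  exact not_vanishesAt_aeval_of_coeff_zero hf hTJ (mem_centerIdeal.1 hv)

end Form

/-! ### Real points -/

section RealPoints

variable {K : Type*} [Field K] {m : ℕ}

theorem map_aeval_int {T : Subring (FunctionField K m)} (ψ : T →+* ℝ)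
    {z : Fin m → FunctionField K m} (hz : ∀ i, z i ∈ T) (f : MvPolynomial (Fin m) ℤ)
    (h : MvPolynomial.aeval z f ∈ T) :
    ψ ⟨MvPolynomial.aeval z f, h⟩ = MvPolynomial.aeval (fun i => ψ ⟨z i, hz i⟩) f := by
  induction f using MvPolynomial.induction_on with
  | C r =>
    have : (⟨MvPolynomial.aeval z (MvPolynomial.C r), h⟩ : T) = (r : T) :=
      Subtype.ext ((MvPolynomial.aeval_C z r).trans ((eq_intCast _ r).trans
        (T.coe_intCast r).symm))
    rw [this, map_intCast, MvPolynomial.aeval_C, eq_intCast]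
  | add p q hp hq =>
    refine Eq.trans ?_ (map_add _ p q).symm
    rw [← hp (aeval_int_mem hz p), ← hq (aeval_int_mem hz q), ← map_add]
    exact congrArg ψ (Subtype.ext (map_add _ p q))
  | mul_X p i hp =>
    refine Eq.trans ?_ (map_mul _ p _).symm
    rw [MvPolynomial.aeval_X, ← hp (aeval_int_mem hz p), ← map_mul]
    exact congrArg ψ (Subtype.ext
      ((map_mul _ p _).trans (congrArg _ (MvPolynomial.aeval_X z i))))

theorem aeval_pos {σ : Type*} {f : MvPolynomial σ ℤ} (hf : ∀ s, 0 ≤ f.coeff s)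
    (hf0 : 0 < f.coeff 0) {y : σ → ℝ} (hy : ∀ i, 0 ≤ y i) : 0 < MvPolynomial.aeval y f := by
  rw [MvPolynomial.aeval_def, MvPolynomial.eval₂_eq]
  refine Finset.sum_pos' (fun s _ => ?_) ⟨0, MvPolynomial.mem_support_iff.2 hf0.ne', ?_⟩
  · exact mul_nonneg (by simpa using hf s) (Finset.prod_nonneg fun i _ => pow_nonneg (hy i) _)
  · simpa using hf0

variable [Algebra K ℝ]

theorem eval_eq_zero_of_vanishesAt {F : Type*} [Field F] [Algebra K F] {X : Set (LocalSubring F)}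
    (p : RealPoint K X) {f : F} (h : VanishesAt p.point f) : p.eval ⟨f, h.mem⟩ = 0 := by
  by_contra hne
  obtain ⟨hf, hm⟩ := h
  exact (IsLocalRing.mem_maximalIdeal _).1 hm (p.isLocalHom_eval.map_nonunit _ (Ne.isUnit hne))

theorem eval_ne_zero_of_not_vanishesAt {F : Type*} [Field F] [Algebra K F]
    {X : Set (LocalSubring F)} (p : RealPoint K X) {f : F} (hf : f ∈ p.point.toSubring)
    (h : ¬ VanishesAt p.point f) : p.eval ⟨f, hf⟩ ≠ 0 := by
  have hu : IsUnit (⟨f, hf⟩ : p.point.toSubring) := by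
    by_contra hu
    exact h ⟨hf, (IsLocalRing.mem_maximalIdeal _).2 hu⟩
  exact (hu.map p.eval).ne_zero

theorem isOpen_regular_mem {F : Type*} [Field F] [Algebra K F] {X : Set (LocalSubring F)} (f : F)
    {O : Set ℝ} (hO : IsOpen O) :
    IsOpen {p : RealPoint K X | ∃ h : f ∈ p.point.toSubring, p.eval ⟨f, h⟩ ∈ O} :=
  TopologicalSpace.isOpen_generateFrom_of_mem ⟨f, O, hO, rfl⟩

variable {𝓢 : Finset (Finset (Fin (m + 1)))}

/-- On the strict transform of the positive simplex, the coordinates of an adapted toric chart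
are non-negative. -/
theorem eval_chartCoord_nonneg {P : Stage (FunctionField K m)} (hP : IsBlowupOf K m P 𝓢)
    {π : Equiv.Perm (Fin (m + 1))} {j : Fin (m + 1)} (h : IsAdapted 𝓢 π j) {p : RealPoint K P.space}
    (hp : p ∈ strictPositiveSimplex K m P)
    (hle : toricRing K π j ≤ p.point.toSubring) (i : Fin m) :
    0 ≤ p.eval ⟨chartCoord K π j i, chartCoord_mem hle i⟩ := by
  by_contra! hneg
  -- a neighbourhood of `p` in the chart, on which the coordinate is negative
  have hopen : IsOpen ((⋂ l : Fin m, {q : RealPoint K P.space |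
      ∃ h : chartCoord K π j l ∈ q.point.toSubring, q.eval ⟨_, h⟩ ∈ Set.univ}) ∩
      {q | ∃ h : chartCoord K π j i ∈ q.point.toSubring, q.eval ⟨_, h⟩ ∈ Set.Iio 0}) :=
    (isOpen_iInter_of_finite fun l => isOpen_regular_mem _ isOpen_univ).inter
      (isOpen_regular_mem _ isOpen_Iio)
  obtain ⟨q, ⟨hq1, hzi, hqi⟩, hqpos, hqex⟩ := mem_closure_iff.1 hp _ hopen
    ⟨Set.mem_iInter.2 fun l => ⟨chartCoord_mem hle l, Set.mem_univ _⟩, chartCoord_mem hle i, hneg⟩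
  have hqm : q.point ∈ ratioModel K (affineCoord K m) 𝓢 := hP.space_eq ▸ q.point_mem
  have hqle : toricRing K π j ≤ q.point.toSubring :=
    toricRing_le (algebraMap_mem_of_mem_ratioModel hqm) fun l => (Set.mem_iInter.1 hq1 l).1
  have hqout : q.point ∈ outside K m 𝓢 := by
    by_contra hn
    rw [hP.exceptional_eq] at hqex
    exact hqex ⟨hqm, hn⟩
  obtain ⟨j', hj'⟩ := hqpos
  choose hmem hnonneg using hj'
  have hchart : ∀ e, affineCoord K m e / affineCoord K m (π 0) ∈ q.point.toSubring := fun e =>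
    hqle (chartRing_le_toricRing π j (div_mem_chartRing _ _))
  have hv : ¬ VanishesAt q.point (coordRatio K m (π (min i.castSucc j)) j') := by
    intro hv
    refine h.not_vanishesAt hqout hqle (min_le_right i.castSucc j) ?_
    rw [← div_mul_div_cancel₀ (affineCoord_ne_zero j')]
    exact hv.mul_right (hchart j')
  have hpos := (hnonneg (π (min i.castSucc j))).lt_of_ne'
    (eval_ne_zero_of_not_vanishesAt q (hmem _) hv)
  have hmul : q.eval ⟨_, hzi⟩ * q.eval ⟨_, hmem (π (min i.castSucc j))⟩ =
      q.eval ⟨_, hmem (π i.succ)⟩ := by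
    rw [← map_mul]
    congr 1
    exact Subtype.ext (div_mul_div_cancel₀ (affineCoord_ne_zero _))
  have h1 := mul_neg_of_neg_of_pos hqi hpos
  rw [hmul] at h1
  exact absurd (hnonneg _) h1.not_ge

end RealPoints

end GraphMotive

theorem mainTheorem3 {K : Type*} [Field K] [Algebra K ℝ] {V : Type*} [Finite V] {m n : ℕ}
    (Γ : GraphMotive.OrientedGraph V (Fin (m + 1))) (hΓ : Γ.IsPrimitiveLogDivergent n) :
    ∃ S : List (Finset (Fin (m + 1))),
      (∀ s ∈ S, (GraphMotive.coordSubspace K m s).Nonempty ∧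
        GraphMotive.coordSubspace K m s ⊆ GraphMotive.graphHypersurface K Γ) ∧
      ∃ (P : GraphMotive.Stage (GraphMotive.FunctionField K m))
        (Y B : Set (LocalSubring (GraphMotive.FunctionField K m))),
        P = GraphMotive.tower K m S ∧
        Y = P.strict (GraphMotive.graphHypersurface K Γ) ∧
        B = GraphMotive.inverseImage P.space (GraphMotive.coordSimplex K m) ∧
        -- no poles at the generic points of the exceptional divisors
        (∀ D ∈ P.exceptional, ringKrullDim D.toSubring = 1 →
          GraphMotive.IsRegularFormAt K (GraphMotive.graphForm K Γ) D) ∧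
        GraphMotive.IsNormalCrossingsDivisor P.space B ∧
        (∀ C ∈ GraphMotive.faces P.space B, ¬ C ⊆ Y) ∧
        (∀ p ∈ GraphMotive.strictPositiveSimplex K m P, p.point ∉ Y) := by
  open GraphMotive in
  have hchar : CharZero K := (algebraMap K ℝ).charZero_iff (algebraMap K ℝ).injective |>.2
    inferInstance
  let 𝓢 : Finset (Finset (Fin (m + 1))) := Finset.univ.filter fun S => 0 < Γ.h1 S
  have h𝓢 : ∀ S, S ∈ 𝓢 ↔ 0 < Γ.h1 S := fun S => by simp [𝓢]
  have hupper : IsUpperSet (𝓢 : Set (Finset (Fin (m + 1)))) := fun A B hAB hA =>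
    (h𝓢 B).2 (((h𝓢 A).1 hA).trans_le (Γ.h1_mono hAB))
  have huniv : Finset.univ ∈ 𝓢 := by
    have := hΓ.edges
    rw [Fintype.card_fin] at this
    rw [h𝓢, hΓ.loops]
    omega
  have hempty : ∅ ∉ 𝓢 := by
    rw [h𝓢, Γ.h1_empty]
    exact lt_irrefl 0
  obtain ⟨L, hL, hP⟩ := exists_tower (K := K) hupper huniv hempty
  refine ⟨L, fun s hs => ⟨coordSubspace_nonempty (hL s hs).2,
    coordSubspace_subset_graphHypersurface ((h𝓢 s).1 (hL s hs).1)⟩, tower K m L, _, _,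
    rfl, rfl, rfl, fun D hD hdim => ?_, ?_, fun C hC hCY => ?_, fun p hp hpY => ?_⟩
  · rw [hP.exceptional_eq] at hD
    obtain ⟨π, j, h, hloc⟩ := exists_isAdapted hupper huniv hempty hD.1
    obtain ⟨f, -, hf0, hf⟩ := Γ.exists_strict_equation (K := K) h𝓢 h
    refine isRegularFormAt_graphForm hΓ hf hloc.1 ?_
    obtain ⟨i, -, hi⟩ : ∃ i ≤ j, VanishesAt D (affineCoord K m (π i) / affineCoord K m (π 0)) := by
      by_contra! hcon
      exact hD.2 (h.mem_outside hupper hloc hcon)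
    rw [div_eq_prod_chartCoord π j] at hi
    obtain ⟨l, -, hl⟩ := hi.exists_of_prod _ _ fun l _ => chartCoord_mem hloc.1 l
    exact not_vanishesAt_of_ringKrullDim_eq_one hf0 hloc hdim hl
  · rw [hP.space_eq]
    exact isNormalCrossingsDivisor_coordSimplex hupper huniv hempty
  · rw [hP.space_eq] at hC
    obtain ⟨π, j, h, O, hOC, hO, hOJ⟩ := exists_origin_mem_face hupper huniv hempty hC
    obtain ⟨f, -, hf0, hf⟩ := Γ.exists_strict_equation (K := K) h𝓢 h
    exact not_vanishesAt_aeval_of_coeff_zero hf0 hOJ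
      (vanishesAt_of_mem_strict_graphHypersurface h𝓢 h hf hO.1
        (hP.strict_subset _ (zeroLocus_subset _) (hCY hOC)))
  · have hpm : p.point ∈ ratioModel K (affineCoord K m) 𝓢 := hP.space_eq ▸ p.point_mem
    obtain ⟨π, j, h, hloc⟩ := exists_isAdapted hupper huniv hempty hpm
    obtain ⟨f, hfpos, hf0, hf⟩ := Γ.exists_strict_equation (K := K) h𝓢 h
    have hv := vanishesAt_of_mem_strict_graphHypersurface h𝓢 h hf hloc.1
        (hP.strict_subset _ (zeroLocus_subset _) hpY)
    have h0 := eval_eq_zero_of_vanishesAt p hv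
    have hpos := aeval_pos hfpos hf0 (eval_chartCoord_nonneg hP h hp hloc.1)
    exact hpos.ne' ((map_aeval_int p.eval (chartCoord_mem hloc.1) f hv.mem).symm.trans h0)
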